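/- Let $n\ge 2$ and $k\ge 1$ be integers. The dominant integral weights $\hat\lambda=\sum_{i=1}^n m_i\hat\omega_i$ of $\widehat{\mathfrak{su}}(n)$ at level $k=\sum_i m_i$ are labelled by the set $P$ of partitions $\lambda$ with at most $n-1$ rows and at most $k$ columns, via $\lambda_i-\lambda_{i+1}=m_i$ for $1\le i<n$. The fusion coefficients are defined by the Verlinde formula $$\mathcal N^{(k)\hat\nu}_{\hat\lambda\hat\mu}=\sum_{\sigma\in P}\frac{S_{\lambda\sigma}S_{\mu\sigma}S^{-1}_{\nu\sigma}}{S_{\emptyset\sigma}},\qquad S_{\lambda\sigma}=\frac{e^{i\pi n(n-1)/4}}{\sqrt{n(k+n)^{n-1}}}\sum_{w\in\mathbb S_n}(-1)^{\ell(w)}e^{-\frac{2\pi i}{k+n}(\sigma+\rho,\,w(\lambda+\rho))},$$ where in the second formula $\rho$ is the Weyl vector of $\mathfrak{su}(n)$. For a commutative ring $R$ let $h_m$ be the complete symmetric polynomials in $R[e_1,\dots,e_k]=R[x_1,\dots,x_k]^{\mathbb S_k}$ ($h_m=0$ for $m<0$), and for $\alpha\in\mathbb Z_{\ge0}^k$ let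 $s_\alpha=\det(h_{\alpha_i-i+j})_{1\le i,j\le k}$. Let $c_{\lambda\mu}^{\rho}$ be the Littlewood–Richardson coefficient, i.e. the number of Littlewood–Richardson tableaux of shape $\rho/\lambda$ and content $\mu$, and let $\lambda^t$ be the transposed partition. (a) Let $z\in R$ (for instance $R=\mathbb C$, or $R=\mathbb C[z]$). For every partition $\alpha=(\alpha_1\ge\dots\ge\alpha_k\ge0)$ with $\alpha_1\ge n$, $$s_{(\alpha_1,\dots,\alpha_k)}\equiv z\,s_{(\alpha_2,\dots,\alpha_k,\alpha_1-n)}\pmod{\langle h_n-z,\,h_{n+1},\dots,h_{n+k-1}\rangle}.$$ Moreover $s_{(\dots,a,b,\dots)}=-s_{(\dots,b-1,a+1,\dots)}$ for $b\ge1$, and $s_{(\dots,a,a+1,\dots)}=0$. (b) The following algorithm computes the fusion coefficients for all $\lambda,\mu\in P$. Step 1. Expand by the Littlewood–Richardson rule applied to the transposed partitions, discarding all terms for which $\rho^t$ has length $>k$; in $R[e_1,\dots,e_k]$ this reads $$s_{\lambda^t}s_{\mu^t}=\sum_{|\rho|=|\lambda|+|\mu|,\ \ell(\rho^t)\le k}c_{\lambda^t\mu^t}^{\rho^t}\,s_{\rho^t}.$$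 Step 2. Starting from each remaining term $s_{\rho^t}$, apply the following replacements as long as one of them is possible: $s_\alpha\to s_{(\alpha_2,\dots,\alpha_k,\alpha_1-n)}$ if $\alpha$ is a partition with $\alpha_1\ge n$; $s_{(\dots,a,b,\dots)}\to-s_{(\dots,b-1,a+1,\dots)}$ if $b>a+1$; $s_{(\dots,a,a+1,\dots)}\to0$. There is no infinite sequence of replacements, and no replacement is possible exactly for the terms $0$ and $\pm s_\alpha$ with $\alpha$ a partition and all $\alpha_i<n$. Step 3. For every choice of replacements, writing the final result for $\rho$ as $0$ or $\varepsilon_\rho s_{\alpha(\rho)}$ with $\varepsilon_\rho=\pm1$, one has for all $\nu\in P$ $$\mathcal N^{(k)\hat\nu}_{\hat\lambda\hat\mu}=\sum_{\rho:\ \alpha(\rho)=\nu^t}\varepsilon_\rho\,c_{\lambda^t\mu^t}^{\rho^t},$$ where the sum is over the $\rho$ remaining in Step 1 whose final result is nonzero. (c) The resulting expressions in Littlewood–Richardson coefficients differ from the Kac–Walton formula $\mathcal N^{(k)\hat\nu}_{\hat\lambda\hat\mu}=\sum_{w\in\hat W}\varepsilon(w)c_{\lambda\mu}^{(w\cdot\hat\nu)'}$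 (where $\hat W$ is the affine Weyl group with its shifted level-$k$ action, $(w\cdot\hat\nu)'$ is the partition corresponding to $w\cdot\hat\nu$, and partitions with at most $n$ rows that differ by columns of height $n$ stand for the same weight of $\mathfrak{su}(n)$): there are $n\ge2$, $k\ge1$, $\lambda,\mu,\nu\in P$ and a partition $\rho$ with $|\rho|=|\lambda|+|\mu|$ and $\ell(\rho^t)\le k$ such that $c_{\lambda\mu}^\rho\ne0$ and $c_{\lambda^t\mu^t}^{\rho^t}\neq0$, and such that the coefficient of $s_{\nu^t}$ in the final result of Step 2 for $\rho$ (which multiplies $c_{\lambda^t\mu^t}^{\rho^t}$ in Step 3) is, for every choice of replacements, different from the coefficient of $c_{\lambda\mu}^{\rho}$ in the Kac–Walton formula. -/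

import Mathlib

namespace Fusion

/-! ### Partitions in a box, and the modular S-matrix -/

theorem finite_setOf_cells_subset (s : Finset (ℕ × ℕ)) :
    {κ : YoungDiagram | κ.cells ⊆ s}.Finite := by
  refine Set.Finite.of_injOn (f := YoungDiagram.cells) (t := (s.powerset : Set (Finset (ℕ × ℕ))))
    ?_ ?_ s.powerset.finite_toSet
  · intro κ hκ
    simpa using hκ
  · intro κ _ κ' _ h
    exact YoungDiagram.ext h

/-- The partitions whose Young diagram has at most `n - 1` rows and at most `k` columns. They label
the dominant integral weights `∑ mᵢ ω̂ᵢ` of level `k`: `mᵢ = λᵢ - λᵢ₊₁` for `1 ≤ i < n`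
and `mₙ = k - λ₁`. -/
def Weight (n k : ℕ) : Type :=
  {lam : YoungDiagram // lam.colLen 0 ≤ n - 1 ∧ lam.rowLen 0 ≤ k}

noncomputable instance (n k : ℕ) : DecidableEq (Weight n k) := Classical.decEq _

theorem finite_weight (n k : ℕ) :
    {lam : YoungDiagram | lam.colLen 0 ≤ n - 1 ∧ lam.rowLen 0 ≤ k}.Finite := by
  refine (finite_setOf_cells_subset (Finset.range (n - 1) ×ˢ Finset.range k)).subset ?_
  rintro lam ⟨h1, h2⟩ ⟨i, j⟩ hc
  rw [YoungDiagram.mem_cells] at hc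
  have hi := YoungDiagram.mem_iff_lt_colLen.1 (lam.up_left_mem le_rfl (Nat.zero_le j) hc)
  have hj := YoungDiagram.mem_iff_lt_rowLen.1 (lam.up_left_mem (Nat.zero_le i) le_rfl hc)
  simp only [Finset.mem_product, Finset.mem_range]
  omega

noncomputable instance (n k : ℕ) : Fintype (Weight n k) := (finite_weight n k).fintype

/-- The weight `k ω̂ₙ` of the empty partition. -/
def Weight.empty (n k : ℕ) : Weight n k :=
  ⟨⊥, by
    constructor
    · by_contra h
      exact YoungDiagram.notMem_bot _ (YoungDiagram.mem_iff_lt_colLen.2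
        (show 0 < (⊥ : YoungDiagram).colLen 0 by omega))
    · by_contra h
      exact YoungDiagram.notMem_bot _ (YoungDiagram.mem_iff_lt_rowLen.2
        (show 0 < (⊥ : YoungDiagram).rowLen 0 by omega))⟩

/-- The coordinates `λᵢ + n - i` (`1 ≤ i ≤ n`) of `λ + ρ`. -/
def shifted (n : ℕ) (lam : YoungDiagram) (i : Fin n) : ℤ :=
  (lam.rowLen i : ℤ) + ((n : ℤ) - 1 - (i : ℤ))

/-- The invariant form on the weight space of `su(n)`, which is `ℝⁿ` modulo `(1, …, 1)`: the
standard inner product of the projections of `a` and `b` to the hyperplane `∑ xᵢ = 0`. -/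
noncomputable def weightInner {n : ℕ} (a b : Fin n → ℤ) : ℝ :=
  (∑ i, (a i : ℝ) * (b i : ℝ)) - (∑ i, (a i : ℝ)) * (∑ i, (b i : ℝ)) / (n : ℝ)

/-- The modular S-matrix of `su(n)` at level `k`, by the Kac-Peterson formula. -/
noncomputable def modularS (n k : ℕ) : Matrix (Weight n k) (Weight n k) ℂ :=
  Matrix.of fun lam sig =>
    Complex.exp (Complex.I * (Real.pi : ℂ) * ((n : ℂ) * ((n : ℂ) - 1)) / 4)
      / ((Real.sqrt ((n : ℝ) * ((k : ℝ) + (n : ℝ)) ^ (n - 1)) : ℝ) : ℂ)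
      * ∑ w : Equiv.Perm (Fin n), ((Equiv.Perm.sign w : ℤ) : ℂ) *
          Complex.exp (-(2 * (Real.pi : ℂ) * Complex.I) / ((k : ℂ) + (n : ℂ)) *
            ((weightInner (shifted n sig.1) (fun i => shifted n lam.1 (w i)) : ℝ) : ℂ))

/-- The fusion coefficient of `su(n)` at level `k`, by the Verlinde formula. -/
noncomputable def fusionCoeff (n k : ℕ) (lam mu nu : Weight n k) : ℂ :=
  ∑ sig : Weight n k,
    modularS n k lam sig * modularS n k mu sig * (modularS n k)⁻¹ nu sig
      / modularS n k (Weight.empty n k) sig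

/-! ### Littlewood-Richardson coefficients -/

/-- Littlewood-Richardson tableaux of skew shape `ρ/λ` and content `μ` (with entries counted
from `0`): semistandard fillings of `ρ/λ` with `μ_m` entries equal to `m`, such that, when the
entries are read row by row from top to bottom, each row from right to left, at every moment at most
as many `m + 1` as `m` have been read. -/
structure LRTableau (lam mu rho : YoungDiagram) where
  entry : ℕ → ℕ → ℕ
  le : lam ≤ rho
  zeros : ∀ i j, (i, j) ∉ rho.cells \ lam.cells → entry i j = 0
  row_weak : ∀ i j₁ j₂, j₁ < j₂ → (i, j₁) ∈ rho.cells \ lam.cells →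
    (i, j₂) ∈ rho.cells \ lam.cells → entry i j₁ ≤ entry i j₂
  col_strict : ∀ i₁ i₂ j, i₁ < i₂ → (i₁, j) ∈ rho.cells \ lam.cells →
    (i₂, j) ∈ rho.cells \ lam.cells → entry i₁ j < entry i₂ j
  content : ∀ m, ((rho.cells \ lam.cells).filter fun c => entry c.1 c.2 = m).card = mu.rowLen m
  lattice : ∀ i j, (i, j) ∈ rho.cells \ lam.cells → ∀ m,
    ((rho.cells \ lam.cells).filter fun c =>
        (c.1 < i ∨ (c.1 = i ∧ j ≤ c.2)) ∧ entry c.1 c.2 = m + 1).card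
      ≤ ((rho.cells \ lam.cells).filter fun c =>
        (c.1 < i ∨ (c.1 = i ∧ j ≤ c.2)) ∧ entry c.1 c.2 = m).card

/-- The Littlewood-Richardson coefficient `c_{λμ}^ρ`, by the Littlewood-Richardson rule. -/
noncomputable def lrCoeff (lam mu rho : YoungDiagram) : ℕ :=
  Nat.card (LRTableau lam mu rho)

/-- The first `k` parts of a partition. -/
def parts (k : ℕ) (κ : YoungDiagram) : Fin k → ℕ := fun i => κ.rowLen i

theorem finite_remaining (k N : ℕ) :
    {rho : YoungDiagram | rho.card = N ∧ rho.transpose.colLen 0 ≤ k}.Finite := by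
  refine (finite_setOf_cells_subset (Finset.range N ×ˢ Finset.range N)).subset ?_
  rintro rho ⟨h1, -⟩ ⟨i, j⟩ hc
  rw [YoungDiagram.mem_cells] at hc
  have hi := YoungDiagram.mem_iff_lt_colLen.1 hc
  have hj := YoungDiagram.mem_iff_lt_rowLen.1 hc
  have h2 : rho.colLen j ≤ rho.card := by
    rw [YoungDiagram.colLen_eq_card]
    exact Finset.card_le_card (Finset.filter_subset _ _)
  have h3 : rho.rowLen i ≤ rho.card := by
    rw [YoungDiagram.rowLen_eq_card]
    exact Finset.card_le_card (Finset.filter_subset _ _)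
  simp only [Finset.mem_product, Finset.mem_range]
  omega

/-- The partitions `ρ` of `N` for which the transposed partition `ρᵗ` has length at most `k`. -/
noncomputable def remaining (k N : ℕ) : Finset YoungDiagram := (finite_remaining k N).toFinset

/-! ### Schur polynomials and the Bethe ansatz ideal

The ring `R[e₁, …, e_k]` is the ring of symmetric polynomials in `k` variables. -/

section Ring

variable (R : Type*) [CommRing R] (k : ℕ)

/-- The complete symmetric polynomial `h_m` in `k` variables, with `h_m = 0` for `m < 0`. -/
noncomputable def hSym (m : ℤ) : MvPolynomial.symmetricSubalgebra (Fin k) R :=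
  if 0 ≤ m then
    ⟨MvPolynomial.hsymm (Fin k) R m.toNat, MvPolynomial.hsymm_isSymmetric (Fin k) R m.toNat⟩
  else 0

variable {k}

/-- The Schur polynomial `s_α = det (h_{αᵢ - i + j})` of a sequence `α = (α₁, …, α_k)`, which need
not be weakly decreasing. -/
noncomputable def schur (α : Fin k → ℕ) : MvPolynomial.symmetricSubalgebra (Fin k) R :=
  Matrix.det (Matrix.of fun i j : Fin k => hSym R k ((α i : ℤ) - (i : ℤ) + (j : ℤ)))

variable {R}

/-- The ideal `⟨h_n - z, h_{n+1}, …, h_{n+k-1}⟩`. -/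
noncomputable def betheIdeal (n k : ℕ) (z : R) :
    Ideal (MvPolynomial.symmetricSubalgebra (Fin k) R) :=
  Ideal.span ({hSym R k n - algebraMap R _ z} ∪
    {f | ∃ j : ℕ, 1 ≤ j ∧ j ≤ k - 1 ∧ f = hSym R k ((n : ℤ) + (j : ℤ))})

end Ring

/-! ### The reduction of Schur polynomials -/

/-- `(α₁, …, α_k) ↦ (α₂, …, α_k, α₁ - n)`; used only for `n ≤ α₁`. -/
def rimReduce (n : ℕ) {k : ℕ} (α : Fin k → ℕ) : Fin k → ℕ := fun i =>
  if h : i.1 + 1 < k then α ⟨i.1 + 1, h⟩ else α ⟨0, i.pos⟩ - n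

/-- `(…, a, b, …) ↦ (…, b - 1, a + 1, …)` in the positions `i`, `i + 1`; used only for `1 ≤ b`. -/
def straighten {k : ℕ} (α : Fin k → ℕ) (i : ℕ) (h : i + 1 < k) : Fin k → ℕ :=
  Function.update (Function.update α ⟨i, by omega⟩ (α ⟨i + 1, h⟩ - 1))
    ⟨i + 1, h⟩ (α ⟨i, by omega⟩ + 1)

/-- Formal terms `0` and `± s_α`. -/
inductive SchurTerm (k : ℕ) : Type
  | zero : SchurTerm k
  | signed (ε : ℤˣ) (α : Fin k → ℕ) : SchurTerm k

namespace SchurTerm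

/-- One step of the reduction. -/
inductive Step (n : ℕ) {k : ℕ} : SchurTerm k → SchurTerm k → Prop
  | rim (ε : ℤˣ) (α : Fin k → ℕ) (hk : 0 < k) (hα : Antitone α) (hn : n ≤ α ⟨0, hk⟩) :
      Step n (signed ε α) (signed ε (rimReduce n α))
  | swap (ε : ℤˣ) (α : Fin k → ℕ) (i : ℕ) (h : i + 1 < k)
      (hα : α ⟨i, by omega⟩ + 1 < α ⟨i + 1, h⟩) :
      Step n (signed ε α) (signed (-ε) (straighten α i h))
  | vanish (ε : ℤˣ) (α : Fin k → ℕ) (i : ℕ) (h : i + 1 < k)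
      (hα : α ⟨i + 1, h⟩ = α ⟨i, by omega⟩ + 1) :
      Step n (signed ε α) zero

/-- The terms `0`, and `± s_α` with `α` a partition all of whose parts are less than `n`. -/
def IsReduced (n : ℕ) {k : ℕ} : SchurTerm k → Prop
  | zero => True
  | signed _ α => Antitone α ∧ ∀ i, α i < n

/-- The coefficient of `s_β` in a term. -/
def coeff {k : ℕ} : SchurTerm k → (Fin k → ℕ) → ℤ
  | zero, _ => 0
  | signed ε α, β => if α = β then (ε : ℤ) else 0

/-- `t` is a possible final result of the reduction of `s_α`. -/
def IsResult (n : ℕ) {k : ℕ} (α : Fin k → ℕ) (t : SchurTerm k) : Prop :=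
  Relation.ReflTransGen (Step n) (signed 1 α) t ∧ t.IsReduced n

end SchurTerm

/-! ### The Kac-Walton formula -/

open Classical in
/-- The coefficient of `c_{λμ}^ρ` in the Kac-Walton expression `∑_{w ∈ Ŵ} ε(w) c_{λμ}^{(w·ν)'}` for
the fusion coefficient of `λ, μ, ν`. The affine Weyl group `Ŵ` of `su(n)` consists of the pairs of a
permutation `π` and a translation `β ∈ ℤⁿ` with `∑ βᵢ = 0`; it acts on `x = ν + ρ` at level `k` by
`x ↦ (x_{π i} + (n + k) βᵢ)ᵢ`, and `ε(π, β)` is the sign of `π`. The weight of `su(n)` given by a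
partition with at most `n` rows does not change when columns of height `n` are added or removed,
which is the constant `c`. -/
noncomputable def kacWaltonCoeff (n k : ℕ) (nu rho : YoungDiagram) : ℤ :=
  if rho.colLen 0 ≤ n then
    ∑ π : Equiv.Perm (Fin n),
      if ∃ (β : Fin n → ℤ) (c : ℤ), ∑ i, β i = 0 ∧
          ∀ i, shifted n rho i = shifted n nu (π i) + ((n : ℤ) + (k : ℤ)) * β i + c
      then (Equiv.Perm.sign π : ℤ) else 0
  else 0

end Fusion

/-! The bridge between the Verlinde formula and symmetric polynomials is a set of solutions of the
Bethe ansatz equations indexed by `P`. The boundary of `σ` in a box with `n` rows and `k` columns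
splits the positions 0, …, n+k-1 into `n` vertical and `k` horizontal steps. To position `r` belongs
the number `phase n k σ r`, a power of a primitive (n+k)-th root of unity times a factor common to
all positions. The vertical values form `charPoint`, and the Kac-Peterson sum is an alternant there,
so S_{λσ}/S_{∅σ} is s_λ at that point. The negated horizontal values form `bethePoint`. The powers
of the values make up a multiple of a unitary Fourier-type matrix with explicit inverse, and
Jacobi's theorem on complementary minors turns s_λ(`charPoint`) into s_{λᵗ}(`bethePoint`); this is
`alternant_charPoint`, whence `modularS_eq`. At the Bethe points h_n = 1 and h_{n+1} = … = h_{n+k-1}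
= 0, so the ideal for z = 1 vanishes there and reductions preserve values.

For the reduction itself: modulo the ideal the tail h_n, h_{n+1}, … is essentially the sequence h
again, shifted by `k` and multiplied by a constant (`IsBetheSequence.eq_shift`). Hence a
Jacobi-Trudi row with a large exponent is a multiple of a row whose exponent is lower
(`IsBetheSequence.jacobiTrudi_rim`), and a rotation of rows gives (a). Straightening is an exchange
of rows. Termination is a lexicographic descent.

The Littlewood-Richardson rule comes from expanding the Jacobi-Trudi determinant of s_μ, iterating
Pieri's rule, and cancelling by a sign-reversing involution of Bender-Knuth type on chains of
partitions (`schurSeq_mul_eq_sum_chains`); the surviving chains are the tableaux (`tableauEquiv`).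

Finally, the h_m separate the Bethe points, so the reduced Schur functions span all functions on `P`
and S is invertible (`isUnit_det_modularS`). The Verlinde sum then reads off the coefficients of a
reduced expansion, whatever replacements produced it (`fusionCoeff_eq`). Part (c) is settled by
columns for n = 3, k = 1. -/

namespace Fusion

open Finset

/-! ### Complete symmetric functions, alternants and the Jacobi-Trudi identity. -/

section Symmetric

variable {A : Type*} [CommRing A] {k : ℕ}

/-- The complete homogeneous symmetric function of degree `m` of a family `x`. -/
noncomputable def complete (x : Fin k → A) (m : ℤ) : A :=
  if 0 ≤ m then ∑ l ∈ Finset.piAntidiag Finset.univ m.toNat, ∏ i, x i ^ l i else 0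

/-- The determinant `det (x_l ^ p_i)`. -/
def alternant (x : Fin k → A) (p : Fin k → ℕ) : A :=
  Matrix.det (Matrix.of fun i l : Fin k => x l ^ p i)

/-- The determinant of the vectors `(h_{p-k+1}, …, h_p)`, where `p` runs through the `p_i`. -/
def jacobiTrudi (h : ℤ → A) (p : Fin k → ℤ) : A :=
  Matrix.det (Matrix.of fun i j : Fin k => h (p i - ((k : ℤ) - 1) + (j : ℤ)))

/-- The staircase `(k - 1, …, 1, 0)`. -/
def staircase (k : ℕ) (i : Fin k) : ℕ := k - 1 - i

theorem complete_of_neg (x : Fin k → A) {m : ℤ} (hm : m < 0) : complete x m = 0 := by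
  simp [complete, hm]

theorem complete_natCast (x : Fin k → A) (m : ℕ) :
    complete x m = ∑ l ∈ Finset.piAntidiag Finset.univ m, ∏ i, x i ^ l i := by
  simp [complete]

theorem complete_zero (x : Fin k → A) : complete x 0 = 1 := by
  simp [complete]

theorem map_complete {B : Type*} [CommRing B] (f : A →+* B) (x : Fin k → A) (m : ℤ) :
    f (complete x m) = complete (fun i => f (x i)) m := by
  unfold complete
  split_ifs <;> simp

theorem map_jacobiTrudi {B : Type*} [CommRing B] (f : A →+* B) (h : ℤ → A) (p : Fin k → ℤ) :
    f (jacobiTrudi h p) = jacobiTrudi (fun m => f (h m)) p := by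
  unfold jacobiTrudi
  rw [RingHom.map_det]
  rfl

theorem geom_mul_one_sub (a : A) :
    PowerSeries.mk (fun n => a ^ n) * (1 - PowerSeries.C a * PowerSeries.X) = 1 := by
  ext n
  rw [mul_sub, mul_one, map_sub, ← mul_assoc]
  cases n with
  | zero => simp
  | succ n => simp [PowerSeries.coeff_succ_mul_X, PowerSeries.coeff_mul_C, pow_succ,
      PowerSeries.coeff_one]

theorem mk_complete (x : Fin k → A) :
    PowerSeries.mk (fun n => complete x (n : ℕ)) = ∏ i, PowerSeries.mk (fun n => x i ^ n) := by
  ext n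
  rw [PowerSeries.coeff_prod]
  simp only [PowerSeries.coeff_mk, complete_natCast]
  refine Finset.sum_equiv Finsupp.equivFunOnFinite.symm ?_ ?_
  · intro l
    simp [Finset.sum]
  · intro l _
    simp

/-- The power series `∏ (1 - x_i t)`. -/
noncomputable def elementarySeries {ι : Type*} (s : Finset ι) (x : ι → A) : PowerSeries A :=
  ∏ i ∈ s, (1 - PowerSeries.C (x i) * PowerSeries.X)

theorem mk_complete_mul_elementarySeries (x : Fin k → A) :
    PowerSeries.mk (fun n => complete x (n : ℕ)) * elementarySeries univ x = 1 := by
  rw [mk_complete, elementarySeries, ← Finset.prod_mul_distrib]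
  simp [geom_mul_one_sub]

theorem coeff_elementarySeries_of_card_lt {ι : Type*} [DecidableEq ι] (s : Finset ι) (x : ι → A) :
    ∀ r, s.card < r → PowerSeries.coeff r (elementarySeries s x) = 0 := by
  induction s using Finset.induction_on with
  | empty => intro r hr; simp at hr; simp [elementarySeries, PowerSeries.coeff_one]; omega
  | insert a s ha ih =>
    intro r hr
    rw [Finset.card_insert_of_notMem ha] at hr
    obtain ⟨r, rfl⟩ : ∃ r', r = r' + 1 := ⟨r - 1, by omega⟩
    have : elementarySeries (insert a s) x = elementarySeries s x -
        PowerSeries.C (x a) * (elementarySeries s x * PowerSeries.X) := by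
      rw [elementarySeries, Finset.prod_insert ha]
      simp only [elementarySeries]; ring
    rw [this, map_sub, PowerSeries.coeff_C_mul, PowerSeries.coeff_succ_mul_X, ih _ (by omega),
      ih _ (by omega)]
    simp

theorem coeff_card_elementarySeries {ι : Type*} [DecidableEq ι] (s : Finset ι) (x : ι → A) :
    PowerSeries.coeff s.card (elementarySeries s x) = (-1) ^ s.card * ∏ i ∈ s, x i := by
  induction s using Finset.induction_on with
  | empty => simp [elementarySeries]
  | insert a s ha ih =>
    have : elementarySeries (insert a s) x = elementarySeries s x -
        PowerSeries.C (x a) * (elementarySeries s x * PowerSeries.X) := by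
      rw [elementarySeries, Finset.prod_insert ha]
      simp only [elementarySeries]; ring
    rw [Finset.card_insert_of_notMem ha, this, map_sub, PowerSeries.coeff_C_mul,
      PowerSeries.coeff_succ_mul_X, ih, Finset.prod_insert ha,
      coeff_elementarySeries_of_card_lt _ _ _ (Nat.lt_succ_self _)]
    ring

theorem coeff_zero_elementarySeries {ι : Type*} (s : Finset ι) (x : ι → A) :
    PowerSeries.coeff 0 (elementarySeries s x) = 1 := by
  simp [elementarySeries, map_prod]

/-- `∑ (-1)^r e_r h_{p-r} = 0` for `p ≥ 1`. -/
theorem sum_coeff_mul_complete (x : Fin k → A) (p : ℕ) (hp : 1 ≤ p) :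
    ∑ r ∈ range (k + 1), PowerSeries.coeff r (elementarySeries univ x) *
      complete x ((p : ℤ) - (r : ℤ)) = 0 := by
  have h := congrArg (PowerSeries.coeff p) (mk_complete_mul_elementarySeries x)
  rw [mul_comm, PowerSeries.coeff_mul, Finset.Nat.sum_antidiagonal_eq_sum_range_succ_mk,
    PowerSeries.coeff_one, if_neg (by omega)] at h
  simp only [PowerSeries.coeff_mk] at h
  have e1 : ∑ r ∈ range (p + 1 + (k + 1)), PowerSeries.coeff r (elementarySeries univ x) *
      complete x ((p : ℤ) - (r : ℤ)) = 0 := by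
    rw [← h]
    symm
    refine Finset.sum_subset_zero_on_sdiff (by intro; simp; omega) ?_ ?_
    · intro r hr
      simp at hr
      rw [complete_of_neg _ (by omega), mul_zero]
    · intro r hr
      simp at hr
      rw [Nat.cast_sub (by omega)]
  rw [← e1]
  refine Finset.sum_subset_zero_on_sdiff (by intro; simp; omega) ?_ (fun _ _ => rfl)
  intro r hr
  simp at hr
  rw [coeff_elementarySeries_of_card_lt _ _ _ (by simp; omega), zero_mul]

/-- In ∏ 1/(1 - x_i t), multiplying by all factors 1 - x_i t with i ≠ l leaves 1/(1 - x_l t); this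
compares coefficients of t^p. The index `j` stands for the degree k-1-j, which makes the left side a
matrix product. -/
theorem sum_coeff_erase_mul_complete (x : Fin k → A) (l : Fin k) (p : ℕ) :
    ∑ j : Fin k, complete x ((p : ℤ) - ((k : ℤ) - 1) + (j : ℤ)) *
      PowerSeries.coeff (k - 1 - j) (elementarySeries (univ.erase l) x) = x l ^ p := by
  have h1 : elementarySeries univ x =
      (1 - PowerSeries.C (x l) * PowerSeries.X) * elementarySeries (univ.erase l) x := by
    rw [elementarySeries, ← Finset.mul_prod_erase _ _ (mem_univ l)]; rfl
  have h2 : PowerSeries.mk (fun n => complete x (n : ℕ)) * elementarySeries (univ.erase l) x =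
      PowerSeries.mk (fun n => x l ^ n) := by
    calc _ = PowerSeries.mk (fun n => complete x (n : ℕ)) * elementarySeries (univ.erase l) x *
          (PowerSeries.mk (fun n => x l ^ n) * (1 - PowerSeries.C (x l) * PowerSeries.X)) := by
            rw [geom_mul_one_sub, mul_one]
      _ = PowerSeries.mk (fun n => complete x (n : ℕ)) * elementarySeries univ x *
            PowerSeries.mk (fun n => x l ^ n) := by rw [h1]; ring
      _ = _ := by rw [mk_complete_mul_elementarySeries, one_mul]
  have h := congrArg (PowerSeries.coeff p) h2
  rw [mul_comm, PowerSeries.coeff_mul, Finset.Nat.sum_antidiagonal_eq_sum_range_succ_mk] at h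
  simp only [PowerSeries.coeff_mk] at h
  have hk : 0 < k := l.pos
  rw [← h, Fin.sum_univ_eq_sum_range (fun j => complete x ((p : ℤ) - ((k : ℤ) - 1) + (j : ℤ)) *
      PowerSeries.coeff (k - 1 - j) (elementarySeries (univ.erase l) x)), ← Finset.sum_range_reflect]
  have e1 : ∀ r ∈ range k, complete x ((p : ℤ) - ((k : ℤ) - 1) + ((k - 1 - r : ℕ) : ℤ)) *
      PowerSeries.coeff (k - 1 - (k - 1 - r)) (elementarySeries (univ.erase l) x) =
      PowerSeries.coeff r (elementarySeries (univ.erase l) x) * complete x ((p : ℤ) - (r : ℤ)) := by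
    intro r hr
    simp at hr
    have e1 : ((p : ℤ) - ((k : ℤ) - 1) + ((k - 1 - r : ℕ) : ℤ)) = (p : ℤ) - (r : ℤ) := by omega
    have e2 : k - 1 - (k - 1 - r) = r := by omega
    rw [e1, e2, mul_comm]
  rw [Finset.sum_congr rfl e1]
  have e2 : ∑ r ∈ range k, PowerSeries.coeff r (elementarySeries (univ.erase l) x) *
      complete x ((p : ℤ) - (r : ℤ)) = ∑ r ∈ range (p + 1 + k),
      PowerSeries.coeff r (elementarySeries (univ.erase l) x) * complete x ((p : ℤ) - (r : ℤ)) := by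
    refine Finset.sum_subset_zero_on_sdiff (by intro; simp; omega) ?_ (fun _ _ => rfl)
    intro r hr
    simp at hr
    rw [coeff_elementarySeries_of_card_lt _ _ _ (by simp; omega), zero_mul]
  rw [e2]
  symm
  refine Finset.sum_subset_zero_on_sdiff (by intro; simp; omega) ?_ ?_
  · intro r hr
    simp at hr
    rw [complete_of_neg _ (by omega), mul_zero]
  · intro r hr
    simp at hr
    rw [Nat.cast_sub (by omega)]

theorem jacobiTrudi_staircase (x : Fin k → A) :
    jacobiTrudi (complete x) (fun i => (staircase k i : ℤ)) = 1 := by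
  unfold jacobiTrudi
  rw [Matrix.det_of_isUpperTriangular]
  · apply Finset.prod_eq_one
    intro i _
    rw [Matrix.of_apply, ← complete_zero x]
    congr 1
    simp only [staircase]
    omega
  · intro i j hij
    rw [Matrix.of_apply]
    apply complete_of_neg
    simp only [staircase, id] at hij ⊢
    omega

/-- The Jacobi-Trudi identity. -/
theorem alternant_eq (x : Fin k → A) (p : Fin k → ℕ) :
    alternant x p = alternant x (staircase k) * jacobiTrudi (complete x) (fun i => (p i : ℤ)) := by
  -- The factor `M` does not involve the exponents, so its determinant can be read off from the
  -- staircase, where the Jacobi-Trudi matrix is unitriangular.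
  set M : Matrix (Fin k) (Fin k) A := Matrix.of fun j l =>
    PowerSeries.coeff (k - 1 - j) (elementarySeries (univ.erase l) x)
  have key : ∀ q : Fin k → ℕ,
      alternant x q = jacobiTrudi (complete x) (fun i => (q i : ℤ)) * M.det := by
    intro q
    unfold jacobiTrudi alternant
    rw [← Matrix.det_mul]
    congr 1
    ext i l
    rw [Matrix.mul_apply]
    simp only [Matrix.of_apply, M]
    rw [sum_coeff_erase_mul_complete]
  rw [key p, key (staircase k), jacobiTrudi_staircase, one_mul, mul_comm]

/-- In the Leibniz expansion each permutation contributes a monomial; multiplying it by h_m adds all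
exponent vectors of sum m, and this set of vectors is stable under the permutation. -/
theorem complete_mul_alternant (x : Fin k → A) (m : ℕ) (p : Fin k → ℕ) :
    complete x m * alternant x p =
      ∑ β ∈ Finset.piAntidiag Finset.univ m, alternant x (p + β) := by
  unfold alternant
  simp only [Matrix.det_apply', Matrix.of_apply]
  rw [Finset.sum_comm, Finset.mul_sum]
  refine Finset.sum_congr rfl fun w _ => ?_
  rw [← Finset.mul_sum, mul_left_comm]
  congr 1
  rw [complete_natCast, Finset.sum_mul]
  refine Finset.sum_equiv (w.arrowCongr (Equiv.refl ℕ)) ?_ ?_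
  · intro l
    have : ∑ i, (w.arrowCongr (Equiv.refl ℕ)) l i = ∑ i, l i := Equiv.sum_comp w.symm l
    simp [this]
  · intro l _
    rw [← Finset.prod_mul_distrib]
    refine Finset.prod_congr rfl fun i _ => ?_
    simp [pow_add, mul_comm]

theorem hsymm_eq_complete (R : Type*) [CommRing R] (m : ℕ) :
    MvPolynomial.hsymm (Fin k) R m = complete MvPolynomial.X (m : ℤ) := by
  rw [complete_natCast, MvPolynomial.hsymm]
  refine Finset.sum_bij (fun s _ i => (s.1.count i)) ?_ ?_ ?_ ?_
  · intro s _
    simp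
  · intro s _ t _ h
    apply Sym.coe_injective
    ext i
    exact congrFun h i
  · intro b hb
    simp at hb
    refine ⟨⟨∑ i, Multiset.replicate (b i) i, by simp [hb]⟩, mem_univ _, ?_⟩
    funext i
    simp [Multiset.count_sum', Multiset.count_replicate]
  · intro s _
    rw [Finset.prod_multiset_map_count]
    refine Finset.prod_subset (subset_univ _) ?_
    intro i _ hi
    simp at hi
    simp [hi]

theorem alternant_staircase_ne_zero [IsDomain A] (x : Fin k → A) (hx : Function.Injective x) :
    alternant x (staircase k) ≠ 0 := by
  have h : Matrix.of (fun i l : Fin k => x l ^ staircase k i) =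
      (Matrix.vandermonde x).transpose.submatrix Fin.revPerm id := by
    ext i l
    simp [Matrix.vandermonde, staircase, Fin.val_rev]
    congr 1
    omega
  rw [alternant, h, Matrix.det_permute, Matrix.det_transpose]
  refine mul_ne_zero ?_ (Matrix.det_vandermonde_ne_zero_iff.2 hx)
  rcases Int.units_eq_one_or (Equiv.Perm.sign (Fin.revPerm : Equiv.Perm (Fin k))) with h | h <;>
    simp [h]

theorem exists_map_X (x : Fin k → A) :
    ∃ f : MvPolynomial (Fin k) ℤ →+* A, ∀ i, f (MvPolynomial.X i) = x i :=
  ⟨MvPolynomial.eval₂Hom (Int.castRingHom A) x, fun i => by simp⟩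

/-- `h_m s_α = ∑ s_{α+β}`. -/
theorem complete_mul_jacobiTrudi (x : Fin k → A) (m : ℕ) (p : Fin k → ℕ) :
    complete x m * jacobiTrudi (complete x) (fun i => (p i : ℤ)) =
      ∑ β ∈ Finset.piAntidiag Finset.univ m,
        jacobiTrudi (complete x) (fun i => ((p i + β i : ℕ) : ℤ)) := by
  -- The identity is proved for independent variables over ℤ, where the Vandermonde factor cancels,
  -- and then specialised along `f`; in `A` the points may coincide.
  obtain ⟨f, hf⟩ := exists_map_X x
  have h : complete (MvPolynomial.X : Fin k → MvPolynomial (Fin k) ℤ) m *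
      jacobiTrudi (complete MvPolynomial.X) (fun i => (p i : ℤ)) =
      ∑ β ∈ Finset.piAntidiag Finset.univ m,
        jacobiTrudi (complete MvPolynomial.X) (fun i => ((p i + β i : ℕ) : ℤ)) := by
    apply mul_left_cancel₀ (alternant_staircase_ne_zero _
      (MvPolynomial.X_injective (σ := Fin k) (R := ℤ)))
    rw [mul_left_comm, ← alternant_eq, Finset.mul_sum, complete_mul_alternant]
    refine Finset.sum_congr rfl fun β _ => ?_
    rw [← alternant_eq]
    rfl
  have h' := congrArg f h
  simpa only [map_mul, map_sum, map_complete, map_jacobiTrudi, hf] using h'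

/-- Raising all exponents by one multiplies a Schur polynomial by `e_k`. -/
theorem prod_mul_jacobiTrudi (x : Fin k → A) (p : Fin k → ℕ) :
    (∏ i, x i) * jacobiTrudi (complete x) (fun i => (p i : ℤ)) =
      jacobiTrudi (complete x) (fun i => ((p i + 1 : ℕ) : ℤ)) := by
  obtain ⟨f, hf⟩ := exists_map_X x
  have h : (∏ i : Fin k, (MvPolynomial.X i : MvPolynomial (Fin k) ℤ)) *
      jacobiTrudi (complete MvPolynomial.X) (fun i => (p i : ℤ)) =
        jacobiTrudi (complete MvPolynomial.X) (fun i => ((p i + 1 : ℕ) : ℤ)) := by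
    apply mul_left_cancel₀ (alternant_staircase_ne_zero _
      (MvPolynomial.X_injective (σ := Fin k) (R := ℤ)))
    rw [mul_left_comm, ← alternant_eq, ← alternant_eq]
    unfold alternant
    rw [← Matrix.det_mul_row]
    congr 1
    ext i l
    simp [pow_succ, mul_comm]
  have h' := congrArg f h
  simpa only [map_mul, map_prod, map_complete, map_jacobiTrudi, hf] using h'

theorem jacobiTrudi_comp_perm (h : ℤ → A) (p : Fin k → ℤ) (w : Equiv.Perm (Fin k)) :
    jacobiTrudi h (fun i => p (w i)) = (Equiv.Perm.sign w : ℤ) * jacobiTrudi h p := by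
  unfold jacobiTrudi
  rw [← Matrix.det_permute]
  rfl

theorem jacobiTrudi_eq_zero (h : ℤ → A) (p : Fin k → ℤ) {i j : Fin k} (hij : i ≠ j)
    (hp : p i = p j) : jacobiTrudi h p = 0 := by
  unfold jacobiTrudi
  exact Matrix.det_zero_of_row_eq hij (by ext l; simp [hp])

end Symmetric
/-- The exponents `αᵢ + k - i` of a sequence `α`. -/
def exponents {k : ℕ} (α : Fin k → ℕ) (i : Fin k) : ℕ := α i + staircase k i

/-! ### Reduction modulo the Bethe ansatz ideal and straightening. -/

section Reduction

variable (R : Type*) [CommRing R] {k : ℕ}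

theorem coe_hSym (m : ℤ) :
    ((hSym R k m : MvPolynomial.symmetricSubalgebra (Fin k) R) : MvPolynomial (Fin k) R) =
      complete MvPolynomial.X m := by
  unfold hSym
  split_ifs with h
  · obtain ⟨m, rfl⟩ := Int.eq_ofNat_of_zero_le h
    simp [hsymm_eq_complete]
  · rw [complete_of_neg _ (by omega)]
    rfl

theorem hSym_of_neg {m : ℤ} (hm : m < 0) : hSym R k m = 0 := by
  simp [hSym, hm]

theorem hSym_zero : hSym R k 0 = 1 := by
  refine Subtype.ext ?_
  rw [coe_hSym, complete_zero]
  rfl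

theorem schur_eq_jacobiTrudi (α : Fin k → ℕ) :
    schur R α = jacobiTrudi (hSym R k) (fun i => (exponents α i : ℤ)) := by
  unfold schur jacobiTrudi
  congr 1
  ext i j
  simp only [Matrix.of_apply, exponents, staircase]
  congr 3
  omega

/-- The coefficient `(-1)^r e_r` as an element of the ring of symmetric polynomials. -/
noncomputable def elementarySym (k r : ℕ) : MvPolynomial.symmetricSubalgebra (Fin k) R :=
  ⟨PowerSeries.coeff r (elementarySeries univ MvPolynomial.X), by
    intro e
    have h : PowerSeries.map (MvPolynomial.rename (R := R) e : _ →ₐ[R] _).toRingHom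
        (elementarySeries univ (MvPolynomial.X : Fin k → MvPolynomial (Fin k) R)) =
        elementarySeries univ MvPolynomial.X := by
      unfold elementarySeries
      rw [map_prod]
      simp only [map_sub, map_one, map_mul, PowerSeries.map_C, PowerSeries.map_X]
      simp only [AlgHom.toRingHom_eq_coe, RingHom.coe_coe, MvPolynomial.rename_X]
      exact Equiv.prod_comp e
        (fun i => 1 - PowerSeries.C (MvPolynomial.X i : MvPolynomial (Fin k) R) * PowerSeries.X)
    have h' := congrArg (PowerSeries.coeff r) h
    rw [PowerSeries.coeff_map] at h'
    exact h'⟩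

theorem elementarySym_zero : elementarySym R k 0 = 1 := by
  apply Subtype.coe_injective
  exact coeff_zero_elementarySeries _ _

theorem sum_elementarySym_mul_hSym (p : ℕ) (hp : 1 ≤ p) :
    ∑ r ∈ range (k + 1), elementarySym R k r * hSym R k ((p : ℤ) - (r : ℤ)) = 0 := by
  apply Subtype.coe_injective
  simp only [AddSubmonoidClass.coe_finsetSum, MulMemClass.coe_mul, coe_hSym, elementarySym]
  exact sum_coeff_mul_complete _ p hp

theorem coe_jacobiTrudi_hSym (p : Fin k → ℤ) :
    ((jacobiTrudi (hSym R k) p : MvPolynomial.symmetricSubalgebra (Fin k) R) :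
      MvPolynomial (Fin k) R) = jacobiTrudi (complete MvPolynomial.X) p := by
  have h := map_jacobiTrudi (MvPolynomial.symmetricSubalgebra (Fin k) R).val.toRingHom
    (hSym R k) p
  simpa [coe_hSym] using h

theorem elementarySym_mul_jacobiTrudi (p : Fin k → ℕ) :
    (-1) ^ k * elementarySym R k k * jacobiTrudi (hSym R k) (fun i => (p i : ℤ)) =
      jacobiTrudi (hSym R k) (fun i => ((p i + 1 : ℕ) : ℤ)) := by
  apply Subtype.coe_injective
  simp only [MulMemClass.coe_mul, coe_jacobiTrudi_hSym, ← prod_mul_jacobiTrudi]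
  congr 1
  have h := coeff_card_elementarySeries univ (MvPolynomial.X : Fin k → MvPolynomial (Fin k) R)
  rw [card_univ, Fintype.card_fin] at h
  simp [elementarySym, h, ← mul_assoc, ← mul_pow]

/-- A sequence `h_m` that behaves like the complete symmetric functions of `k` variables, modulo the
relations `h_n = z` and `h_{n+1} = ⋯ = h_{n+k-1} = 0`. -/
structure IsBetheSequence {Q : Type*} [CommRing Q] (n k : ℕ) (h : ℤ → Q) (ε : ℕ → Q) (z : Q) :
    Prop where
  neg : ∀ m < 0, h m = 0
  zero : h 0 = 1
  elementary_zero : ε 0 = 1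
  recurrence : ∀ p : ℕ, 1 ≤ p → ∑ r ∈ range (k + 1), ε r * h ((p : ℤ) - (r : ℤ)) = 0
  shift : ∀ p : Fin k → ℕ, (-1) ^ k * ε k * jacobiTrudi h (fun i => (p i : ℤ)) =
    jacobiTrudi h (fun i => ((p i + 1 : ℕ) : ℤ))
  eq_z : h n = z
  vanish : ∀ j : ℕ, 1 ≤ j → j ≤ k - 1 → h ((n : ℤ) + (j : ℤ)) = 0

namespace IsBetheSequence

variable {Q : Type*} [CommRing Q] {n : ℕ} {h : ℤ → Q} {ε : ℕ → Q} {z : Q}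

/-- For m ≥ k the recurrence at n + m only involves h_n, h_{n+1}, …, so the tail is determined by
its first `k` values z, 0, …, 0. The right side has the same first values and satisfies the same
recurrence: at m = k the Kronecker term cancels the term of h_0, and beyond that the recurrence is
the one at m - k. -/
theorem eq_shift (H : IsBetheSequence n k h ε z) (hk : 1 ≤ k) (m : ℕ) :
    h ((n : ℤ) + m) = z * ((if m = 0 then 1 else 0) - ε k * h ((m : ℤ) - k)) := by
  induction m using Nat.strong_induction_on with
  | _ m ih =>
  rcases Nat.eq_zero_or_pos m with rfl | hm
  · rw [H.neg (((0 : ℕ) : ℤ) - k) (by omega)]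
    simp [H.eq_z]
  rw [if_neg (by omega)]
  by_cases hmk : m < k
  · rw [H.vanish m hm (by omega), H.neg ((m : ℤ) - k) (by omega)]
    simp
  · have h1 := H.recurrence (n + m) (by omega)
    rw [Finset.sum_range_succ', H.elementary_zero] at h1
    have h2 : ∀ r ∈ range k, ε (r + 1) * h (((n + m : ℕ) : ℤ) - ((r + 1 : ℕ) : ℤ)) =
        z * (if m = r + 1 then ε (r + 1) else 0) -
          z * ε k * (ε (r + 1) * h (((m - k : ℕ) : ℤ) - ((r + 1 : ℕ) : ℤ))) := by
      intro r hr
      rw [mem_range] at hr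
      have e : (((n + m : ℕ) : ℤ) - ((r + 1 : ℕ) : ℤ)) = (n : ℤ) + ((m - (r + 1) : ℕ) : ℤ) := by
        omega
      have e' : (((m - (r + 1) : ℕ) : ℤ) - k) = ((m - k : ℕ) : ℤ) - ((r + 1 : ℕ) : ℤ) := by omega
      rw [e, ih _ (by omega), e']
      have : (m - (r + 1) = 0) ↔ m = r + 1 := by omega
      simp only [this]
      split_ifs <;> ring
    rw [Finset.sum_congr rfl h2, Finset.sum_sub_distrib, ← Finset.mul_sum, ← Finset.mul_sum] at h1
    have e0 : (((n + m : ℕ) : ℤ) - ((0 : ℕ) : ℤ)) = (n : ℤ) + m := by omega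
    rw [e0] at h1
    by_cases hmk' : m = k
    · subst hmk'
      have h3 : ∑ r ∈ range m, (if m = r + 1 then ε (r + 1) else 0) = ε m := by
        rw [Finset.sum_eq_single (m - 1)]
        · rw [if_pos (by omega)]; congr 1; omega
        · intro b _ hb; rw [if_neg (by omega)]
        · intro hb; simp at hb; omega
      have h4 : ∑ r ∈ range m, ε (r + 1) * h (((m - m : ℕ) : ℤ) - ((r + 1 : ℕ) : ℤ)) = 0 := by
        apply Finset.sum_eq_zero
        intro r _
        rw [H.neg _ (by omega), mul_zero]
      rw [h3, h4] at h1
      rw [sub_self, H.zero]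
      linear_combination h1
    · have h3 : ∑ r ∈ range k, (if m = r + 1 then ε (r + 1) else 0) = 0 := by
        apply Finset.sum_eq_zero
        intro r hr
        rw [mem_range] at hr
        rw [if_neg (by omega)]
      have h4 := H.recurrence (m - k) (by omega)
      rw [Finset.sum_range_succ', H.elementary_zero] at h4
      have e5 : (((m - k : ℕ) : ℤ) - ((0 : ℕ) : ℤ)) = (m : ℤ) - k := by omega
      rw [e5] at h4
      rw [h3] at h1
      linear_combination h1 + z * ε k * h4

/-- If p_0 = n + K, the first row is (z, 0, …, 0) on the left and (0, …, 0, 1) on the right, and the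
complementary minors coincide. If p_0 is larger, `eq_shift` makes the first row -z ε_{K+1} times the
row of exponent p_0 - (n+K) - 1, and `shift` absorbs ε_{K+1} by raising all exponents by one. -/
theorem jacobiTrudi_rim {K : ℕ} (H : IsBetheSequence n (K + 1) h ε z) (p : Fin (K + 1) → ℕ)
    (hp : n + K ≤ p 0) :
    jacobiTrudi h (fun i => (p i : ℤ)) = z * ((-1) ^ K *
      jacobiTrudi h (Fin.cons ((p 0 - (n + K) : ℕ) : ℤ) (fun i => ((p i.succ + 1 : ℕ) : ℤ)))) := by
  by_cases h0 : p 0 = n + K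
  · unfold jacobiTrudi
    rw [Matrix.det_succ_row_zero, Matrix.det_succ_row_zero, Finset.sum_eq_single 0,
      Finset.sum_eq_single (Fin.last K)]
    · have e1 : h ((p 0 : ℤ) - (((K + 1 : ℕ) : ℤ) - 1) + ((0 : Fin (K + 1)) : ℤ)) = z := by
        rw [← H.eq_z, h0]; congr 1; push_cast; simp
      have e2 : h (((p 0 - (n + K) : ℕ) : ℤ) - (((K + 1 : ℕ) : ℤ) - 1) +
          ((Fin.last K : Fin (K + 1)) : ℤ)) = 1 := by
        rw [← H.zero, h0]; congr 1; simp
      rw [Matrix.of_apply, Matrix.of_apply, Fin.cons_zero, e1, e2, Fin.val_zero, Fin.val_last,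
        pow_zero, one_mul, mul_one, ← mul_assoc ((-1 : Q) ^ K), ← mul_pow]
      simp only [mul_neg, mul_one, neg_neg, one_pow, one_mul]
      congr 2
      ext i j
      simp only [Matrix.submatrix_apply, Matrix.of_apply, Fin.cons_succ, Fin.succAbove_zero,
        Fin.succAbove_last, Fin.val_succ, Fin.val_castSucc]
      congr 1
      push_cast
      ring
    · intro j _ hj
      have : (j : ℕ) < K := by
        have := j.2
        have : (j : ℕ) ≠ K := fun e => hj (Fin.ext e)
        omega
      simp only [Matrix.of_apply, Fin.cons_zero]
      rw [H.neg _ (by omega)]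
      simp
    · simp
    · intro j _ hj
      have h1 : (j : ℕ) ≠ 0 := fun e => hj (Fin.ext e)
      have h2 := j.2
      have : ((p 0 : ℤ) - (((K + 1 : ℕ) : ℤ) - 1) + (j : ℤ)) = (n : ℤ) + (j : ℕ) := by
        rw [h0]; push_cast; ring
      rw [Matrix.of_apply, this, H.vanish j (by omega) (by omega)]
      simp
    · simp
  · have e1 := H.shift (Fin.cons (p 0 - (n + K) - 1) (fun i => p i.succ))
    have e2 : (fun i => ((((Fin.cons (p 0 - (n + K) - 1) (fun i => p i.succ) :
        Fin (K + 1) → ℕ) i + 1 : ℕ) : ℤ))) =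
        (Fin.cons ((p 0 - (n + K) : ℕ) : ℤ) (fun i => ((p i.succ + 1 : ℕ) : ℤ)) :
          Fin (K + 1) → ℤ) := by
      funext i
      refine Fin.cases ?_ ?_ i
      · simp only [Fin.cons_zero]; omega
      · intro i; simp only [Fin.cons_succ]
    rw [e2] at e1
    rw [← e1]
    have e3 : z * ((-1) ^ K * ((-1) ^ (K + 1) * ε (K + 1) * jacobiTrudi h (fun i =>
        ((Fin.cons (p 0 - (n + K) - 1) (fun i => p i.succ) : Fin (K + 1) → ℕ) i : ℤ)))) =
        (-(z * ε (K + 1))) * jacobiTrudi h (fun i =>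
        ((Fin.cons (p 0 - (n + K) - 1) (fun i => p i.succ) : Fin (K + 1) → ℕ) i : ℤ)) := by
      have : ((-1 : Q) ^ K) * (-1) ^ K = 1 := by rw [← mul_pow]; simp
      linear_combination (-(z * ε (K + 1))) * jacobiTrudi h (fun i =>
        ((Fin.cons (p 0 - (n + K) - 1) (fun i => p i.succ) : Fin (K + 1) → ℕ) i : ℤ)) * this
    rw [e3]
    unfold jacobiTrudi
    rw [Matrix.det_succ_row_zero, Matrix.det_succ_row_zero, Finset.mul_sum]
    refine Finset.sum_congr rfl fun j _ => ?_
    have e4 : h ((p 0 : ℤ) - (((K + 1 : ℕ) : ℤ) - 1) + (j : ℤ)) = -(z * ε (K + 1)) *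
        h (((p 0 - (n + K) - 1 : ℕ) : ℤ) - (((K + 1 : ℕ) : ℤ) - 1) + (j : ℤ)) := by
      have := H.eq_shift (by omega) (p 0 - (n + K) + j)
      rw [if_neg (by omega)] at this
      have a1 : ((p 0 : ℤ) - (((K + 1 : ℕ) : ℤ) - 1) + (j : ℤ)) =
        (n : ℤ) + ((p 0 - (n + K) + (j : ℕ) : ℕ) : ℤ) := by omega
      have a2 : (((p 0 - (n + K) - 1 : ℕ) : ℤ) - (((K + 1 : ℕ) : ℤ) - 1) + (j : ℤ)) =
        ((p 0 - (n + K) + (j : ℕ) : ℕ) : ℤ) - ((K + 1 : ℕ) : ℤ) := by omega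
      rw [a1, a2, this]
      ring
    simp only [Matrix.of_apply, Fin.cons_zero, e4]
    have e5 : (Matrix.of fun i j : Fin (K + 1) =>
          h ((p i : ℤ) - (((K + 1 : ℕ) : ℤ) - 1) + (j : ℤ))).submatrix Fin.succ j.succAbove =
        (Matrix.of fun i j : Fin (K + 1) =>
          h (((Fin.cons (p 0 - (n + K) - 1) (fun i => p i.succ) : Fin (K + 1) → ℕ) i : ℤ) -
            (((K + 1 : ℕ) : ℤ) - 1) + (j : ℤ))).submatrix Fin.succ j.succAbove := by
      ext a b
      simp only [Matrix.submatrix_apply, Matrix.of_apply, Fin.cons_succ]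
    rw [e5]
    ring

end IsBetheSequence

/-- The first exponent drops by n + K and moves to the end; the others rise by one because their
positions move up. The sign (-1)^K of this rotation is the one in `jacobiTrudi_rim`. -/
theorem exponents_rimReduce {K n : ℕ} (α : Fin (K + 1) → ℕ) (hn : n ≤ α 0) :
    (fun i => (exponents (rimReduce n α) i : ℤ)) = fun i =>
      (Fin.cons ((exponents α 0 - (n + K) : ℕ) : ℤ)
        (fun i => ((exponents α i.succ + 1 : ℕ) : ℤ)) : Fin (K + 1) → ℤ) (finRotate (K + 1) i) := by
  funext i
  refine Fin.lastCases ?_ ?_ i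
  · rw [finRotate_last, Fin.cons_zero]
    simp [exponents, rimReduce, staircase]
    omega
  · intro i
    have : finRotate (K + 1) i.castSucc = i.succ := by
      rw [finRotate_apply]; simp
    rw [this, Fin.cons_succ]
    have h1 : (i.castSucc : ℕ) + 1 < K + 1 := by have := i.2; simp
    have h2 : (⟨(i.castSucc : ℕ) + 1, h1⟩ : Fin (K + 1)) = i.succ := by ext; simp
    have h3 : rimReduce n α i.castSucc = α i.succ := by
      rw [rimReduce, dif_pos h1, h2]
    have := i.2
    simp only [exponents, h3, staircase, Fin.val_castSucc, Fin.val_succ]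
    omega

theorem isBetheSequence_quotient (n : ℕ) (z : R) :
    IsBetheSequence n k (fun m => Ideal.Quotient.mk (betheIdeal n k z) (hSym R k m))
      (fun r => Ideal.Quotient.mk (betheIdeal n k z) (elementarySym R k r))
      (Ideal.Quotient.mk (betheIdeal n k z) (algebraMap R _ z)) where
  neg m hm := by rw [hSym_of_neg R hm, map_zero]
  zero := by rw [hSym_zero, map_one]
  elementary_zero := by rw [elementarySym_zero, map_one]
  recurrence p hp := by
    simp only [← map_mul, ← map_sum]
    rw [sum_elementarySym_mul_hSym R p hp, map_zero]
  shift p := by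
    rw [← map_jacobiTrudi, ← map_jacobiTrudi, ← elementarySym_mul_jacobiTrudi]
    simp
  eq_z := by
    rw [Ideal.Quotient.eq]
    exact Ideal.subset_span (Or.inl rfl)
  vanish j h1 h2 := by
    rw [Ideal.Quotient.eq_zero_iff_mem]
    exact Ideal.subset_span (Or.inr ⟨j, h1, h2, rfl⟩)

theorem schur_sub_mem_betheIdeal (n : ℕ) (hk : 0 < k) (z : R) (α : Fin k → ℕ)
    (hn : n ≤ α ⟨0, hk⟩) :
    schur R α - algebraMap R _ z * schur R (rimReduce n α) ∈ betheIdeal n k z := by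
  obtain ⟨K, rfl⟩ : ∃ K, k = K + 1 := ⟨k - 1, by omega⟩
  have e : jacobiTrudi (hSym R (K + 1)) (fun i => (exponents (rimReduce n α) i : ℤ)) = (-1) ^ K *
      jacobiTrudi (hSym R (K + 1)) (Fin.cons ((exponents α 0 - (n + K) : ℕ) : ℤ)
        (fun i => ((exponents α i.succ + 1 : ℕ) : ℤ))) := by
    rw [exponents_rimReduce α hn, jacobiTrudi_comp_perm, sign_finRotate]
    simp
  rw [← Ideal.Quotient.eq, map_mul, schur_eq_jacobiTrudi, schur_eq_jacobiTrudi, e, map_mul,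
    map_jacobiTrudi (Ideal.Quotient.mk _), map_jacobiTrudi (Ideal.Quotient.mk _)]
  have := (isBetheSequence_quotient R (k := K + 1) n z).jacobiTrudi_rim (exponents α) (by
    simp only [exponents, staircase]
    have : n ≤ α 0 := hn
    simp
    omega)
  rw [this]
  simp

/-- On the exponents αᵢ + k - i the rule exchanges two neighbours, hence two rows of the
determinant. The hypothesis `h1` keeps the truncated subtraction b - 1 exact. -/
theorem schur_straighten (α : Fin k → ℕ) (i : ℕ) (h : i + 1 < k) (h1 : 1 ≤ α ⟨i + 1, h⟩) :
    schur R α = -schur R (straighten α i h) := by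
  have e : (fun j => (exponents (straighten α i h) j : ℤ)) = fun j =>
      (fun j => (exponents α j : ℤ)) (Equiv.swap (⟨i, by omega⟩ : Fin k) ⟨i + 1, h⟩ j) := by
    funext j
    simp only [Equiv.swap_apply_def, exponents, straighten, staircase, Function.update_apply]
    split_ifs with a b b
    · subst a; simp at b
    · rw [a]; simp only; omega
    · rw [b]; simp only; omega
    · rfl
  rw [schur_eq_jacobiTrudi, schur_eq_jacobiTrudi, e,
    jacobiTrudi_comp_perm _ (fun j => (exponents α j : ℤ)), Equiv.Perm.sign_swap (by simp)]
  push_cast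
  ring

theorem schur_eq_zero (α : Fin k → ℕ) (i : ℕ) (h : i + 1 < k)
    (h1 : α ⟨i + 1, h⟩ = α ⟨i, by omega⟩ + 1) : schur R α = 0 := by
  rw [schur_eq_jacobiTrudi]
  refine jacobiTrudi_eq_zero _ _ (i := ⟨i, by omega⟩) (j := ⟨i + 1, h⟩) (by simp) ?_
  simp only [exponents, staircase, h1]
  omega

end Reduction

/-! ### Termination and invariants of the reduction of formal terms. -/

namespace SchurTerm

variable {n k : ℕ}

/-- A measure which decreases lexicographically in each reduction step. -/
def size : SchurTerm k → ℕ × ℕ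
  | zero => (0, 0)
  -- The added 1 places every signed term above `zero`, even when all parts are 0.
  | signed _ α => (∑ i, α i + 1, ∑ i : Fin k, (i : ℕ) * α i)

theorem sum_rimReduce_add (hk : 0 < k) (α : Fin k → ℕ) (hn : n ≤ α ⟨0, hk⟩) :
    ∑ i, rimReduce n α i + n = ∑ i, α i := by
  obtain ⟨K, rfl⟩ : ∃ K, k = K + 1 := ⟨k - 1, by omega⟩
  rw [Fin.sum_univ_castSucc, Fin.sum_univ_succ]
  have h1 : ∀ i : Fin K, rimReduce n α i.castSucc = α i.succ := by
    intro i
    have h1 : (i.castSucc : ℕ) + 1 < K + 1 := by simp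
    simp only [rimReduce, dif_pos h1]
    rfl
  have h2 : rimReduce n α (Fin.last K) = α 0 - n := by
    simp [rimReduce]
  have h3 : n ≤ α 0 := hn
  simp only [h1, h2]
  omega

/-- Applied with weights 1 (the total is kept) and j (the weighted sum drops). The old and new terms
are placed on opposite sides to avoid subtracting sums of natural numbers. -/
theorem sum_straighten (f : ℕ → ℕ) (α : Fin k → ℕ) (i : ℕ) (h : i + 1 < k) :
    (∑ j : Fin k, f j * straighten α i h j) + (f i * α ⟨i, by omega⟩ + f (i + 1) * α ⟨i + 1, h⟩) =
      (∑ j : Fin k, f j * α j) +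
        (f i * (α ⟨i + 1, h⟩ - 1) + f (i + 1) * (α ⟨i, by omega⟩ + 1)) := by
  set a : Fin k := ⟨i, by omega⟩
  set b : Fin k := ⟨i + 1, h⟩
  have hab : b ≠ a := by simp [a, b]
  have key : ∀ β : Fin k → ℕ, ∑ j : Fin k, f j * β j =
      (∑ j ∈ (univ.erase a).erase b, f j * β j) + (f i * β a + f (i + 1) * β b) := by
    intro β
    rw [← Finset.sum_erase_add _ _ (mem_univ a),
      ← Finset.sum_erase_add _ _ (mem_erase.2 ⟨hab, mem_univ b⟩)]
    simp only [a, b]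
    ring
  rw [key (straighten α i h), key α]
  have e1 : ∑ j ∈ (univ.erase a).erase b, f j * straighten α i h j =
      ∑ j ∈ (univ.erase a).erase b, f j * α j := by
    refine Finset.sum_congr rfl fun j hj => ?_
    simp only [mem_erase, mem_univ, and_true] at hj
    simp [straighten, hj.1, hj.2, a, b] at hj ⊢
  have e2 : straighten α i h a = α b - 1 := by
    simp [straighten, a, b]
  have e3 : straighten α i h b = α a + 1 := by
    simp [straighten, a, b]
  rw [e1, e2, e3]
  ring

/-- A rim step lowers the total by n > 0. A swap of a, b keeps the total and lowers ∑ i αᵢ by b - a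
- 1, which is positive because b > a + 1. -/
theorem Step.size_lt (hn : 0 < n) {t t' : SchurTerm k} (h : Step n t t') :
    Prod.Lex (· < ·) (· < ·) t'.size t.size := by
  cases h with
  | rim ε α hk hα hn' =>
    apply Prod.Lex.left
    have := sum_rimReduce_add hk α hn'
    omega
  | swap ε α i h hα =>
    have h1 := sum_straighten (fun _ => 1) α i h
    have h2 := sum_straighten (fun j => j) α i h
    simp only [size]
    simp only [one_mul] at h1
    have e : ∑ j, straighten α i h j = ∑ j, α j := by omega
    rw [e]
    apply Prod.Lex.right
    obtain ⟨c, hc⟩ : ∃ c, α ⟨i + 1, h⟩ = α ⟨i, by omega⟩ + 2 + c :=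
      ⟨α ⟨i + 1, h⟩ - α ⟨i, by omega⟩ - 2, by omega⟩
    have hc' : α ⟨i + 1, h⟩ - 1 = α ⟨i, by omega⟩ + 1 + c := by omega
    rw [hc', hc] at h2
    nlinarith
  | vanish ε α i h hα =>
    apply Prod.Lex.left
    simp

theorem wellFounded_step (hn : 0 < n) :
    WellFounded fun t' t : SchurTerm k => Step n t t' :=
  Subrelation.wf (fun h => h.size_lt hn)
    (InvImage.wf size (WellFounded.prod_lex Nat.lt_wfRel.wf Nat.lt_wfRel.wf))

theorem antitone_of_forall_succ_le {α : Fin k → ℕ}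
    (h : ∀ i (hi : i + 1 < k), α ⟨i + 1, hi⟩ ≤ α ⟨i, by omega⟩) : Antitone α := by
  cases k with
  | zero => intro i; exact i.elim0
  | succ K =>
    rw [Fin.antitone_iff_succ_le]
    intro i
    exact h i (by simp)

theorem forall_not_step_iff (hk : 1 ≤ k) (t : SchurTerm k) :
    (∀ t', ¬ Step n t t') ↔ t.IsReduced n := by
  constructor
  · intro h
    cases t with
    | zero => trivial
    | signed ε α =>
      have hα : Antitone α := by
        apply antitone_of_forall_succ_le
        intro i hi
        by_contra hlt
        by_cases he : α ⟨i + 1, hi⟩ = α ⟨i, by omega⟩ + 1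
        · exact h _ (Step.vanish ε α i hi he)
        · exact h _ (Step.swap ε α i hi (by omega))
      refine ⟨hα, fun i => ?_⟩
      by_contra hi
      have := hα (show (⟨0, hk⟩ : Fin k) ≤ i from Nat.zero_le _)
      exact h _ (Step.rim ε α hk hα (by omega))
  · intro h t' hs
    cases hs with
    | rim ε α hk hα hn' => exact absurd (h.2 ⟨0, hk⟩) (by omega)
    | swap ε α i hi hα =>
      have := h.1 (show (⟨i, by omega⟩ : Fin k) ≤ ⟨i + 1, hi⟩ from Nat.le_succ i)
      omega
    | vanish ε α i hi hα =>
      have := h.1 (show (⟨i, by omega⟩ : Fin k) ≤ ⟨i + 1, hi⟩ from Nat.le_succ i)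
      omega

theorem exists_isResult (hn : 0 < n) (hk : 1 ≤ k) (α : Fin k → ℕ) :
    ∃ t : SchurTerm k, IsResult n α t := by
  have key : ∀ t : SchurTerm k, ∃ t', Relation.ReflTransGen (Step n) t t' ∧ t'.IsReduced n := by
    intro t
    induction t using (wellFounded_step (k := k) hn).induction with
    | _ t ih =>
    by_cases h : ∀ t', ¬ Step n t t'
    · exact ⟨t, Relation.ReflTransGen.refl, (forall_not_step_iff hk t).1 h⟩
    · push Not at h
      obtain ⟨t', ht'⟩ := h
      obtain ⟨t'', h1, h2⟩ := ih t' ht'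
      exact ⟨t'', Relation.ReflTransGen.head ht' h1, h2⟩
  exact key _

/-- The value of a term in a ring, given the values of the `s_α`. -/
def value {A : Type*} [CommRing A] (f : (Fin k → ℕ) → A) : SchurTerm k → A
  | zero => 0
  | signed ε α => ((ε : ℤ) : A) * f α

/-- Each rule preserves the value given by such an `f`. This takes the place of a confluence
argument: different choices lead to results with equal values. -/
theorem value_eq_of_isResult {A : Type*} [CommRing A] {f : (Fin k → ℕ) → A}
    (hrim : ∀ α (hk : 0 < k), n ≤ α ⟨0, hk⟩ → f α = f (rimReduce n α))
    (hswap : ∀ α i (h : i + 1 < k), 1 ≤ α ⟨i + 1, h⟩ → f α = -f (straighten α i h))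
    (hvanish : ∀ α i (h : i + 1 < k), α ⟨i + 1, h⟩ = α ⟨i, by omega⟩ + 1 → f α = 0)
    {α : Fin k → ℕ} {t : SchurTerm k} (ht : IsResult n α t) : t.value f = f α := by
  have key : ∀ t t' : SchurTerm k, Relation.ReflTransGen (Step n) t t' →
      t'.value f = t.value f := by
    intro t t' h
    induction h with
    | refl => rfl
    | tail _ hs ih =>
      rw [← ih]
      cases hs with
      | rim ε α hk hα hn => simp [value, hrim α hk hn]
      | swap ε α i h hα => simp [value, hswap α i h (by omega)]
      | vanish ε α i h hα => simp [value, hvanish α i h hα]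
  rw [key _ _ ht.1]
  simp [value]

end SchurTerm
-- Horizontal strips and Pieri's rule.
/-- `y` is a partition with at most `k` parts, continued by zeros. -/
structure IsPartition (k : ℕ) (y : ℕ → ℤ) : Prop where
  anti : ∀ i, y (i + 1) ≤ y i
  nonneg : ∀ i, 0 ≤ y i
  support : ∀ i, k ≤ i → y i = 0

/-- `x / y` is a horizontal strip. -/
def Interlace (y x : ℕ → ℤ) : Prop := ∀ i, y i ≤ x i ∧ x (i + 1) ≤ y i

theorem IsPartition.of_interlace {k : ℕ} {y x : ℕ → ℤ} (hy : IsPartition k y)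
    (h : Interlace y x) (hx : ∀ i, k ≤ i → x i = 0) : IsPartition k x where
  anti i := (h i).2.trans (h i).1
  nonneg i := (hy.nonneg i).trans (h i).1
  support := hx

theorem finite_setOf_bounded {ι : Type*} (s : Finset ι) (B : ℤ) :
    {f : ι → ℤ | (∀ i, i ∉ s → f i = 0) ∧ ∀ i, 0 ≤ f i ∧ f i ≤ B}.Finite := by
  refine Set.Finite.of_injOn (f := fun f (i : s) => f i)
    (t := Set.pi Set.univ fun _ => Set.Icc 0 B) ?_ ?_ (Set.Finite.pi fun _ => Set.finite_Icc 0 B)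
  · intro f hf i _
    exact hf.2 i
  · intro f hf g hg h
    funext i
    by_cases hi : i ∈ s
    · exact congrFun h ⟨i, hi⟩
    · rw [hf.1 i hi, hg.1 i hi]

theorem le_sum_range {k : ℕ} {y : ℕ → ℤ} (h0 : ∀ i, 0 ≤ y i) (hs : ∀ i, k ≤ i → y i = 0) (i : ℕ) :
    y i ≤ ∑ r ∈ range k, y r := by
  by_cases hi : i < k
  · exact Finset.single_le_sum (fun r _ => h0 r) (mem_range.2 hi)
  · rw [hs i (by omega)]
    exact Finset.sum_nonneg fun r _ => h0 r

theorem finite_raised (k : ℕ) (N : ℤ) :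
    {x : ℕ → ℤ | (∀ i, 0 ≤ x i) ∧ (∀ i, k ≤ i → x i = 0) ∧ ∑ i ∈ range k, x i = N}.Finite := by
  refine (finite_setOf_bounded (range k) N).subset ?_
  rintro x ⟨h1, h2, h3⟩
  exact ⟨fun i hi => h2 i (by simpa using hi), fun i => ⟨h1 i, h3 ▸ le_sum_range h1 h2 i⟩⟩

open Classical in
/-- The sequences obtained by adding nonnegative integers with sum `c` to the entries of `y`. -/
noncomputable def raised (k : ℕ) (y : ℕ → ℤ) (c : ℤ) : Finset (ℕ → ℤ) :=
  (finite_raised k (∑ i ∈ range k, y i + c)).toFinset.filter fun x => ∀ i, y i ≤ x i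

open Classical in
/-- The partitions obtained by adding a horizontal strip of size `c` to `y`. -/
noncomputable def strips (k : ℕ) (y : ℕ → ℤ) (c : ℤ) : Finset (ℕ → ℤ) :=
  (raised k y c).filter fun x => Interlace y x

theorem mem_raised {k : ℕ} {y : ℕ → ℤ} (hy : IsPartition k y) {c : ℤ} {x : ℕ → ℤ} :
    x ∈ raised k y c ↔ (∀ i, y i ≤ x i) ∧ (∀ i, k ≤ i → x i = 0) ∧
      ∑ i ∈ range k, x i = ∑ i ∈ range k, y i + c := by
  simp only [raised, mem_filter, Set.Finite.mem_toFinset, Set.mem_ofPred_eq]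
  constructor
  · rintro ⟨⟨-, h2, h3⟩, h4⟩
    exact ⟨h4, h2, h3⟩
  · rintro ⟨h4, h2, h3⟩
    exact ⟨⟨fun i => (hy.nonneg i).trans (h4 i), h2, h3⟩, h4⟩

theorem mem_strips {k : ℕ} {y : ℕ → ℤ} (hy : IsPartition k y) {c : ℤ} {x : ℕ → ℤ} :
    x ∈ strips k y c ↔ Interlace y x ∧ (∀ i, k ≤ i → x i = 0) ∧
      ∑ i ∈ range k, x i = ∑ i ∈ range k, y i + c := by
  simp only [strips, mem_filter, mem_raised hy]
  constructor
  · rintro ⟨⟨-, h2, h3⟩, h4⟩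
    exact ⟨h4, h2, h3⟩
  · rintro ⟨h4, h2, h3⟩
    exact ⟨⟨fun i => (h4 i).1, h2, h3⟩, h4⟩

theorem exists_last {P : ℕ → Prop} {B : ℕ} (hB : ∀ i, P i → i < B) (h : ∃ i, P i) :
    ∃ i, P i ∧ ∀ j, i < j → ¬ P j := by
  classical
  obtain ⟨i, hi⟩ := h
  refine ⟨Nat.findGreatest P B, Nat.findGreatest_spec (hB i hi).le hi, fun j hj hPj => ?_⟩
  exact Nat.findGreatest_is_greatest hj (hB j hPj).le hPj

section Pieri

variable {A : Type*} [CommRing A] {k : ℕ}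

/-- The Schur function of an integer sequence. -/
def schurSeq (k : ℕ) (h : ℤ → A) (x : ℕ → ℤ) : A :=
  jacobiTrudi h (fun i : Fin k => x i + ((k : ℤ) - 1 - (i : ℤ)))

/-- `(…, a, b, …) ↦ (…, b - 1, a + 1, …)` in the positions `i`, `i + 1`. -/
def swapSeq (i : ℕ) (x : ℕ → ℤ) : ℕ → ℤ :=
  fun r => if r = i then x (i + 1) - 1 else if r = i + 1 then x i + 1 else x r

theorem swapSeq_self (i : ℕ) (x : ℕ → ℤ) : swapSeq i x i = x (i + 1) - 1 := by simp [swapSeq]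

theorem swapSeq_succ (i : ℕ) (x : ℕ → ℤ) : swapSeq i x (i + 1) = x i + 1 := by simp [swapSeq]

theorem swapSeq_of_ne {i r : ℕ} (x : ℕ → ℤ) (h1 : r ≠ i) (h2 : r ≠ i + 1) :
    swapSeq i x r = x r := by
  simp [swapSeq, h1, h2]

theorem swapSeq_swapSeq (i : ℕ) (x : ℕ → ℤ) : swapSeq i (swapSeq i x) = x := by
  funext r
  by_cases h1 : r = i
  · subst h1; rw [swapSeq_self, swapSeq_succ]; ring
  · by_cases h2 : r = i + 1
    · subst h2; rw [swapSeq_succ, swapSeq_self]; ring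
    · rw [swapSeq_of_ne _ h1 h2, swapSeq_of_ne _ h1 h2]

theorem sum_swapSeq {i : ℕ} (hi : i + 1 < k) (x : ℕ → ℤ) :
    ∑ r ∈ range k, swapSeq i x r = ∑ r ∈ range k, x r := by
  have key : ∀ z : ℕ → ℤ, ∑ r ∈ range k, z r =
      ∑ r ∈ ((range k).erase i).erase (i + 1), z r + z (i + 1) + z i := by
    intro z
    rw [Finset.sum_erase_add _ _ (by simp; omega), Finset.sum_erase_add _ _ (by simp; omega)]
  rw [key, key x, swapSeq_self, swapSeq_succ]
  have : ∑ r ∈ ((range k).erase i).erase (i + 1), swapSeq i x r =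
      ∑ r ∈ ((range k).erase i).erase (i + 1), x r := by
    refine Finset.sum_congr rfl fun r hr => ?_
    simp only [mem_erase] at hr
    exact swapSeq_of_ne _ hr.2.1 hr.1
  rw [this]
  ring

theorem schurSeq_swapSeq (h : ℤ → A) {i : ℕ} (hi : i + 1 < k) (x : ℕ → ℤ) :
    schurSeq k h (swapSeq i x) = -schurSeq k h x := by
  have e : (fun j : Fin k => swapSeq i x j + ((k : ℤ) - 1 - (j : ℤ))) = fun j =>
      (fun j : Fin k => x j + ((k : ℤ) - 1 - (j : ℤ)))
        (Equiv.swap (⟨i, by omega⟩ : Fin k) ⟨i + 1, hi⟩ j) := by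
    funext j
    simp only [Equiv.swap_apply_def, Fin.ext_iff]
    split_ifs with a b
    · rw [a, swapSeq_self]; push_cast; ring
    · rw [b, swapSeq_succ]; push_cast; ring
    · rw [swapSeq_of_ne _ a b]
  unfold schurSeq
  rw [e, jacobiTrudi_comp_perm _ (fun j : Fin k => x j + ((k : ℤ) - 1 - (j : ℤ))),
    Equiv.Perm.sign_swap (by simp)]
  push_cast
  ring

theorem schurSeq_eq_zero (h : ℤ → A) {i : ℕ} (hi : i + 1 < k) (x : ℕ → ℤ)
    (hx : x (i + 1) = x i + 1) : schurSeq k h x = 0 := by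
  refine jacobiTrudi_eq_zero _ _ (i := ⟨i, by omega⟩) (j := ⟨i + 1, hi⟩) (by simp) ?_
  simp only [hx]
  push_cast
  ring

/-- The sequences that are not horizontal strips cancel under a sign-reversing involution: `swapSeq`
at the last place where x_{i+1} exceeds y_i. -/
theorem sum_raised_eq_sum_strips (h : ℤ → A) {y : ℕ → ℤ} (hy : IsPartition k y) (c : ℤ) :
    ∑ x ∈ raised k y c, schurSeq k h x = ∑ x ∈ strips k y c, schurSeq k h x := by
  classical
  rw [← Finset.sum_filter_add_sum_filter_not (raised k y c) (fun x => Interlace y x), strips]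
  convert add_zero _
  -- Taking the last violation makes the place recoverable: the swap at L alters only the entries L
  -- and L + 1, so the comparisons of x_{j+1} with y_j for j > L are untouched, while the one at L
  -- remains violated since x_L + 1 > y_L.
  have hex : ∀ x ∈ (raised k y c).filter (fun x => ¬ Interlace y x), ∃ i,
      (i + 1 < k ∧ y i < x (i + 1)) ∧ ∀ j, i < j → ¬ (j + 1 < k ∧ y j < x (j + 1)) := by
    intro x hx
    rw [mem_filter, mem_raised hy] at hx
    refine exists_last (B := k) (fun i hi => by omega) ?_
    by_contra hne
    push Not at hne
    refine hx.2 fun i => ⟨hx.1.1 i, ?_⟩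
    by_cases hi : i + 1 < k
    · exact hne i hi
    · rw [hx.1.2.1 _ (by omega)]
      exact hy.nonneg i
  choose! L hL1 hL2 using hex
  have hmem : ∀ x ∈ (raised k y c).filter (fun x => ¬ Interlace y x),
      swapSeq (L x) x ∈ (raised k y c).filter (fun x => ¬ Interlace y x) := by
    intro x hx
    have h1 := hL1 x hx
    rw [mem_filter, mem_raised hy] at hx ⊢
    obtain ⟨⟨h2, h3, h4⟩, h5⟩ := hx
    refine ⟨⟨fun i => ?_, fun i hi => ?_, ?_⟩, fun hI => ?_⟩
    · by_cases hi : i = L x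
      · rw [hi, swapSeq_self]; omega
      · by_cases hi' : i = L x + 1
        · rw [hi', swapSeq_succ]
          have := h2 (L x)
          have := hy.anti (L x)
          omega
        · rw [swapSeq_of_ne _ hi hi']; exact h2 i
    · rw [swapSeq_of_ne _ (by omega) (by omega)]
      exact h3 i hi
    · rw [sum_swapSeq h1.1, h4]
    · have := (hI (L x)).2
      rw [swapSeq_succ] at this
      have := h2 (L x)
      omega
  refine Finset.sum_involution (fun x _ => swapSeq (L x) x) ?_ ?_ hmem ?_
  · intro x hx
    rw [schurSeq_swapSeq h (hL1 x hx).1, add_neg_cancel]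
  -- At a fixed point x_{L+1} = x_L + 1, so the determinant has two equal rows and the term is zero.
  · intro x hx hne heq
    apply hne
    apply schurSeq_eq_zero h (hL1 x hx).1
    have := congrFun heq (L x)
    rw [swapSeq_self] at this
    omega
  · intro x hx
    have h1 := hL1 x hx
    have h2 := hL2 x hx
    have h3 := hL1 _ (hmem x hx)
    have h4 := hL2 _ (hmem x hx)
    rw [mem_filter, mem_raised hy] at hx
    have : L (swapSeq (L x) x) = L x := by
      rcases lt_trichotomy (L (swapSeq (L x) x)) (L x) with hlt | heq | hgt
      · refine absurd ?_ (h4 _ hlt)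
        rw [swapSeq_succ]
        have := hx.1.1 (L x)
        exact ⟨h1.1, by omega⟩
      · exact heq
      · refine absurd ?_ (h2 _ hgt)
        rw [swapSeq_of_ne _ (by omega) (by omega)] at h3
        exact h3
    simp only [this, swapSeq_swapSeq]

/-- Pieri's rule. -/
theorem complete_mul_schurSeq (x : Fin k → A) {y : ℕ → ℤ} (hy : IsPartition k y) (c : ℤ) :
    complete x c * schurSeq k (complete x) y =
      ∑ z ∈ strips k y c, schurSeq k (complete x) z := by
  by_cases hc : c < 0
  · rw [complete_of_neg _ hc, zero_mul]
    symm
    apply Finset.sum_eq_zero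
    intro z hz
    rw [mem_strips hy] at hz
    have := Finset.sum_le_sum fun i (_ : i ∈ range k) => (hz.1 i).1
    omega
  obtain ⟨m, rfl⟩ := Int.eq_ofNat_of_zero_le (not_lt.1 hc)
  rw [← sum_raised_eq_sum_strips _ hy]
  have h0 := complete_mul_jacobiTrudi x m (fun i => (y i).toNat + staircase k i)
  have e1 : schurSeq k (complete x) y =
      jacobiTrudi (complete x) (fun i : Fin k => (((y i).toNat + staircase k i : ℕ) : ℤ)) := by
    unfold schurSeq
    congr 1
    funext i
    have := hy.nonneg i
    simp only [staircase]
    omega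
  rw [e1]
  refine h0.trans ?_
  refine Finset.sum_bij (fun β _ r => if hr : r < k then y r + β ⟨r, hr⟩ else 0) ?_ ?_ ?_ ?_
  · intro β hβ
    rw [mem_raised hy]
    simp only [mem_piAntidiag, mem_univ, implies_true, and_true] at hβ
    refine ⟨fun i => ?_, fun i hi => by rw [dif_neg (by omega)], ?_⟩
    · split_ifs with hi
      · omega
      · rw [hy.support i (by omega)]
    · rw [Finset.sum_range, Finset.sum_range, ← hβ]
      push_cast
      rw [← Finset.sum_add_distrib]
      refine Finset.sum_congr rfl fun i _ => ?_
      simp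
  · intro β _ γ _ h
    funext i
    have := congrFun h i
    simpa using this
  · intro z hz
    rw [mem_raised hy] at hz
    refine ⟨fun i => (z i - y i).toNat, ?_, ?_⟩
    · simp only [mem_piAntidiag, mem_univ, implies_true, and_true]
      zify
      have e : ∀ i ∈ (univ : Finset (Fin k)), (((z i - y i).toNat : ℕ) : ℤ) = z i - y i := by
        intro i _
        have := hz.1 i
        omega
      rw [Finset.sum_congr rfl e, Finset.sum_sub_distrib, ← Finset.sum_range,
        ← Finset.sum_range, hz.2.2]
      ring
    · funext r
      split_ifs with hr
      · have := hz.1 r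
        simp only
        omega
      · exact (hz.2.1 r (by omega)).symm
  · intro β _
    unfold schurSeq
    congr 1
    funext i
    have := hy.nonneg i
    simp only [Fin.is_lt, dif_pos, Fin.eta, staircase]
    omega

end Pieri
-- Chains of horizontal strips and the iterated Pieri rule.
/-- A chain of partitions `y = G 0, …, G l` in which `G (j + 1) / G j` is a horizontal strip of size
`c j`; continued by zeros. -/
structure IsHorizontalChain (k : ℕ) (y : ℕ → ℤ) (c : ℕ → ℤ) (l : ℕ) (G : ℕ → ℕ → ℤ) : Prop where
  start : G 0 = y
  interlace : ∀ j < l, Interlace (G j) (G (j + 1))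
  support : ∀ j ≤ l, ∀ i, k ≤ i → G j i = 0
  sum_eq : ∀ j < l, ∑ i ∈ range k, G (j + 1) i = ∑ i ∈ range k, G j i + c j
  eq_zero : ∀ j, l < j → G j = 0

namespace IsHorizontalChain

variable {k l : ℕ} {y : ℕ → ℤ} {c : ℕ → ℤ} {G : ℕ → ℕ → ℤ}

theorem isPartition (hy : IsPartition k y) (hG : IsHorizontalChain k y c l G) {j : ℕ} (hj : j ≤ l) :
    IsPartition k (G j) := by
  induction j with
  | zero => rw [hG.start]; exact hy
  | succ j ih => exact (ih (by omega)).of_interlace (hG.interlace j (by omega)) (hG.support _ hj)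

theorem mono (hG : IsHorizontalChain k y c l G) {j j' : ℕ} (h : j ≤ j') (hj' : j' ≤ l) (i : ℕ) :
    G j i ≤ G j' i := by
  induction j', h using Nat.le_induction with
  | base => rfl
  | succ j' _ ih => exact (ih (by omega)).trans ((hG.interlace j' (by omega) i).1)

theorem sum_last (hG : IsHorizontalChain k y c l G) {j : ℕ} (hj : j ≤ l) :
    ∑ i ∈ range k, G j i = ∑ i ∈ range k, y i + ∑ r ∈ range j, c r := by
  induction j with
  | zero => simp [hG.start]
  | succ j ih => rw [hG.sum_eq j (by omega), ih (by omega), Finset.sum_range_succ, add_assoc]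

end IsHorizontalChain

theorem finite_chains (k : ℕ) {y : ℕ → ℤ} (hy : IsPartition k y) (c : ℕ → ℤ) (l : ℕ) :
    {G | IsHorizontalChain k y c l G}.Finite := by
  have := finite_setOf_bounded (range (l + 1) ×ˢ range k)
    (∑ i ∈ range k, y i + ∑ r ∈ range l, c r)
  refine Set.Finite.of_injOn (f := Function.uncurry) ?_ (Function.LeftInverse.injective
    (g := Function.curry) fun _ => rfl).injOn this
  intro G hG
  refine ⟨?_, ?_⟩
  · rintro ⟨j, i⟩ h
    simp only [mem_product, mem_range, not_and_or, not_lt] at h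
    by_cases hj : j ≤ l
    · exact hG.support j hj i (by omega)
    · exact congrFun (hG.eq_zero j (by omega)) i
  · rintro ⟨j, i⟩
    simp only [Function.uncurry]
    by_cases hj : j ≤ l
    · have h1 := hG.isPartition hy hj
      have h2 := hG.isPartition hy le_rfl
      refine ⟨h1.nonneg i, (hG.mono hj le_rfl i).trans ?_⟩
      rw [← hG.sum_last le_rfl]
      exact le_sum_range h2.nonneg h2.support i
    · rw [hG.eq_zero j (by omega)]
      refine ⟨le_rfl, ?_⟩
      have h2 := hG.isPartition hy le_rfl
      rw [← hG.sum_last le_rfl]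
      exact Finset.sum_nonneg fun r _ => h2.nonneg r

open Classical in
/-- The finset of all chains. -/
noncomputable def chains (k : ℕ) (y : ℕ → ℤ) (c : ℕ → ℤ) (l : ℕ) : Finset (ℕ → ℕ → ℤ) :=
  if hy : IsPartition k y then (finite_chains k hy c l).toFinset else ∅

theorem mem_chains {k l : ℕ} {y : ℕ → ℤ} (hy : IsPartition k y) {c : ℕ → ℤ} {G : ℕ → ℕ → ℤ} :
    G ∈ chains k y c l ↔ IsHorizontalChain k y c l G := by
  simp [chains, dif_pos hy]

section Sum

variable {A : Type*} [CommRing A] {k : ℕ}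

/-- Iterating Pieri's rule records all intermediate partitions. Only the Pieri property of `F`
enters, so `F` need not be given by determinants. -/
theorem prod_mul_eq_sum_chains {h : ℤ → A} {F : (ℕ → ℤ) → A}
    (hF : ∀ y, IsPartition k y → ∀ c, h c * F y = ∑ z ∈ strips k y c, F z)
    {y : ℕ → ℤ} (hy : IsPartition k y) (c : ℕ → ℤ) (l : ℕ) :
    (∏ j ∈ range l, h (c j)) * F y = ∑ G ∈ chains k y c l, F (G l) := by
  induction l with
  | zero =>
    rw [prod_range_zero, one_mul]
    symm
    rw [Finset.sum_eq_single_of_mem (fun j => if j = 0 then y else 0)]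
    · simp
    · rw [mem_chains hy]
      exact ⟨by simp, by simp, fun j hj i hi => by simp [Nat.le_zero.1 hj, hy.support i hi],
        by simp, fun j hj => by simp [hj.ne']⟩
    · intro G hG hne
      rw [mem_chains hy] at hG
      refine absurd ?_ hne
      funext j
      split_ifs with hj
      · rw [hj, hG.start]
      · exact hG.eq_zero j (by omega)
  | succ l ih =>
    rw [prod_range_succ, mul_comm _ (h (c l)), mul_assoc, ih, Finset.mul_sum]
    have e : ∀ G ∈ chains k y c l, h (c l) * F (G l) = ∑ z ∈ strips k (G l) (c l), F z := by
      intro G hG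
      rw [mem_chains hy] at hG
      exact hF _ (hG.isPartition hy le_rfl) _
    rw [Finset.sum_congr rfl e, Finset.sum_sigma']
    -- A chain of length l + 1 is a chain of length l together with its last member; removing that
    -- member resets it to 0, as `eq_zero` demands.
    refine Finset.sum_bij' (fun p _ => Function.update p.1 (l + 1) p.2)
      (fun G _ => ⟨Function.update G (l + 1) 0, G (l + 1)⟩) ?_ ?_ ?_ ?_ ?_
    · rintro ⟨G, z⟩ hp
      simp only [mem_sigma, mem_chains hy] at hp ⊢
      obtain ⟨hG, hz⟩ := hp
      rw [mem_strips (hG.isPartition hy le_rfl)] at hz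
      have e1 : ∀ j ≤ l, Function.update G (l + 1) z j = G j := fun j hj =>
        Function.update_of_ne (by omega) _ _
      refine ⟨by rw [e1 0 (by omega), hG.start], ?_, ?_, ?_, ?_⟩
      · intro j hj
        rw [e1 j (by omega)]
        rcases Nat.lt_succ_iff_lt_or_eq.1 hj with h1 | rfl
        · rw [e1 _ h1]; exact hG.interlace j h1
        · rw [Function.update_self]; exact hz.1
      · intro j hj i hi
        rcases Nat.le_succ_iff.1 hj with h1 | rfl
        · rw [e1 _ h1]; exact hG.support j h1 i hi
        · rw [Function.update_self]; exact hz.2.1 i hi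
      · intro j hj
        rw [e1 j (by omega)]
        rcases Nat.lt_succ_iff_lt_or_eq.1 hj with h1 | rfl
        · rw [e1 _ h1]; exact hG.sum_eq j h1
        · rw [Function.update_self]; exact hz.2.2
      · intro j hj
        rw [Function.update_of_ne (by omega)]
        exact hG.eq_zero j (by omega)
    · intro G hG
      rw [mem_chains hy] at hG
      have e1 : ∀ j ≤ l, Function.update G (l + 1) 0 j = G j := fun j hj =>
        Function.update_of_ne (by omega) _ _
      have hG' : IsHorizontalChain k y c l (Function.update G (l + 1) 0) := by
        refine ⟨by rw [e1 0 (by omega), hG.start], ?_, ?_, ?_, ?_⟩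
        · intro j hj
          rw [e1 j (by omega), e1 _ hj]
          exact hG.interlace j (by omega)
        · intro j hj
          rw [e1 j hj]
          exact hG.support j (by omega)
        · intro j hj
          rw [e1 j (by omega), e1 _ hj]
          exact hG.sum_eq j (by omega)
        · intro j hj
          by_cases hj' : j = l + 1
          · rw [hj', Function.update_self]
          · rw [Function.update_of_ne hj']
            exact hG.eq_zero j (by omega)
      simp only [mem_sigma, mem_chains hy]
      refine ⟨hG', ?_⟩
      rw [mem_strips (hG'.isPartition hy le_rfl), e1 l le_rfl]
      exact ⟨hG.interlace l (by omega), hG.support _ le_rfl, hG.sum_eq l (by omega)⟩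
    · rintro ⟨G, z⟩ hp
      simp only [mem_sigma, mem_chains hy] at hp
      have : Function.update (Function.update G (l + 1) z) (l + 1) 0 = G := by
        rw [Function.update_idem, Function.update_eq_self_iff]
        exact (hp.1.eq_zero _ (by omega)).symm
      simp [this]
    · intro G _
      simp
    · rintro ⟨G, z⟩ _
      simp

end Sum

/-! ### Lattice chains -/

/-- The row-wise bound in the lattice condition for three consecutive partitions `y, z, x`. -/
def latticeBound (y z x : ℕ → ℤ) (i : ℕ) : ℤ :=
  ∑ r ∈ range (i + 1), x r + ∑ r ∈ range i, y r - 2 * ∑ r ∈ range i, z r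

theorem latticeBound_zero (y z x : ℕ → ℤ) : latticeBound y z x 0 = x 0 := by
  simp [latticeBound]

theorem latticeBound_succ (y z x : ℕ → ℤ) (i : ℕ) :
    latticeBound y z x (i + 1) = latticeBound y z x i + x (i + 1) + y i - 2 * z i := by
  simp only [latticeBound, Finset.sum_range_succ]
  ring

theorem latticeBound_congr {y z x y' z' x' : ℕ → ℤ} {i : ℕ} (hy : ∀ r < i, y r = y' r)
    (hz : ∀ r < i, z r = z' r) (hx : ∀ r ≤ i, x r = x' r) :
    latticeBound y z x i = latticeBound y' z' x' i := by
  unfold latticeBound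
  rw [Finset.sum_congr rfl fun r hr => hx r (by simpa [Nat.lt_succ_iff] using hr),
    Finset.sum_congr rfl fun r hr => hy r (by simpa using hr),
    Finset.sum_congr rfl fun r hr => hz r (by simpa using hr)]

/-- The partial Bender-Knuth reflection of `z` between `y` and `x`, from row `i` on. -/
def reflectRow (y z x : ℕ → ℤ) (i : ℕ) : ℕ → ℤ := fun r =>
  if r < i then z r
  else if r = i then latticeBound y z x i - 1 + max (x (i + 1)) (y i) - z i
  else min (x r) (y (r - 1)) + max (x (r + 1)) (y r) - z r

theorem reflectRow_of_lt {y z x : ℕ → ℤ} {i r : ℕ} (h : r < i) : reflectRow y z x i r = z r := by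
  simp [reflectRow, h]

theorem reflectRow_self (y z x : ℕ → ℤ) (i : ℕ) :
    reflectRow y z x i i = latticeBound y z x i - 1 + max (x (i + 1)) (y i) - z i := by
  simp [reflectRow]

theorem reflectRow_succ {y z x : ℕ → ℤ} {i r : ℕ} (h : i ≤ r) : reflectRow y z x i (r + 1) =
    min (x (r + 1)) (y r) + max (x (r + 1 + 1)) (y (r + 1)) - z (r + 1) := by
  simp only [reflectRow]
  rw [if_neg (by omega), if_neg (by omega)]
  simp

/-- Each row from i on is reflected in an interval whose ends do not change: the bound in row i
involves `z` only in the rows above i, which stay fixed. -/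
theorem reflectRow_reflectRow (y z x : ℕ → ℤ) (i : ℕ) :
    reflectRow y (reflectRow y z x i) x i = z := by
  have hb : latticeBound y (reflectRow y z x i) x i = latticeBound y z x i :=
    latticeBound_congr (fun _ _ => rfl) (fun r hr => reflectRow_of_lt hr) fun _ _ => rfl
  funext r
  rcases lt_trichotomy r i with h | h | h
  · rw [reflectRow_of_lt h, reflectRow_of_lt h]
  · subst h; rw [reflectRow_self, reflectRow_self, hb]; ring
  · obtain ⟨r, rfl⟩ : ∃ r', r = r' + 1 := ⟨r - 1, by omega⟩
    rw [reflectRow_succ (by omega), reflectRow_succ (by omega)]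
    ring

/-- Interlacing confines row r of `z` to the interval from max(x_{r+1}, y_r) to min(x_r, y_{r-1})
(just x_0 above, if r = 0). Rows after i are reflected in this interval. In row i the upper end is
replaced by the lattice bound minus one, so the failure persists; that no row above i fails gives
that the bound is at most the old upper end. -/
theorem interlace_reflectRow {y z x : ℕ → ℤ} {i : ℕ} (hyz : Interlace y z) (hzx : Interlace z x)
    (hlt : ∀ r < i, latticeBound y z x r ≤ z r) (hi : z i < latticeBound y z x i) :
    Interlace y (reflectRow y z x i) ∧ Interlace (reflectRow y z x i) x := by
  have h0 : max (x (i + 1)) (y i) ≤ reflectRow y z x i i := by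
    rw [reflectRow_self]; omega
  have h1 : reflectRow y z x i i < latticeBound y z x i := by
    rw [reflectRow_self]
    have := (hyz i).1
    have := (hzx i).2
    omega
  have h2 : latticeBound y z x i ≤ x i := by
    cases i with
    | zero => rw [latticeBound_zero]
    | succ i =>
      have := hlt i (by omega)
      rw [latticeBound_succ]
      have := (hyz i).1
      omega
  have lower : ∀ r, max (x (r + 1)) (y r) ≤ reflectRow y z x i r := by
    intro r
    rcases lt_trichotomy r i with h | h | h
    · rw [reflectRow_of_lt h]
      exact max_le (hzx r).2 (hyz r).1
    · rw [h]; exact h0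
    · obtain ⟨r, rfl⟩ : ∃ r', r = r' + 1 := ⟨r - 1, by omega⟩
      rw [reflectRow_succ (by omega)]
      have := (hyz r).2
      have := (hzx (r + 1)).1
      omega
  have upper : ∀ r, reflectRow y z x i r ≤ x r := by
    intro r
    rcases lt_trichotomy r i with h | h | h
    · rw [reflectRow_of_lt h]
      exact (hzx r).1
    · rw [h]; omega
    · obtain ⟨r, rfl⟩ : ∃ r', r = r' + 1 := ⟨r - 1, by omega⟩
      rw [reflectRow_succ (by omega)]
      have := (hyz (r + 1)).1
      have := (hzx (r + 1)).2
      omega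
  have upper' : ∀ r, reflectRow y z x i (r + 1) ≤ y r := by
    intro r
    rcases lt_trichotomy (r + 1) i with h | h | h
    · rw [reflectRow_of_lt h]
      exact (hyz r).2
    · subst h
      have := hlt r (by omega)
      rw [latticeBound_succ] at h1
      have := (hzx r).2
      omega
    · rw [reflectRow_succ (by omega)]
      have := (hyz (r + 1)).1
      have := (hzx (r + 1)).2
      omega
  exact ⟨fun r => ⟨(le_max_right _ _).trans (lower r), upper' r⟩,
    fun r => ⟨upper r, (le_max_left _ _).trans (lower r)⟩⟩

theorem reflectRow_support {k : ℕ} {y z x : ℕ → ℤ} {i : ℕ} (hy : ∀ r, 0 ≤ y r) (hi : i < k)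
    (hys : ∀ r, k ≤ r → y r = 0) (hzs : ∀ r, k ≤ r → z r = 0) (hxs : ∀ r, k ≤ r → x r = 0)
    (r : ℕ) (hr : k ≤ r) : reflectRow y z x i r = 0 := by
  obtain ⟨r, rfl⟩ : ∃ r', r = r' + 1 := ⟨r - 1, by omega⟩
  rw [reflectRow_succ (by omega), hxs _ hr, hxs _ (by omega), hys _ hr, hzs _ hr]
  have := hy r
  omega

/-- Since min(x_r, y_{r-1}) + max(x_r, y_{r-1}) = x_r + y_{r-1}, the sum telescopes up to a boundary
term, which vanishes because x_k = 0. The final -1 makes the contents (c_m, c_{m+1}) become (c_{m+1}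
- 1, c_m + 1). -/
theorem sum_reflectRow {k : ℕ} {y z x : ℕ → ℤ} {i : ℕ} (hi : i < k) (hy : ∀ r, 0 ≤ y r)
    (hxs : x k = 0) :
    ∑ r ∈ range k, reflectRow y z x i r =
      ∑ r ∈ range k, x r + ∑ r ∈ range k, y r - ∑ r ∈ range k, z r - 1 := by
  have key : ∀ K, i + 1 ≤ K → ∑ r ∈ range K, reflectRow y z x i r =
      ∑ r ∈ range K, x r + ∑ r ∈ range K, y r - ∑ r ∈ range K, z r - 1 +
        (max (x K) (y (K - 1)) - y (K - 1)) := by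
    intro K hK
    induction K, hK using Nat.le_induction with
    | base =>
      have e : ∑ r ∈ range i, reflectRow y z x i r = ∑ r ∈ range i, z r :=
        Finset.sum_congr rfl fun r hr => reflectRow_of_lt (by simpa using hr)
      rw [Finset.sum_range_succ, e, reflectRow_self]
      simp only [latticeBound, Finset.sum_range_succ, Nat.add_sub_cancel]
      ring
    | succ K hK ih =>
      obtain ⟨K, rfl⟩ : ∃ r', K = r' + 1 := ⟨K - 1, by omega⟩
      rw [Finset.sum_range_succ, ih, reflectRow_succ (by omega), Finset.sum_range_succ _ (K + 1),
        Finset.sum_range_succ _ (K + 1), Finset.sum_range_succ z (K + 1)]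
      simp only [Nat.add_sub_cancel]
      have := min_add_max (x (K + 1)) (y K)
      linarith
  rw [key k hi, hxs, max_eq_right (hy _)]
  ring

/-- The failure of the lattice condition at the step `m` and the row `i`. -/
def LatticeFails (k : ℕ) (G : ℕ → ℕ → ℤ) (m i : ℕ) : Prop :=
  (m + 2 ≤ k ∧ i < k) ∧ G (m + 1) i < latticeBound (G m) (G (m + 1)) (G (m + 2)) i

/-- The lattice condition. -/
def IsLattice (k : ℕ) (G : ℕ → ℕ → ℤ) : Prop := ∀ m i, ¬ LatticeFails k G m i

/-- The first failure of the lattice condition: in the topmost possible row, and there at the last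
possible step. -/
structure IsFirstFailure (k : ℕ) (G : ℕ → ℕ → ℤ) (m i : ℕ) : Prop where
  fails : LatticeFails k G m i
  top : ∀ m' i', i' < i → ¬ LatticeFails k G m' i'
  last : ∀ m', m < m' → ¬ LatticeFails k G m' i

theorem exists_isFirstFailure {k : ℕ} {G : ℕ → ℕ → ℤ} (h : ¬ IsLattice k G) :
    ∃ p : ℕ × ℕ, IsFirstFailure k G p.1 p.2 := by
  classical
  have h1 : ∃ i, ∃ m, LatticeFails k G m i := by
    unfold IsLattice at h
    push Not at h
    obtain ⟨m, i, h⟩ := h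
    exact ⟨i, m, h⟩
  obtain ⟨m, hm, hm'⟩ := exists_last (P := fun m => LatticeFails k G m (Nat.find h1)) (B := k)
    (fun m hm => by have := hm.1.1; omega) (Nat.find_spec h1)
  refine ⟨⟨m, Nat.find h1⟩, hm, fun m' i' hi' hf => ?_, hm'⟩
  exact Nat.find_min h1 hi' ⟨m', hf⟩

theorem IsFirstFailure.unique {k : ℕ} {G : ℕ → ℕ → ℤ} {p q : ℕ × ℕ}
    (hp : IsFirstFailure k G p.1 p.2) (hq : IsFirstFailure k G q.1 q.2) : p = q := by
  have h2 : p.2 = q.2 := by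
    rcases lt_trichotomy p.2 q.2 with h | h | h
    · exact absurd hp.fails (hq.top _ _ h)
    · exact h
    · exact absurd hq.fails (hp.top _ _ h)
  refine Prod.ext ?_ h2
  rcases lt_trichotomy p.1 q.1 with h | h | h
  · exact absurd hq.fails (h2 ▸ hp.last _ h)
  · exact h
  · exact absurd hp.fails (h2 ▸ hq.last _ h)

/-- The reflection of a chain at the step `m` and the row `i`. -/
def reflectChain (m i : ℕ) (G : ℕ → ℕ → ℤ) : ℕ → ℕ → ℤ :=
  Function.update G (m + 1) (reflectRow (G m) (G (m + 1)) (G (m + 2)) i)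

theorem reflectChain_succ (m i : ℕ) (G : ℕ → ℕ → ℤ) : reflectChain m i G (m + 1) =
    reflectRow (G m) (G (m + 1)) (G (m + 2)) i := Function.update_self ..

theorem reflectChain_of_ne {m j : ℕ} (i : ℕ) (G : ℕ → ℕ → ℤ) (h : j ≠ m + 1) :
    reflectChain m i G j = G j := Function.update_of_ne h ..

theorem reflectChain_of_lt {i r : ℕ} (m j : ℕ) (G : ℕ → ℕ → ℤ) (h : r < i) :
    reflectChain m i G j r = G j r := by
  by_cases hj : j = m + 1
  · rw [hj, reflectChain_succ, reflectRow_of_lt h]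
  · rw [reflectChain_of_ne i G hj]

theorem reflectChain_reflectChain (m i : ℕ) (G : ℕ → ℕ → ℤ) :
    reflectChain m i (reflectChain m i G) = G := by
  funext j
  by_cases hj : j = m + 1
  · subst hj
    rw [reflectChain_succ, reflectChain_succ, reflectChain_of_ne i G (by omega),
      reflectChain_of_ne i G (by omega), reflectRow_reflectRow]
  · rw [reflectChain_of_ne _ _ hj, reflectChain_of_ne _ _ hj]

/-- Only member m + 1 changes, and only in the rows from i on. The condition in a row above i never
sees these entries, nor does the condition in row i at a step after m, where members m' + 1 and m' +
2 differ from m + 1. An earlier step could see them, which is why the last failing step is chosen.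
-/
theorem IsFirstFailure.reflectChain {k m i : ℕ} {G : ℕ → ℕ → ℤ}
    (hG : Interlace (G m) (G (m + 1)) ∧ Interlace (G (m + 1)) (G (m + 2)))
    (h : IsFirstFailure k G m i) : IsFirstFailure k (reflectChain m i G) m i := by
  refine ⟨⟨h.fails.1, ?_⟩, ?_, ?_⟩
  · rw [reflectChain_of_ne i G (show m ≠ m + 1 by omega),
      reflectChain_of_ne i G (show m + 2 ≠ m + 1 by omega)]
    have e : latticeBound (G m) (Fusion.reflectChain m i G (m + 1)) (G (m + 2)) i =
        latticeBound (G m) (G (m + 1)) (G (m + 2)) i :=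
      latticeBound_congr (fun _ _ => rfl) (fun r hr => reflectChain_of_lt _ _ _ hr) fun _ _ => rfl
    rw [e, reflectChain_succ, reflectRow_self]
    have := (hG.1 i).1
    have := (hG.2 i).2
    omega
  · intro m' i' hi' hf
    refine h.top m' i' hi' ⟨hf.1, ?_⟩
    have := hf.2
    rwa [reflectChain_of_lt _ _ _ hi', latticeBound_congr
      (fun r hr => reflectChain_of_lt _ _ _ (hr.trans hi'))
      (fun r hr => reflectChain_of_lt _ _ _ (hr.trans hi'))
      (fun r hr => reflectChain_of_lt _ _ _ (hr.trans_lt hi'))] at this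
  · intro m' hm' hf
    refine h.last m' hm' ⟨hf.1, ?_⟩
    have := hf.2
    rwa [reflectChain_of_ne i G (show m' + 1 ≠ m + 1 by omega),
      reflectChain_of_ne i G (show m' + 2 ≠ m + 1 by omega), latticeBound_congr
      (fun r hr => reflectChain_of_lt _ _ _ hr) (fun _ _ => rfl) fun _ _ => rfl] at this

theorem IsHorizontalChain.reflectChain {k m i : ℕ} {y : ℕ → ℤ} {c c' : ℕ → ℤ} {G : ℕ → ℕ → ℤ}
    (hy : IsPartition k y) (hG : IsHorizontalChain k y c k G) (h : IsFirstFailure k G m i)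
    (h1 : c' m = c (m + 1) - 1) (h2 : c' (m + 1) = c m + 1)
    (h3 : ∀ j, j ≠ m → j ≠ m + 1 → c' j = c j) :
    IsHorizontalChain k y c' k (reflectChain m i G) := by
  obtain ⟨⟨⟨hm, hi⟩, hf⟩, htop, -⟩ := h
  have hI := interlace_reflectRow (hG.interlace m (by omega)) (hG.interlace (m + 1) (by omega))
    (fun r hr => by
      by_contra hlt
      exact htop m r hr ⟨⟨hm, by omega⟩, not_le.1 hlt⟩) hf
  have hym := hG.isPartition hy (j := m) (by omega)
  have hsum := sum_reflectRow (z := G (m + 1)) (x := G (m + 2)) hi hym.nonneg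
    (hG.support _ hm k le_rfl)
  have s1 := hG.sum_eq m (by omega)
  have s2 := hG.sum_eq (m + 1) (by omega)
  rw [show m + 1 + 1 = m + 2 from rfl] at s2
  refine ⟨?_, ?_, ?_, ?_, ?_⟩
  · rw [reflectChain_of_ne _ _ (by omega), hG.start]
  · intro j hj
    by_cases e1 : j = m
    · subst e1
      rw [reflectChain_succ, reflectChain_of_ne _ _ (by omega)]
      exact hI.1
    · by_cases e2 : j = m + 1
      · subst e2
        rw [reflectChain_succ, reflectChain_of_ne _ _ (by omega)]
        exact hI.2
      · rw [reflectChain_of_ne _ _ e2, reflectChain_of_ne _ _ (by omega)]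
        exact hG.interlace j hj
  · intro j hj
    by_cases e2 : j = m + 1
    · subst e2
      rw [reflectChain_succ]
      exact reflectRow_support hym.nonneg hi hym.support (hG.support _ (by omega))
        (hG.support _ hm)
    · rw [reflectChain_of_ne _ _ e2]
      exact hG.support j hj
  · intro j hj
    by_cases e1 : j = m
    · subst e1
      rw [reflectChain_succ, reflectChain_of_ne _ _ (show j ≠ j + 1 by omega), h1]
      linarith
    · by_cases e2 : j = m + 1
      · subst e2
        rw [reflectChain_succ, reflectChain_of_ne _ _ (by omega), h2]
        rw [show m + 1 + 1 = m + 2 from rfl]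
        linarith
      · rw [reflectChain_of_ne _ _ e2, reflectChain_of_ne _ _ (by omega), h3 j e1 e2]
        exact hG.sum_eq j hj
  · intro j hj
    rw [reflectChain_of_ne _ _ (by omega)]
    exact hG.eq_zero j hj

/-- The lattice condition in the bottom row k - 1 compares the whole contents of two successive
letters. -/
theorem IsLattice.content_le {k m : ℕ} {y : ℕ → ℤ} {c : ℕ → ℤ} {G : ℕ → ℕ → ℤ}
    (hy : IsPartition k y) (hG : IsHorizontalChain k y c k G) (hL : IsLattice k G)
    (hm : m + 2 ≤ k) : c (m + 1) ≤ c m := by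
  obtain ⟨K, rfl⟩ : ∃ K, k = K + 1 := ⟨k - 1, by omega⟩
  have h1 := hG.sum_eq m (by omega)
  have h2 := hG.sum_eq (m + 1) (by omega)
  have h3 : ¬ _ := fun h => hL m K ⟨⟨hm, by omega⟩, h⟩
  rw [latticeBound] at h3
  have h4 := (hG.interlace m (by omega) K).1
  simp only [Finset.sum_range_succ, show m + 1 + 1 = m + 2 from rfl] at h1 h2 h3
  linarith

/-- The contents `μ_{w j} - w j + j`. -/
def permContent (k : ℕ) (mu : ℕ → ℤ) (w : Equiv.Perm (Fin k)) (j : ℕ) : ℤ :=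
  if h : j < k then mu (w ⟨j, h⟩) - ((w ⟨j, h⟩ : Fin k) : ℤ) + j else 0

/-- Lattice chains have weakly decreasing contents, so μ_{w j} - w j strictly decreases in j. As μ_a
- a decreases in a, the permutation is increasing, hence trivial. -/
theorem eq_one_of_isLattice {k : ℕ} {y mu : ℕ → ℤ} {G : ℕ → ℕ → ℤ} {w : Equiv.Perm (Fin k)}
    (hy : IsPartition k y) (hmu : IsPartition k mu)
    (hG : IsHorizontalChain k y (permContent k mu w) k G) (hL : IsLattice k G) : w = 1 := by
  have hanti : Antitone mu := antitone_nat_of_succ_le hmu.anti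
  have hmono : StrictMono w := by
    cases k with
    | zero => intro i; exact i.elim0
    | succ K =>
      rw [Fin.strictMono_iff_lt_succ]
      intro i
      have h := hL.content_le hy hG (m := i) (by omega)
      rw [permContent, permContent, dif_pos (by omega), dif_pos (by omega)] at h
      have e1 : (⟨(i : ℕ), by omega⟩ : Fin (K + 1)) = i.castSucc := rfl
      have e2 : (⟨(i : ℕ) + 1, by omega⟩ : Fin (K + 1)) = i.succ := rfl
      rw [e1, e2] at h
      by_contra hlt
      have h5 : w i.succ ≤ w i.castSucc := not_lt.1 hlt
      have h6 : ((w i.succ : Fin (K + 1)) : ℕ) ≤ (w i.castSucc : Fin (K + 1)) := h5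
      have h7 := hanti h6
      push_cast at h
      omega
  have : (w : Fin k → Fin k) = id :=
    (StrictMono.range_inj hmono strictMono_id).1 (by simp [w.surjective.range_eq])
  exact Equiv.ext fun i => congrFun this i

/-- Right multiplication by an adjacent transposition changes the contents exactly as `reflectChain`
does; this lets the reflection be paired with a change of sign. -/
theorem permContent_swap {k m : ℕ} (mu : ℕ → ℤ) (w : Equiv.Perm (Fin k)) (hm : m + 1 < k) :
    permContent k mu (w * Equiv.swap ⟨m, by omega⟩ ⟨m + 1, hm⟩) m = permContent k mu w (m + 1) - 1 ∧
    permContent k mu (w * Equiv.swap ⟨m, by omega⟩ ⟨m + 1, hm⟩) (m + 1) = permContent k mu w m + 1 ∧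
    ∀ j, j ≠ m → j ≠ m + 1 →
      permContent k mu (w * Equiv.swap ⟨m, by omega⟩ ⟨m + 1, hm⟩) j = permContent k mu w j := by
  refine ⟨?_, ?_, ?_⟩
  · rw [permContent, permContent, dif_pos (by omega), dif_pos hm]
    simp only [Equiv.Perm.mul_apply, Equiv.swap_apply_left]
    push_cast
    ring
  · rw [permContent, permContent, dif_pos hm, dif_pos (by omega)]
    simp only [Equiv.Perm.mul_apply, Equiv.swap_apply_right]
    push_cast
    ring
  · intro j h1 h2
    unfold permContent
    split_ifs with hj
    · rw [Equiv.Perm.mul_apply, Equiv.swap_apply_of_ne_of_ne (by simpa using h1)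
        (by simpa using h2)]
    · rfl

/-! ### The Littlewood-Richardson rule for lattice chains. -/

section Rule

variable {A : Type*} [CommRing A] {k : ℕ}

open Classical in
/-- The Littlewood-Richardson rule, for an arbitrary function satisfying Pieri's rule. -/
theorem schurSeq_mul_eq_sum_chains {h : ℤ → A} {F : (ℕ → ℤ) → A}
    (hF : ∀ y, IsPartition k y → ∀ c, h c * F y = ∑ z ∈ strips k y c, F z)
    {y mu : ℕ → ℤ} (hy : IsPartition k y) (hmu : IsPartition k mu) :
    schurSeq k h mu * F y =
      ∑ G ∈ (chains k y (fun j => if j < k then mu j else 0) k).filter (IsLattice k), F (G k) := by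
  -- Leibniz expansion of the Jacobi-Trudi determinant: `w` contributes the product of the h with
  -- indices μ_{w j} - w j + j, and each product acts on `F y` through chains.
  have h1 : schurSeq k h mu * F y = ∑ w : Equiv.Perm (Fin k), ∑ G ∈ chains k y (permContent k mu w) k,
      ((Equiv.Perm.sign w : ℤ) : A) * F (G k) := by
    unfold schurSeq jacobiTrudi
    rw [Matrix.det_apply', Finset.sum_mul]
    refine Finset.sum_congr rfl fun w _ => ?_
    rw [← Finset.mul_sum, ← prod_mul_eq_sum_chains hF hy, mul_assoc, Finset.prod_range]
    congr 2
    refine Finset.prod_congr rfl fun j _ => ?_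
    simp only [Matrix.of_apply, permContent, Fin.is_lt, dif_pos, Fin.eta]
    congr 1
    ring
  rw [h1, Finset.sum_sigma', ← Finset.sum_filter_add_sum_filter_not _ (fun p => IsLattice k p.2)]
  -- The non-lattice chains cancel: reflecting at the first failure is an involution that multiplies
  -- `w` by a transposition.
  have h2 : ∑ p ∈ (univ.sigma fun w => chains k y (permContent k mu w) k).filter
      (fun p => ¬ IsLattice k p.2), ((Equiv.Perm.sign p.1 : ℤ) : A) * F (p.2 k) = 0 := by
    have hex : ∀ G : ℕ → ℕ → ℤ, ¬ IsLattice k G → ∃ p : ℕ × ℕ, IsFirstFailure k G p.1 p.2 :=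
      fun G hG => exists_isFirstFailure hG
    choose! f hf using hex
    have hlt : ∀ G, ¬ IsLattice k G → (f G).1 + 1 < k := fun G hG => (hf G hG).fails.1.1
    let sw : (G : ℕ → ℕ → ℤ) → Equiv.Perm (Fin k) := fun G =>
      if h : (f G).1 + 1 < k then Equiv.swap ⟨(f G).1, by omega⟩ ⟨(f G).1 + 1, h⟩ else 1
    have hsw : ∀ G, ¬ IsLattice k G → ∃ h : (f G).1 + 1 < k,
        sw G = Equiv.swap ⟨(f G).1, by omega⟩ ⟨(f G).1 + 1, h⟩ :=
      fun G hG => ⟨hlt G hG, dif_pos (hlt G hG)⟩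
    let φ : (Σ _ : Equiv.Perm (Fin k), ℕ → ℕ → ℤ) → (Σ _ : Equiv.Perm (Fin k), ℕ → ℕ → ℤ) :=
      fun p => ⟨p.1 * sw p.2, reflectChain (f p.2).1 (f p.2).2 p.2⟩
    have hfail : ∀ p ∈ (univ.sigma fun w => chains k y (permContent k mu w) k).filter
        (fun p => ¬ IsLattice k p.2), IsFirstFailure k (φ p).2 (f p.2).1 (f p.2).2 := by
      rintro ⟨w, G⟩ hp
      simp only [mem_filter, mem_sigma, mem_univ, true_and, mem_chains hy] at hp
      have hlt' := hlt G hp.2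
      exact (hf G hp.2).reflectChain
        ⟨hp.1.interlace _ (Nat.lt_of_succ_lt hlt'), hp.1.interlace _ hlt'⟩
    have hmem : ∀ p ∈ (univ.sigma fun w => chains k y (permContent k mu w) k).filter
        (fun p => ¬ IsLattice k p.2), φ p ∈ (univ.sigma fun w =>
          chains k y (permContent k mu w) k).filter (fun p => ¬ IsLattice k p.2) := by
      rintro ⟨w, G⟩ hp
      have h0 := hfail _ hp
      simp only [mem_filter, mem_sigma, mem_univ, true_and, mem_chains hy] at hp ⊢
      refine ⟨?_, fun hL => hL _ _ h0.fails⟩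
      obtain ⟨h3, h4⟩ := hsw G hp.2
      obtain ⟨h5, h6, h7⟩ := permContent_swap mu w h3
      simp only [φ, h4]
      exact hp.1.reflectChain hy (hf G hp.2) h5 h6 h7
    have hf' : ∀ p ∈ (univ.sigma fun w => chains k y (permContent k mu w) k).filter
        (fun p => ¬ IsLattice k p.2), f (φ p).2 = f p.2 := by
      intro p hp
      have := (mem_filter.1 (hmem p hp)).2
      exact (hf _ this).unique (hfail p hp)
    refine Finset.sum_involution (fun p _ => φ p) ?_ ?_ hmem ?_
    · rintro ⟨w, G⟩ hp
      have hG := (mem_filter.1 hp).2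
      obtain ⟨h3, h4⟩ := hsw G hG
      -- The reflected member has index at most k - 1, so the endpoint, and with it the value of
      -- `F`, is kept.
      have e : reflectChain (f G).1 (f G).2 G k = G k := reflectChain_of_ne _ _ h3.ne'
      simp only [φ, e, h4, Equiv.Perm.sign_mul, Equiv.Perm.sign_swap (show
        (⟨(f G).1, Nat.lt_of_succ_lt h3⟩ : Fin k) ≠ ⟨(f G).1 + 1, h3⟩ by simp)]
      push_cast
      ring
    · rintro ⟨w, G⟩ hp _ heq
      have hG := (mem_filter.1 hp).2
      obtain ⟨h3, h4⟩ := hsw G hG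
      have h5 : w * sw G = w := congrArg Sigma.fst heq
      rw [h4, mul_eq_left, Equiv.swap_eq_one_iff] at h5
      simp at h5
    · rintro ⟨w, G⟩ hp
      have h5 := hf' _ hp
      have hG := (mem_filter.1 hp).2
      obtain ⟨h3, h4⟩ := hsw G hG
      have h6 : sw (φ ⟨w, G⟩).2 = sw G := by
        simp only [sw, h5]
      have h7 : reflectChain (f (φ ⟨w, G⟩).2).1 (f (φ ⟨w, G⟩).2).2 (φ ⟨w, G⟩).2 = G := by
        rw [h5]
        exact reflectChain_reflectChain _ _ _
      have h8 : (φ ⟨w, G⟩).1 * sw (φ ⟨w, G⟩).2 = w := by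
        rw [h6]
        simp only [φ, h4, mul_assoc, Equiv.swap_mul_self, mul_one]
      show (⟨_, _⟩ : Σ _ : Equiv.Perm (Fin k), ℕ → ℕ → ℤ) = _
      rw [h7, h8]
  rw [h2, add_zero]
  have hc : permContent k mu 1 = fun j => if j < k then mu j else 0 := by
    funext j
    unfold permContent
    split_ifs <;> simp
  refine Finset.sum_bij' (fun p _ => p.2) (fun G _ => ⟨1, G⟩) ?_ ?_ ?_ ?_ ?_
  · rintro ⟨w, G⟩ hp
    simp only [mem_filter, mem_sigma, mem_univ, true_and, mem_chains hy] at hp ⊢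
    have := eq_one_of_isLattice hy hmu hp.1 hp.2
    rw [this, hc] at hp
    exact hp
  · intro G hG
    simp only [mem_filter, mem_sigma, mem_univ, true_and, mem_chains hy] at hG ⊢
    rw [hc]
    exact hG
  · rintro ⟨w, G⟩ hp
    simp only [mem_filter, mem_sigma, mem_univ, true_and, mem_chains hy] at hp
    rw [eq_one_of_isLattice hy hmu hp.1 hp.2]
  · intro G _
    rfl
  · rintro ⟨w, G⟩ hp
    simp only [mem_filter, mem_sigma, mem_univ, true_and, mem_chains hy] at hp
    rw [eq_one_of_isLattice hy hmu hp.1 hp.2]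
    simp

end Rule
-- Littlewood-Richardson tableaux as lattice chains.
/-- The row lengths of a Young diagram as an integer sequence. -/
def rows (lam : YoungDiagram) : ℕ → ℤ := fun i => lam.rowLen i

theorem rowLen_eq_zero {lam : YoungDiagram} {i : ℕ} (h : lam.colLen 0 ≤ i) : lam.rowLen i = 0 := by
  by_contra hne
  have := YoungDiagram.mem_iff_lt_colLen.1
    (YoungDiagram.mem_iff_lt_rowLen.2 (Nat.pos_of_ne_zero hne))
  omega

theorem isPartition_rows {k : ℕ} {lam : YoungDiagram} (h : lam.colLen 0 ≤ k) :
    IsPartition k (rows lam) where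
  anti i := by
    have := lam.rowLen_anti i (i + 1) (Nat.le_succ i)
    simp only [rows]
    omega
  nonneg i := by simp [rows]
  support i hi := by simp [rows, rowLen_eq_zero (h.trans hi)]

theorem rows_injective : Function.Injective rows := by
  intro lam mu h
  apply YoungDiagram.ext
  ext ⟨i, j⟩
  have := congrFun h i
  simp only [rows, Nat.cast_inj] at this
  rw [YoungDiagram.mem_cells, YoungDiagram.mem_cells, YoungDiagram.mem_iff_lt_rowLen,
    YoungDiagram.mem_iff_lt_rowLen, this]

theorem mem_cells_sdiff {lam rho : YoungDiagram} {i j : ℕ} :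
    (i, j) ∈ rho.cells \ lam.cells ↔ lam.rowLen i ≤ j ∧ j < rho.rowLen i := by
  rw [mem_sdiff, YoungDiagram.mem_cells, YoungDiagram.mem_cells, YoungDiagram.mem_iff_lt_rowLen,
    YoungDiagram.mem_iff_lt_rowLen]
  omega

theorem card_cells_filter {k : ℕ} {lam rho : YoungDiagram} (hrho : rho.colLen 0 ≤ k)
    (P : ℕ × ℕ → Prop) [DecidablePred P] :
    ((rho.cells \ lam.cells).filter P).card =
      ∑ i ∈ range k, ((Ico (lam.rowLen i) (rho.rowLen i)).filter fun j => P (i, j)).card := by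
  rw [Finset.card_eq_sum_card_fiberwise (f := Prod.fst) (t := range k)]
  · refine Finset.sum_congr rfl fun i _ => ?_
    refine Finset.card_bij' (fun c _ => c.2) (fun j _ => (i, j)) ?_ ?_ ?_ ?_
    · rintro ⟨a, j⟩ h
      simp only [mem_filter, mem_cells_sdiff, mem_Ico] at h ⊢
      obtain ⟨⟨h1, h2⟩, rfl⟩ := h
      exact ⟨h1, h2⟩
    · intro j h
      simp only [mem_filter, mem_cells_sdiff, mem_Ico] at h ⊢
      exact ⟨h, trivial⟩
    · rintro ⟨a, j⟩ h
      simp only [mem_filter] at h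
      simp [h.2]
    · intro j _
      rfl
  · rintro ⟨i, j⟩ h
    simp only [coe_filter, Set.mem_ofPred_eq, mem_cells_sdiff] at h
    simp only [coe_range, Set.mem_Iio]
    by_contra hi
    have := rowLen_eq_zero (hrho.trans (not_lt.1 hi))
    omega

theorem card_eq_sum_rowLen {k : ℕ} {rho : YoungDiagram} (hrho : rho.colLen 0 ≤ k) :
    rho.card = ∑ i ∈ range k, rho.rowLen i := by
  have h := card_cells_filter (lam := ⊥) hrho (fun _ => True)
  have h0 : ∀ i, (⊥ : YoungDiagram).rowLen i = 0 := by
    intro i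
    by_contra hne
    exact YoungDiagram.notMem_bot _ (YoungDiagram.mem_iff_lt_rowLen.2 (Nat.pos_of_ne_zero hne))
  simpa [h0] using h

/-- A filling of `ρ/λ` and a sequence of partitions from `λ` to `ρ` correspond to each other if the
`m`-th partition consists of `λ` and the cells with entries less than `m`. -/
structure Corresponds (k : ℕ) (lam rho : YoungDiagram) (e : ℕ → ℕ → ℕ) (G : ℕ → ℕ → ℤ) :
    Prop where
  start : G 0 = rows lam
  finish : G k = rows rho
  le_succ : ∀ m < k, ∀ i, G m i ≤ G (m + 1) i
  lt_iff : ∀ i j, (i, j) ∈ rho.cells \ lam.cells → ∀ m ≤ k, e i j < m ↔ (j : ℤ) < G m i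

namespace Corresponds

variable {k : ℕ} {lam rho : YoungDiagram} {e : ℕ → ℕ → ℕ} {G : ℕ → ℕ → ℤ}

theorem mono (H : Corresponds k lam rho e G) {m m' : ℕ} (h : m ≤ m') (hm' : m' ≤ k) (i : ℕ) :
    G m i ≤ G m' i := by
  induction m', h using Nat.le_induction with
  | base => rfl
  | succ m' _ ih => exact (ih (by omega)).trans (H.le_succ m' (by omega) i)

theorem rowLen_le (H : Corresponds k lam rho e G) {m : ℕ} (hm : m ≤ k) (i : ℕ) :
    (lam.rowLen i : ℤ) ≤ G m i := by
  have := H.mono (Nat.zero_le m) hm i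
  rwa [H.start] at this

theorem le_rowLen (H : Corresponds k lam rho e G) {m : ℕ} (hm : m ≤ k) (i : ℕ) :
    G m i ≤ rho.rowLen i := by
  have := H.mono hm le_rfl i
  rwa [H.finish] at this

theorem entry_lt (H : Corresponds k lam rho e G) {i j : ℕ}
    (h : (i, j) ∈ rho.cells \ lam.cells) : e i j < k := by
  rw [H.lt_iff i j h k le_rfl, H.finish]
  have := (mem_cells_sdiff.1 h).2
  simp only [rows]
  omega

theorem entry_eq_iff (H : Corresponds k lam rho e G) {i j : ℕ}
    (h : (i, j) ∈ rho.cells \ lam.cells) {m : ℕ} (hm : m < k) :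
    e i j = m ↔ G m i ≤ j ∧ (j : ℤ) < G (m + 1) i := by
  have h1 := H.lt_iff i j h m hm.le
  have h2 := H.lt_iff i j h (m + 1) hm
  rw [← h2, ← not_lt, ← h1]
  omega

theorem row_weak (H : Corresponds k lam rho e G) {i j₁ j₂ : ℕ} (hj : j₁ < j₂)
    (h1 : (i, j₁) ∈ rho.cells \ lam.cells) (h2 : (i, j₂) ∈ rho.cells \ lam.cells) :
    e i j₁ ≤ e i j₂ := by
  have h := H.entry_lt h2
  have h3 := (H.lt_iff i j₂ h2 (e i j₂ + 1) h).1 (Nat.lt_succ_self _)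
  have h4 := (H.lt_iff i j₁ h1 (e i j₂ + 1) h).2 (by omega)
  omega

theorem col_strict (H : Corresponds k lam rho e G)
    (hI : ∀ m < k, ∀ i, G (m + 1) (i + 1) ≤ G m i) {i₁ i₂ j : ℕ} (hi : i₁ < i₂)
    (h1 : (i₁, j) ∈ rho.cells \ lam.cells) (h2 : (i₂, j) ∈ rho.cells \ lam.cells) :
    e i₁ j < e i₂ j := by
  have step : ∀ i, (i, j) ∈ rho.cells \ lam.cells → (i + 1, j) ∈ rho.cells \ lam.cells →
      e i j < e (i + 1) j := by
    intro i h1 h2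
    have h := H.entry_lt h2
    have h3 := (H.lt_iff _ j h2 (e (i + 1) j + 1) h).1 (Nat.lt_succ_self _)
    have h4 := hI _ h i
    exact (H.lt_iff i j h1 _ h.le).2 (by omega)
  induction i₂, hi using Nat.le_induction with
  | base => exact step _ h1 h2
  | succ i₂ hi ih =>
    have h3 : (i₂, j) ∈ rho.cells \ lam.cells := by
      rw [mem_cells_sdiff] at h1 h2 ⊢
      have := lam.rowLen_anti i₁ i₂ (by omega)
      have := rho.rowLen_anti i₂ (i₂ + 1) (by omega)
      omega
    exact (ih h3).trans (step _ h3 h2)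

/-- If G_{m+1} in row i + 1 went beyond G_m in row i, then in column j = G_m(i) the lower cell would
have an entry at most m and the upper cell an entry at least m. -/
theorem interlace_of_col_strict (H : Corresponds k lam rho e G)
    (hc : ∀ i₁ i₂ j, i₁ < i₂ → (i₁, j) ∈ rho.cells \ lam.cells →
      (i₂, j) ∈ rho.cells \ lam.cells → e i₁ j < e i₂ j) (m : ℕ) (hm : m < k) (i : ℕ) :
    G (m + 1) (i + 1) ≤ G m i := by
  by_contra hlt
  have h0 := H.rowLen_le hm.le i
  obtain ⟨j, hj⟩ := Int.eq_ofNat_of_zero_le (show 0 ≤ G m i by omega)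
  have h1 := H.le_rowLen (m := m + 1) hm (i + 1)
  have h2 := lam.rowLen_anti i (i + 1) (by omega)
  have h3 := rho.rowLen_anti i (i + 1) (by omega)
  have c1 : (i, j) ∈ rho.cells \ lam.cells := mem_cells_sdiff.2 (by omega)
  have c2 : (i + 1, j) ∈ rho.cells \ lam.cells := mem_cells_sdiff.2 (by omega)
  have h4 := hc i (i + 1) j (by omega) c1 c2
  have h5 := (H.lt_iff _ j c2 (m + 1) hm).2 (by omega)
  have h6 := mt (H.lt_iff _ j c1 m hm.le).1 (by omega)
  omega

theorem card_row (H : Corresponds k lam rho e G) {m : ℕ} (hm : m < k) (i j₀ : ℕ) :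
    ((((Ico (lam.rowLen i) (rho.rowLen i)).filter fun j => j₀ ≤ j ∧ e i j = m).card : ℕ) : ℤ) =
      max 0 (G (m + 1) i - max (G m i) j₀) := by
  have h0 := H.rowLen_le hm.le i
  have h1 := H.le_rowLen (m := m + 1) hm i
  have h2 : (Ico (lam.rowLen i) (rho.rowLen i)).filter (fun j => j₀ ≤ j ∧ e i j = m) =
      Ico (max (G m i).toNat j₀) (G (m + 1) i).toNat := by
    ext j
    simp only [mem_filter, mem_Ico]
    constructor
    · rintro ⟨h3, h4, h5⟩
      rw [H.entry_eq_iff (mem_cells_sdiff.2 h3) hm] at h5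
      omega
    · intro h3
      have h4 : lam.rowLen i ≤ j ∧ j < rho.rowLen i := by omega
      refine ⟨h4, by omega, ?_⟩
      rw [H.entry_eq_iff (mem_cells_sdiff.2 h4) hm]
      omega
  rw [h2, Nat.card_Ico]
  omega

theorem card_row' (H : Corresponds k lam rho e G) {m : ℕ} (hm : m < k) (i : ℕ) :
    ((((Ico (lam.rowLen i) (rho.rowLen i)).filter fun j => e i j = m).card : ℕ) : ℤ) =
      G (m + 1) i - G m i := by
  have h := H.card_row hm i 0
  simp only [Nat.zero_le, true_and] at h
  rw [h]
  have := H.rowLen_le hm.le i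
  have := H.le_succ m hm i
  omega

theorem card_content (H : Corresponds k lam rho e G) (hrho : rho.colLen 0 ≤ k) {m : ℕ}
    (hm : m < k) : ((((rho.cells \ lam.cells).filter fun c => e c.1 c.2 = m).card : ℕ) : ℤ) =
      ∑ i ∈ range k, G (m + 1) i - ∑ i ∈ range k, G m i := by
  rw [card_cells_filter hrho, Nat.cast_sum, ← Finset.sum_sub_distrib]
  exact Finset.sum_congr rfl fun i _ => H.card_row' hm i

theorem card_content_of_le (H : Corresponds k lam rho e G) {m : ℕ} (hm : k ≤ m) :
    ((rho.cells \ lam.cells).filter fun c => e c.1 c.2 = m).card = 0 := by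
  rw [Finset.card_eq_zero, Finset.filter_eq_empty_iff]
  rintro ⟨i, j⟩ h
  have := H.entry_lt h
  simp only
  omega

theorem card_read (H : Corresponds k lam rho e G) (hrho : rho.colLen 0 ≤ k) {m : ℕ}
    (hm : m < k) {i j : ℕ} (hi : i < k) :
    ((((rho.cells \ lam.cells).filter fun c =>
      (c.1 < i ∨ (c.1 = i ∧ j ≤ c.2)) ∧ e c.1 c.2 = m).card : ℕ) : ℤ) =
      ∑ r ∈ range i, (G (m + 1) r - G m r) + max 0 (G (m + 1) i - max (G m i) j) := by
  rw [card_cells_filter hrho, Nat.cast_sum]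
  simp only
  obtain ⟨d, rfl⟩ : ∃ d, k = i + 1 + d := ⟨k - (i + 1), by omega⟩
  rw [Finset.sum_range_add, Finset.sum_range_succ]
  have e3 : ∑ x ∈ range d, ((((Ico (lam.rowLen (i + 1 + x)) (rho.rowLen (i + 1 + x))).filter
      fun j' => (i + 1 + x < i ∨ (i + 1 + x = i ∧ j ≤ j')) ∧ e (i + 1 + x) j' = m).card : ℕ) : ℤ) =
      0 := by
    apply Finset.sum_eq_zero
    intro x _
    rw [Nat.cast_eq_zero, Finset.card_eq_zero, Finset.filter_eq_empty_iff]
    intro j' _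
    omega
  rw [e3, add_zero]
  congr 1
  · refine Finset.sum_congr rfl fun r hr => ?_
    rw [mem_range] at hr
    rw [← H.card_row' hm r]
    congr 3
    ext j'
    simp [hr]
  · rw [← H.card_row hm i j]
    congr 3
    ext j'
    simp

/-- The sums count the entries m in the rows above i and the entries m + 1 in the rows up to i. This
is the failure of the reading-word condition at the moment when row i has delivered all its m + 1
and none of its m. -/
theorem latticeFails_iff {m i : ℕ} : G (m + 1) i < latticeBound (G m) (G (m + 1)) (G (m + 2)) i ↔
    ∑ r ∈ range i, (G (m + 1) r - G m r) < ∑ r ∈ range (i + 1), (G (m + 2) r - G (m + 1) r) := by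
  simp only [latticeBound, Finset.sum_sub_distrib, Finset.sum_range_succ]
  constructor <;> intro h <;> linarith

/-- Read from right to left, a row shows its entries m + 1 before its entries m, so the worst moment
in each row is the one tested by `IsLattice`. For m + 2 > k there are no entries m + 1. -/
theorem lattice_of_isLattice (H : Corresponds k lam rho e G) (hrho : rho.colLen 0 ≤ k)
    (hL : IsLattice k G) (i j : ℕ) (hc : (i, j) ∈ rho.cells \ lam.cells) (m : ℕ) :
    ((rho.cells \ lam.cells).filter fun c =>
        (c.1 < i ∨ (c.1 = i ∧ j ≤ c.2)) ∧ e c.1 c.2 = m + 1).card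
      ≤ ((rho.cells \ lam.cells).filter fun c =>
        (c.1 < i ∨ (c.1 = i ∧ j ≤ c.2)) ∧ e c.1 c.2 = m).card := by
  have hi : i < k := by
    by_contra hi
    have := rowLen_eq_zero (hrho.trans (not_lt.1 hi))
    have := (mem_cells_sdiff.1 hc).2
    omega
  by_cases hm : m + 2 ≤ k
  · rw [← Nat.cast_le (α := ℤ)]
    rw [H.card_read hrho (by omega) hi, H.card_read hrho (by omega) hi]
    have h := hL m i
    have h1 : ¬ _ := fun hlt => h ⟨⟨hm, hi⟩, latticeFails_iff.2 hlt⟩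
    rw [Finset.sum_range_succ] at h1
    have h2 := H.le_succ (m + 1) (by omega) i
    rw [show m + 1 + 1 = m + 2 from rfl] at h2 ⊢
    omega
  · have : ((rho.cells \ lam.cells).filter fun c =>
        (c.1 < i ∨ (c.1 = i ∧ j ≤ c.2)) ∧ e c.1 c.2 = m + 1).card = 0 := by
      rw [Finset.card_eq_zero, Finset.filter_eq_empty_iff]
      rintro ⟨i', j'⟩ h
      have := H.entry_lt h
      simp only
      omega
    omega

theorem isLattice_of_lattice (H : Corresponds k lam rho e G) (hrho : rho.colLen 0 ≤ k)
    (hl : ∀ i j, (i, j) ∈ rho.cells \ lam.cells → ∀ m,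
      ((rho.cells \ lam.cells).filter fun c =>
        (c.1 < i ∨ (c.1 = i ∧ j ≤ c.2)) ∧ e c.1 c.2 = m + 1).card
      ≤ ((rho.cells \ lam.cells).filter fun c =>
        (c.1 < i ∨ (c.1 = i ∧ j ≤ c.2)) ∧ e c.1 c.2 = m).card) : IsLattice k G := by
  rintro m i ⟨⟨hm, hi⟩, hf⟩
  rw [latticeFails_iff] at hf
  revert hf
  rw [imp_false, not_lt]
  induction i with
  | zero =>
    rw [Finset.sum_range_one, Finset.sum_range_zero]
    by_contra hlt
    have h0 := H.rowLen_le (m := m + 1) (by omega) 0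
    have h1 := H.le_rowLen (m := m + 2) (by omega) 0
    obtain ⟨j, hj⟩ := Int.eq_ofNat_of_zero_le (show 0 ≤ G (m + 1) 0 by omega)
    have h := Nat.cast_le (α := ℤ).2 (hl 0 j (mem_cells_sdiff.2 (by omega)) m)
    rw [H.card_read hrho (by omega) hi, H.card_read hrho (by omega) hi] at h
    rw [show m + 1 + 1 = m + 2 from rfl] at h
    simp only [Finset.sum_range_zero] at h
    omega
  | succ i ih =>
    have ih := ih (by omega)
    -- A row without entries m + 1 inherits the inequality from the row above. Otherwise the column
    -- G_{m+1}(i+1) holds the leftmost m + 1 of the row, and the condition at that cell is the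
    -- required one.
    by_cases hlt : G (m + 2) (i + 1) ≤ G (m + 1) (i + 1)
    · rw [Finset.sum_range_succ]
      rw [Finset.sum_range_succ (fun r => G (m + 1) r - G m r)]
      have := H.le_succ m (by omega) i
      omega
    · have h0 := H.rowLen_le (m := m + 1) (by omega) (i + 1)
      have h1 := H.le_rowLen (m := m + 2) (by omega) (i + 1)
      obtain ⟨j, hj⟩ := Int.eq_ofNat_of_zero_le (show 0 ≤ G (m + 1) (i + 1) by omega)
      have h := Nat.cast_le (α := ℤ).2 (hl (i + 1) j (mem_cells_sdiff.2 (by omega)) m)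
      rw [H.card_read hrho (by omega) hi, H.card_read hrho (by omega) hi] at h
      rw [show m + 1 + 1 = m + 2 from rfl] at h
      rw [Finset.sum_range_succ]
      omega

theorem entry_unique (H : Corresponds k lam rho e G) {e' : ℕ → ℕ → ℕ}
    (H' : Corresponds k lam rho e' G) {i j : ℕ} (h : (i, j) ∈ rho.cells \ lam.cells) :
    e i j = e' i j := by
  have h1 := H.entry_lt h
  have h2 := H'.entry_lt h
  have h3 := (H'.lt_iff i j h (e i j + 1) h1).2
    ((H.lt_iff i j h (e i j + 1) h1).1 (Nat.lt_succ_self _))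
  have h4 := (H.lt_iff i j h (e' i j + 1) h2).2
    ((H'.lt_iff i j h (e' i j + 1) h2).1 (Nat.lt_succ_self _))
  omega

theorem chain_unique (H : Corresponds k lam rho e G) {G' : ℕ → ℕ → ℤ}
    (H' : Corresponds k lam rho e G') {m : ℕ} (hm : m ≤ k) : G m = G' m := by
  have key : ∀ {G G' : ℕ → ℕ → ℤ}, Corresponds k lam rho e G → Corresponds k lam rho e G' →
      ∀ i, G m i ≤ G' m i := by
    intro G G' H H' i
    by_contra hlt
    have h0 := H'.rowLen_le hm i
    have h1 := H.le_rowLen hm i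
    obtain ⟨j, hj⟩ := Int.eq_ofNat_of_zero_le (show 0 ≤ G' m i by omega)
    have hc : (i, j) ∈ rho.cells \ lam.cells := mem_cells_sdiff.2 (by omega)
    have h2 := (H'.lt_iff i j hc m hm).1 ((H.lt_iff i j hc m hm).2 (by omega))
    omega
  funext i
  exact le_antisymm (key H H' i) (key H' H i)

end Corresponds

section Bijection

variable {k : ℕ} {lam mu rho : YoungDiagram}

/-- The sequence of partitions given by a filling. -/
def fillingChain (k : ℕ) (lam rho : YoungDiagram) (e : ℕ → ℕ → ℕ) (m i : ℕ) : ℤ :=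
  if m ≤ k then
    lam.rowLen i + ((Ico (lam.rowLen i) (rho.rowLen i)).filter fun j => e i j < m).card
  else 0

/-- The filling given by a sequence of partitions. -/
def chainFilling (k : ℕ) (lam rho : YoungDiagram) (G : ℕ → ℕ → ℤ) (i j : ℕ) : ℕ :=
  -- The entry of a cell is the number of members among G_1, …, G_k that do not reach it.
  if (i, j) ∈ rho.cells \ lam.cells then ((range k).filter fun m => G (m + 1) i ≤ j).card else 0

theorem corresponds_fillingChain (hle : lam ≤ rho) (hmu : mu.colLen 0 ≤ k)
    (T : LRTableau lam mu rho) :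
    Corresponds k lam rho T.entry (fillingChain k lam rho T.entry) := by
  have hlt : ∀ i j, (i, j) ∈ rho.cells \ lam.cells → T.entry i j < k := by
    intro i j h
    by_contra hk
    have h1 := T.content (T.entry i j)
    rw [rowLen_eq_zero (hmu.trans (not_lt.1 hk)), Finset.card_eq_zero,
      Finset.filter_eq_empty_iff] at h1
    exact h1 h rfl
  refine ⟨?_, ?_, ?_, ?_⟩
  · funext i
    simp [fillingChain, rows]
  · funext i
    have h1 : lam.rowLen i ≤ rho.rowLen i := by
      by_contra h
      have := YoungDiagram.mem_iff_lt_rowLen.1 (hle (YoungDiagram.mem_iff_lt_rowLen.2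
        (not_le.1 h)))
      omega
    have h2 : (Ico (lam.rowLen i) (rho.rowLen i)).filter (fun j => T.entry i j < k) =
        Ico (lam.rowLen i) (rho.rowLen i) :=
      Finset.filter_true_of_mem fun j hj => hlt i j (mem_cells_sdiff.2 (mem_Ico.1 hj))
    rw [fillingChain, if_pos le_rfl, h2, Nat.card_Ico, rows]
    omega
  · intro m hm i
    rw [fillingChain, fillingChain, if_pos hm.le, if_pos (show m + 1 ≤ k from hm)]
    have : ((Ico (lam.rowLen i) (rho.rowLen i)).filter fun j => T.entry i j < m).card ≤
        ((Ico (lam.rowLen i) (rho.rowLen i)).filter fun j => T.entry i j < m + 1).card :=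
      Finset.card_le_card fun j hj => by
        rw [mem_filter] at hj ⊢
        exact ⟨hj.1, hj.2.trans (Nat.lt_succ_self m)⟩
    omega
  · intro i j hc m hm
    rw [fillingChain, if_pos hm]
    have hc' := mem_cells_sdiff.1 hc
    constructor
    · intro h
      have : Ico (lam.rowLen i) (j + 1) ⊆
          (Ico (lam.rowLen i) (rho.rowLen i)).filter fun j => T.entry i j < m := by
        intro j' hj'
        rw [mem_Ico] at hj'
        have h1 : lam.rowLen i ≤ j' ∧ j' < rho.rowLen i := by omega
        refine mem_filter.2 ⟨mem_Ico.2 h1, ?_⟩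
        rcases Nat.lt_succ_iff_lt_or_eq.1 hj'.2 with h2 | rfl
        · exact (T.row_weak i j' j h2 (mem_cells_sdiff.2 h1) hc).trans_lt h
        · exact h
      have := Finset.card_le_card this
      rw [Nat.card_Ico] at this
      omega
    · intro h
      by_contra hge
      have : (Ico (lam.rowLen i) (rho.rowLen i)).filter (fun j => T.entry i j < m) ⊆
          Ico (lam.rowLen i) j := by
        intro j' hj'
        rw [mem_filter, mem_Ico] at hj'
        refine mem_Ico.2 ⟨hj'.1.1, ?_⟩
        by_contra h2
        rcases Nat.lt_or_eq_of_le (not_lt.1 h2) with h3 | rfl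
        · have := T.row_weak i j j' h3 hc (mem_cells_sdiff.2 hj'.1)
          omega
        · omega
      have := Finset.card_le_card this
      rw [Nat.card_Ico] at this
      omega

theorem corresponds_chainFilling {c : ℕ → ℤ} {G : ℕ → ℕ → ℤ}
    (hG : IsHorizontalChain k (rows lam) c k G) (hGk : G k = rows rho) :
    Corresponds k lam rho (chainFilling k lam rho G) G := by
  refine ⟨hG.start, hGk, fun m hm i => (hG.interlace m hm i).1, ?_⟩
  intro i j hc m hm
  rw [chainFilling, if_pos hc]
  constructor
  · intro h
    by_contra hlt
    have : range m ⊆ (range k).filter fun m => G (m + 1) i ≤ j := by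
      intro m' hm'
      rw [mem_range] at hm'
      refine mem_filter.2 ⟨mem_range.2 (by omega), ?_⟩
      have := hG.mono (show m' + 1 ≤ m by omega) hm i
      omega
    have := Finset.card_le_card this
    rw [card_range] at this
    omega
  · intro h
    have hm0 : m ≠ 0 := by
      rintro rfl
      rw [hG.start] at h
      have := (mem_cells_sdiff.1 hc).1
      simp only [rows] at h
      omega
    have : ((range k).filter fun m => G (m + 1) i ≤ j) ⊆ range (m - 1) := by
      intro m' hm'
      rw [mem_filter, mem_range] at hm'
      rw [mem_range]
      by_contra hge
      have := hG.mono (show m ≤ m' + 1 by omega) (by omega) i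
      omega
    have := Finset.card_le_card this
    rw [card_range] at this
    omega

theorem isHorizontalChain_fillingChain (hle : lam ≤ rho) (hmu : mu.colLen 0 ≤ k)
    (hrho : rho.colLen 0 ≤ k) (T : LRTableau lam mu rho) :
    IsHorizontalChain k (rows lam) (rows mu) k (fillingChain k lam rho T.entry) := by
  have H := corresponds_fillingChain hle hmu T
  refine ⟨H.start, ?_, ?_, ?_, ?_⟩
  · intro m hm i
    exact ⟨H.le_succ m hm i, H.interlace_of_col_strict T.col_strict m hm i⟩
  · intro m hm i hi
    have h1 := H.le_rowLen hm i
    have h2 := H.rowLen_le hm i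
    rw [rowLen_eq_zero (hrho.trans hi)] at h1
    omega
  · intro m hm
    have h1 := H.card_content hrho hm
    rw [T.content m] at h1
    simp only [rows]
    omega
  · intro m hm
    funext i
    rw [fillingChain, if_neg (by omega)]
    rfl

theorem LRTableau.ext_entry {T T' : LRTableau lam mu rho} (h : T.entry = T'.entry) : T = T' := by
  cases T
  cases T'
  cases h
  rfl

/-- The Littlewood-Richardson tableau given by a lattice chain. -/
def chainTableau (hmu : mu.colLen 0 ≤ k) (hrho : rho.colLen 0 ≤ k) {G : ℕ → ℕ → ℤ}
    (hG : IsHorizontalChain k (rows lam) (rows mu) k G) (hL : IsLattice k G)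
    (hGk : G k = rows rho) : LRTableau lam mu rho where
  entry := chainFilling k lam rho G
  le := by
    rintro ⟨i, j⟩ h
    have H := corresponds_chainFilling hG hGk
    have h1 := YoungDiagram.mem_iff_lt_rowLen.1 h
    refine YoungDiagram.mem_iff_lt_rowLen.2 (h1.trans_le ?_)
    have h2 := H.rowLen_le le_rfl i
    have h3 := H.le_rowLen le_rfl i
    omega
  zeros := fun i j h => if_neg h
  row_weak := fun i j₁ j₂ hj h1 h2 => (corresponds_chainFilling hG hGk).row_weak hj h1 h2
  col_strict := fun i₁ i₂ j hi h1 h2 => (corresponds_chainFilling hG hGk).col_strict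
    (fun m hm i => (hG.interlace m hm i).2) hi h1 h2
  content := by
    intro m
    have H := corresponds_chainFilling hG hGk
    by_cases hm : m < k
    · have h1 := H.card_content hrho hm
      have h2 := hG.sum_eq m hm
      simp only [rows] at h2
      omega
    · rw [H.card_content_of_le (not_lt.1 hm), rowLen_eq_zero (hmu.trans (not_lt.1 hm))]
  lattice := (corresponds_chainFilling hG hGk).lattice_of_isLattice hrho hL

/-- Littlewood-Richardson tableaux correspond to lattice chains. -/
def tableauEquiv (hmu : mu.colLen 0 ≤ k) (hrho : rho.colLen 0 ≤ k) :
    LRTableau lam mu rho ≃ {G : ℕ → ℕ → ℤ // (IsHorizontalChain k (rows lam) (rows mu) k G ∧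
      IsLattice k G) ∧ G k = rows rho} where
  toFun T := ⟨fillingChain k lam rho T.entry,
    ⟨isHorizontalChain_fillingChain T.le hmu hrho T,
      (corresponds_fillingChain T.le hmu T).isLattice_of_lattice hrho T.lattice⟩,
    (corresponds_fillingChain T.le hmu T).finish⟩
  invFun G := chainTableau hmu hrho G.2.1.1 G.2.1.2 G.2.2
  left_inv T := by
    apply LRTableau.ext_entry
    show chainFilling k lam rho (fillingChain k lam rho T.entry) = T.entry
    funext i j
    by_cases hc : (i, j) ∈ rho.cells \ lam.cells
    · exact (corresponds_chainFilling (isHorizontalChain_fillingChain T.le hmu hrho T)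
        (corresponds_fillingChain T.le hmu T).finish).entry_unique
        (corresponds_fillingChain T.le hmu T) hc
    · rw [T.zeros i j hc]
      exact if_neg hc
  right_inv G := by
    apply Subtype.ext
    funext m
    by_cases hm : m ≤ k
    · exact Corresponds.chain_unique (corresponds_fillingChain
        (chainTableau hmu hrho G.2.1.1 G.2.1.2 G.2.2).le hmu
        (chainTableau hmu hrho G.2.1.1 G.2.1.2 G.2.2))
        (corresponds_chainFilling G.2.1.1 G.2.2) hm
    · rw [G.2.1.1.eq_zero m (by omega)]
      funext i
      exact if_neg hm

open Classical in
theorem lrCoeff_eq_card (hlam : lam.colLen 0 ≤ k) (hmu : mu.colLen 0 ≤ k)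
    (hrho : rho.colLen 0 ≤ k) : lrCoeff lam mu rho =
      (((chains k (rows lam) (rows mu) k).filter (IsLattice k)).filter
        fun G => G k = rows rho).card := by
  rw [lrCoeff, Nat.card_congr (tableauEquiv hmu hrho)]
  refine Nat.subtype_card _ fun G => ?_
  rw [mem_filter, mem_filter, mem_chains (isPartition_rows hlam)]

end Bijection

theorem exists_youngDiagram {k : ℕ} {y : ℕ → ℤ} (hy : IsPartition k y) :
    ∃ lam : YoungDiagram, rows lam = y ∧ lam.colLen 0 ≤ k := by
  have hanti : Antitone y := antitone_nat_of_succ_le hy.anti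
  let s : Finset (ℕ × ℕ) := (range k ×ˢ range (y 0).toNat).filter fun p => (p.2 : ℤ) < y p.1
  have hs : ∀ i j, (i, j) ∈ s ↔ (j : ℤ) < y i := by
    intro i j
    simp only [s, mem_filter, mem_product, mem_range, and_iff_right_iff_imp]
    intro h
    have h0 := hanti (Nat.zero_le i)
    refine ⟨?_, by omega⟩
    by_contra hi
    have := hy.support i (not_lt.1 hi)
    omega
  let lam : YoungDiagram := ⟨s, by
    rintro ⟨i, j⟩ ⟨i', j'⟩ ⟨h1, h2⟩ h
    rw [Finset.mem_coe, hs] at h ⊢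
    simp only at h1 h2
    have := hanti h1
    omega⟩
  have hrow : ∀ i, (lam.rowLen i : ℤ) = y i := by
    intro i
    have h0 := hy.nonneg i
    have h1 : ∀ j : ℕ, j < lam.rowLen i ↔ (j : ℤ) < y i := by
      intro j
      rw [← YoungDiagram.mem_iff_lt_rowLen, ← YoungDiagram.mem_cells]
      exact hs i j
    have h2 := h1 (y i).toNat
    have h3 := h1 (lam.rowLen i)
    omega
  refine ⟨lam, funext hrow, ?_⟩
  by_contra hlt
  have h1 := YoungDiagram.mem_iff_lt_rowLen.1 (YoungDiagram.mem_iff_lt_colLen.2 (not_le.1 hlt))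
  have h2 := hrow k
  rw [hy.support k le_rfl] at h2
  omega

/-! ### Products of Schur polynomials. -/

section Product

variable (R : Type*) [CommRing R] {k : ℕ}

theorem coe_schur_parts (lam : YoungDiagram) :
    ((schur R (parts k lam) : MvPolynomial.symmetricSubalgebra (Fin k) R) :
      MvPolynomial (Fin k) R) = schurSeq k (complete MvPolynomial.X) (rows lam) := by
  rw [schur_eq_jacobiTrudi, coe_jacobiTrudi_hSym, schurSeq]
  congr 1
  funext i
  simp only [exponents, parts, staircase, rows]
  omega

/-- Lattice chains are grouped by their endpoints. All members of a chain have at most `k` parts, so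
longer partitions never arise. -/
theorem schur_mul_schur {lam mu : YoungDiagram} (hlam : lam.colLen 0 ≤ k) (hmu : mu.colLen 0 ≤ k)
    (S : Finset YoungDiagram) (hS : ∀ rho, rho ∈ S ↔ rho.card = lam.card + mu.card ∧
      rho.colLen 0 ≤ k) :
    schur R (parts k lam) * schur R (parts k mu) =
      ∑ rho ∈ S, lrCoeff lam mu rho • schur R (parts k rho) := by
  classical
  apply Subtype.ext
  simp only [AddSubmonoidClass.coe_finsetSum, MulMemClass.coe_mul]
  have e : ∀ rho ∈ S, ((lrCoeff lam mu rho • schur R (parts k rho) :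
      MvPolynomial.symmetricSubalgebra (Fin k) R) : MvPolynomial (Fin k) R) =
      lrCoeff lam mu rho • schurSeq k (complete MvPolynomial.X) (rows rho) := by
    intro rho _
    rw [← coe_schur_parts]
    rfl
  rw [Finset.sum_congr rfl e, coe_schur_parts, coe_schur_parts, mul_comm,
    schurSeq_mul_eq_sum_chains (fun y hy c => complete_mul_schurSeq MvPolynomial.X hy c)
      (isPartition_rows hlam) (isPartition_rows hmu)]
  have hc : (fun j => if j < k then rows mu j else 0) = rows mu := by
    funext j
    split_ifs with hj
    · rfl
    · exact ((isPartition_rows hmu).support j (not_lt.1 hj)).symm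
  rw [hc]
  have hmaps : ∀ G ∈ (chains k (rows lam) (rows mu) k).filter (IsLattice k),
      G k ∈ S.image rows := by
    intro G hG
    rw [mem_filter, mem_chains (isPartition_rows hlam)] at hG
    obtain ⟨rho, h1, h2⟩ := exists_youngDiagram (hG.1.isPartition (isPartition_rows hlam) le_rfl)
    refine mem_image.2 ⟨rho, (hS rho).2 ⟨?_, h2⟩, h1⟩
    have h3 := hG.1.sum_last le_rfl
    rw [← h1] at h3
    rw [card_eq_sum_rowLen h2, card_eq_sum_rowLen hlam, card_eq_sum_rowLen hmu]
    simp only [rows] at h3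
    exact_mod_cast h3
  rw [← Finset.sum_fiberwise_of_maps_to hmaps, Finset.sum_image rows_injective.injOn]
  refine Finset.sum_congr rfl fun rho hrho => ?_
  rw [lrCoeff_eq_card hlam hmu ((hS rho).1 hrho).2, ← Finset.sum_const]
  refine Finset.sum_congr rfl fun G hG => ?_
  rw [(mem_filter.1 hG).2]

theorem card_transpose (lam : YoungDiagram) : lam.transpose.card = lam.card := by
  unfold YoungDiagram.card YoungDiagram.transpose
  simp

theorem mem_remaining {k N : ℕ} {rho : YoungDiagram} :
    rho ∈ remaining k N ↔ rho.card = N ∧ rho.transpose.colLen 0 ≤ k := by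
  simp [remaining]

theorem schur_mul_schur_transpose {n : ℕ} (lam mu : Weight n k) :
    schur R (parts k lam.1.transpose) * schur R (parts k mu.1.transpose) =
      ∑ rho ∈ remaining k (lam.1.card + mu.1.card),
        lrCoeff lam.1.transpose mu.1.transpose rho.transpose •
          schur R (parts k rho.transpose) := by
  have hinj : Function.Injective YoungDiagram.transpose := fun a b h =>
    YoungDiagram.transpose_eq_iff.1 h
  rw [schur_mul_schur R (by rw [YoungDiagram.colLen_transpose]; exact lam.2.2)
    (by rw [YoungDiagram.colLen_transpose]; exact mu.2.2)
    ((remaining k (lam.1.card + mu.1.card)).map ⟨_, hinj⟩), Finset.sum_map]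
  · rfl
  · intro rho
    simp only [mem_map, mem_remaining, Function.Embedding.coeFn_mk, card_transpose]
    constructor
    · rintro ⟨a, ⟨h1, h2⟩, rfl⟩
      exact ⟨by rw [card_transpose, h1], h2⟩
    · rintro ⟨h1, h2⟩
      exact ⟨rho.transpose, ⟨by rw [card_transpose, h1], by simpa using h2⟩, by simp⟩

end Product
-- The boundary of a Young diagram as a permutation.
theorem cell_iff {lam : YoungDiagram} {i j : ℕ} : j < lam.rowLen i ↔ i < lam.colLen j := by
  rw [← YoungDiagram.mem_iff_lt_rowLen, YoungDiagram.mem_iff_lt_colLen]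

theorem rowLen_bot (i : ℕ) : (⊥ : YoungDiagram).rowLen i = 0 := by
  by_contra hne
  exact YoungDiagram.notMem_bot _ (YoungDiagram.mem_iff_lt_rowLen.2 (Nat.pos_of_ne_zero hne))

theorem colLen_bot (j : ℕ) : (⊥ : YoungDiagram).colLen j = 0 := by
  by_contra hne
  exact YoungDiagram.notMem_bot _ (YoungDiagram.mem_iff_lt_colLen.2 (Nat.pos_of_ne_zero hne))

/-- The Young diagram fits into a box with `n` rows and `k` columns. -/
def InBox (n k : ℕ) (lam : YoungDiagram) : Prop := lam.colLen 0 ≤ n ∧ lam.rowLen 0 ≤ k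

theorem inBox_bot (n k : ℕ) : InBox n k ⊥ := by
  simp [InBox, rowLen_bot, colLen_bot]

theorem Weight.inBox {n k : ℕ} (lam : Weight n k) : InBox n k lam.1 :=
  ⟨lam.2.1.trans (Nat.sub_le n 1), lam.2.2⟩

/-- The positions of the vertical and of the horizontal steps of the boundary of a Young diagram in
a box. -/
def boundaryStep (n : ℕ) (lam : YoungDiagram) (i : ℕ) : ℕ :=
  if i < n then lam.rowLen i + (n - 1 - i) else i - lam.colLen (i - n)

section Boundary

variable {n k : ℕ} {lam : YoungDiagram}

theorem InBox.rowLen_le (h : InBox n k lam) (i : ℕ) : lam.rowLen i ≤ k :=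
  (lam.rowLen_anti 0 i (Nat.zero_le i)).trans h.2

theorem InBox.colLen_le (h : InBox n k lam) (j : ℕ) : lam.colLen j ≤ n :=
  (lam.colLen_anti 0 j (Nat.zero_le j)).trans h.1

theorem boundaryStep_lt (h : InBox n k lam) {i : ℕ} (hi : i < n + k) :
    boundaryStep n lam i < n + k := by
  unfold boundaryStep
  have := h.rowLen_le i
  split_ifs <;> omega

/-- Two vertical steps are always inverted and two horizontal ones never. A vertical step i and a
horizontal step j - n are inverted exactly when the cell (i, j - n) belongs to the diagram. -/
theorem boundaryStep_lt_iff (h : InBox n k lam) {i j : ℕ} (hij : i < j) :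
    boundaryStep n lam i < boundaryStep n lam j ↔ n ≤ j ∧ (i < n → lam.colLen (j - n) ≤ i) := by
  unfold boundaryStep
  by_cases hj : j < n
  · rw [if_pos hj, if_pos (hij.trans hj)]
    have := lam.rowLen_anti i j hij.le
    omega
  · rw [if_neg hj]
    have h1 := h.colLen_le (j - n)
    by_cases hi : i < n
    · rw [if_pos hi]
      have h2 := @cell_iff lam i (j - n)
      omega
    · rw [if_neg hi]
      have h2 := lam.colLen_anti (i - n) (j - n) (by omega)
      have h3 := h.colLen_le (i - n)
      omega

theorem boundaryStep_injOn (h : InBox n k lam) : Function.Injective (boundaryStep n lam) := by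
  have key : ∀ i j, i < j → boundaryStep n lam i ≠ boundaryStep n lam j := by
    intro i j hij
    unfold boundaryStep
    by_cases hj : j < n
    · rw [if_pos hj, if_pos (hij.trans hj)]
      have := lam.rowLen_anti i j hij.le
      omega
    · rw [if_neg hj]
      have h1 := h.colLen_le (j - n)
      by_cases hi : i < n
      · rw [if_pos hi]
        have h2 := @cell_iff lam i (j - n)
        omega
      · rw [if_neg hi]
        have h2 := lam.colLen_anti (i - n) (j - n) (by omega)
        have h3 := h.colLen_le (i - n)
        omega
  intro i j hij
  rcases lt_trichotomy i j with h1 | h1 | h1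
  · exact absurd hij (key i j h1)
  · exact h1
  · exact absurd hij.symm (key j i h1)

/-- The permutation of the positions given by the boundary of a Young diagram. -/
noncomputable def boundaryPerm (h : InBox n k lam) : Equiv.Perm (Fin (n + k)) :=
  Equiv.ofBijective (fun i => ⟨boundaryStep n lam i, boundaryStep_lt h i.2⟩)
    (Finite.injective_iff_bijective.1 fun _ _ hij => Fin.ext
      (boundaryStep_injOn h (Fin.mk.inj_iff.1 hij)))

theorem coe_boundaryPerm (h : InBox n k lam) (i : Fin (n + k)) :
    (boundaryPerm h i : ℕ) = boundaryStep n lam i := rfl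

/-- Compared with the empty diagram, the additional inversions are the cells of `lam`. -/
theorem sign_boundaryPerm (h : InBox n k lam) :
    (Equiv.Perm.sign (boundaryPerm h) : ℤ) =
      Equiv.Perm.sign (boundaryPerm (inBox_bot n k)) * ∏ j : Fin k, (-1) ^ lam.colLen j := by
  have e1 : ∀ (mu : YoungDiagram) (hmu : InBox n k mu),
      (Equiv.Perm.sign (boundaryPerm hmu) : ℤ) = ∏ j : Fin (n + k), ∏ i ∈ Iio j,
        if n ≤ (j : ℕ) ∧ ((i : ℕ) < n → mu.colLen (j - n) ≤ i) then 1 else -1 := by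
    intro mu hmu
    rw [Equiv.Perm.sign_eq_prod_prod_Iio]
    push_cast
    refine Finset.prod_congr rfl fun j _ => Finset.prod_congr rfl fun i hi => ?_
    rw [mem_Iio] at hi
    have := boundaryStep_lt_iff hmu (show (i : ℕ) < j from hi)
    rw [← coe_boundaryPerm hmu, ← coe_boundaryPerm hmu, ← Fin.lt_def] at this
    simp only [← this]
    split_ifs <;> rfl
  have e2 : ∏ j : Fin k, (-1 : ℤ) ^ lam.colLen j = ∏ j : Fin (n + k), ∏ i ∈ Iio j,
      if n ≤ (j : ℕ) ∧ (i : ℕ) < lam.colLen (j - n) then -1 else 1 := by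
    rw [Fin.prod_univ_add]
    have a1 : ∏ j : Fin n, ∏ i ∈ Iio (Fin.castAdd k j),
        (if n ≤ (Fin.castAdd k j : ℕ) ∧ (i : ℕ) < lam.colLen ((Fin.castAdd k j : ℕ) - n)
          then (-1 : ℤ) else 1) = 1 := by
      refine Finset.prod_eq_one fun j _ => Finset.prod_eq_one fun i _ => if_neg ?_
      simp
    rw [a1, one_mul]
    refine Finset.prod_congr rfl fun j _ => ?_
    have a2 : ∀ i ∈ Iio (Fin.natAdd n j), (if n ≤ (Fin.natAdd n j : ℕ) ∧
        (i : ℕ) < lam.colLen ((Fin.natAdd n j : ℕ) - n) then (-1 : ℤ) else 1) =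
        if (i : ℕ) < lam.colLen j then -1 else 1 := by
      intro i _
      simp
    rw [Finset.prod_congr rfl a2, Finset.prod_ite, Finset.prod_const, Finset.prod_const_one, mul_one]
    congr 1
    have hc := h.colLen_le j
    have a3 : (univ : Finset (Fin (lam.colLen j))).card =
        ((Iio (Fin.natAdd n j)).filter fun i : Fin (n + k) => (i : ℕ) < lam.colLen j).card := by
      refine Finset.card_bij (fun i _ => ⟨i, by omega⟩) ?_ ?_ ?_
      · intro i _
        simp [Fin.lt_def]
        omega
      · intro i _ i' _ hi
        simpa [Fin.ext_iff] using hi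
      · intro i hi
        simp only [mem_filter] at hi
        exact ⟨⟨i, hi.2⟩, mem_univ _, rfl⟩
    rw [← a3, card_univ, Fintype.card_fin]
  rw [e1 lam h, e1 ⊥ (inBox_bot n k), e2, ← Finset.prod_mul_distrib]
  refine Finset.prod_congr rfl fun j _ => ?_
  rw [← Finset.prod_mul_distrib]
  refine Finset.prod_congr rfl fun i hi => ?_
  have hc := h.colLen_le (j - n)
  simp only [colLen_bot, Nat.zero_le, implies_true, and_true]
  split_ifs <;> first | rfl | omega

end Boundary

/-! ### Complementary minors. -/

section Complement

variable {n k : ℕ}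

/-- Replacing the first block column of M' by that of the identity and multiplying by M gives a
block triangular matrix with diagonal blocks M₁₁ and 1. -/
theorem det_toBlocks₁₁_eq {A : Type*} [CommRing A]
    {M M' : Matrix (Fin n ⊕ Fin k) (Fin n ⊕ Fin k) A} (h : M * M' = 1) :
    M.toBlocks₁₁.det = M.det * M'.toBlocks₂₂.det := by
  have h1 : M * Matrix.fromBlocks 1 M'.toBlocks₁₂ 0 M'.toBlocks₂₂ =
      Matrix.fromBlocks M.toBlocks₁₁ 0 M.toBlocks₂₁ 1 := by
    have h2 := h
    rw [← Matrix.fromBlocks_toBlocks M, ← Matrix.fromBlocks_toBlocks M',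
      Matrix.fromBlocks_multiply, ← Matrix.fromBlocks_one, Matrix.fromBlocks_inj] at h2
    conv_lhs => rw [← Matrix.fromBlocks_toBlocks M]
    rw [Matrix.fromBlocks_multiply, h2.2.1, h2.2.2.2]
    simp
  have h3 := congrArg Matrix.det h1
  rw [Matrix.det_mul, Matrix.det_fromBlocks_zero₂₁, Matrix.det_fromBlocks_zero₁₂] at h3
  simpa using h3.symm

/-- The values of `u` at the vertical steps of the boundary. -/
def verticalValues (n : ℕ) (u : ℕ → ℂ) (sig : YoungDiagram) (i : Fin n) : ℂ :=
  u (boundaryStep n sig i)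

/-- Minus the values of `u` at the horizontal steps of the boundary. -/
def horizontalValues (n k : ℕ) (u : ℕ → ℂ) (sig : YoungDiagram) (j : Fin k) : ℂ :=
  -u (boundaryStep n sig (n + j))

/-- Jacobi's theorem on complementary minors, for the matrix `(u_r ^ c)`. -/
theorem exists_alternant_eq (u : ℕ → ℂ) (hu : ∀ r, u r ≠ 0)
    (hort : ∀ r s : Fin (n + k), ∑ c : Fin (n + k), u r ^ (c : ℕ) * ((u s)⁻¹) ^ (c : ℕ) =
      if r = s then ((n + k : ℕ) : ℂ) else 0) {sig : YoungDiagram} (hsig : InBox n k sig) :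
    ∃ D : ℂ, ∀ lam : YoungDiagram, InBox n k lam →
      alternant (verticalValues n u sig) (exponents (parts n lam)) =
        D * alternant (horizontalValues n k u sig) (exponents (parts k lam.transpose)) := by
  set W : Matrix (Fin (n + k)) (Fin (n + k)) ℂ := Matrix.of fun r c => u r ^ (c : ℕ)
  set W' : Matrix (Fin (n + k)) (Fin (n + k)) ℂ :=
    Matrix.of fun c r => ((u r)⁻¹) ^ (c : ℕ) * ((n + k : ℕ) : ℂ)⁻¹
  have hWW' : W * W' = 1 := by
    ext r s
    simp only [W, W', Matrix.mul_apply, Matrix.of_apply, ← mul_assoc]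
    rw [← Finset.sum_mul, hort, Matrix.one_apply]
    split_ifs
    · have : ((n + k : ℕ) : ℂ) ≠ 0 := by
        have := r.pos
        exact_mod_cast this.ne'
      exact mul_inv_cancel₀ this
    · simp
  -- The inverse matrix has negative powers. Since n+k-1 = (n + j - λᵗ_j) + (λᵗ_j + k-1-j), pulling
  -- out (u⁻¹)^(n+k-1) leaves the positive exponents of λᵗ; `v` collects what does not depend on λ.
  set v : Fin k → ℂ := fun j =>
    ((u (boundaryStep n sig (n + j)))⁻¹) ^ (n + k - 1) * ((n + k : ℕ) : ℂ)⁻¹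
  set M₀ := W.submatrix (fun p => boundaryPerm hsig (finSumFinEquiv p)) finSumFinEquiv
  -- The witness collects all factors independent of λ: the minor comparison in the standard order
  -- of columns, the sign for the empty diagram, the signs of the staircase and the row factors.
  refine ⟨M₀.det * (Equiv.Perm.sign (boundaryPerm (inBox_bot n k)) : ℤ) *
    ((∏ j : Fin k, (-1) ^ (staircase k j)) * ∏ j, v j), fun lam hlam => ?_⟩
  set M := W.submatrix (fun p => boundaryPerm hsig (finSumFinEquiv p))
    (fun p => boundaryPerm hlam (finSumFinEquiv p)) with hM
  set M' := W'.submatrix (fun p => boundaryPerm hlam (finSumFinEquiv p))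
    (fun p => boundaryPerm hsig (finSumFinEquiv p))
  have hMM' : M * M' = 1 := by
    have : M * M' = (W * W').submatrix (fun p => boundaryPerm hsig (finSumFinEquiv p))
        (fun p => boundaryPerm hsig (finSumFinEquiv p)) :=
      Matrix.submatrix_mul_equiv W W' _ (finSumFinEquiv.trans (boundaryPerm hlam)) _
    rw [this, hWW']
    exact Matrix.submatrix_one_equiv (finSumFinEquiv.trans (boundaryPerm hsig))
  have hdet := det_toBlocks₁₁_eq hMM'
  have h1 : M.toBlocks₁₁.det = alternant (verticalValues n u sig) (exponents (parts n lam)) := by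
    rw [alternant, ← Matrix.det_transpose]
    congr 1
    ext i j
    have e1 : boundaryStep n lam i = lam.rowLen i + (n - 1 - i) := if_pos i.2
    simp [Matrix.toBlocks₁₁, M, W, coe_boundaryPerm, verticalValues, e1, exponents, parts,
      staircase]
  have h2 : M.det = (Equiv.Perm.sign (boundaryPerm hlam) : ℤ) * M₀.det := by
    have : M = M₀.submatrix id (finSumFinEquiv.trans
        ((boundaryPerm hlam).trans finSumFinEquiv.symm)) := by
      ext p q
      simp [M, M₀]
    rw [this, Matrix.det_permute']
    congr 3
    have := Equiv.Perm.sign_symm_trans_trans (boundaryPerm hlam)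
      (finSumFinEquiv (m := n) (n := k)).symm
    rw [← this]
    rfl
  have h3 : M'.toBlocks₂₂.det = (∏ j : Fin k, (-1) ^ lam.colLen j) *
      ((∏ j : Fin k, (-1) ^ (staircase k j)) * ∏ j, v j) *
      alternant (horizontalValues n k u sig) (exponents (parts k lam.transpose)) := by
    have e : M'.toBlocks₂₂ = Matrix.of fun j j' : Fin k => v j' *
        (Matrix.of fun j j' : Fin k => ((-1) ^ lam.colLen j * (-1) ^ (staircase k j)) *
          (Matrix.of fun j j' : Fin k => horizontalValues n k u sig j' ^
            exponents (parts k lam.transpose) j) j j') j j' := by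
      ext j j'
      have e1 : boundaryStep n lam (n + j) = n + j - lam.colLen j := by
        rw [boundaryStep, if_neg (by omega)]
        congr 2
        omega
      have hc := hlam.colLen_le j
      have hj := j.2
      have e2 : exponents (parts k lam.transpose) j = lam.colLen j + staircase k j := by
        simp [exponents, parts]
      simp only [Matrix.toBlocks₂₂, M', W', Matrix.submatrix_apply, Matrix.of_apply,
        finSumFinEquiv_apply_right, coe_boundaryPerm, Fin.val_natAdd, e1, v, horizontalValues, e2]
      set z := u (boundaryStep n sig (n + j'))
      have hz : z ≠ 0 := hu _
      have e3 : n + k - 1 = (n + j - lam.colLen j) + (lam.colLen j + staircase k j) := by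
        simp only [staircase]
        omega
      rw [e3, ← pow_add, neg_pow z, pow_add z⁻¹, inv_pow z (lam.colLen j + staircase k j)]
      have e4 : ((-1 : ℂ) ^ (lam.colLen j + staircase k j)) *
        (-1) ^ (lam.colLen j + staircase k j) = 1 := by rw [← mul_pow]; simp
      field_simp
      linear_combination (-(((n + k : ℕ) : ℂ)⁻¹)) * e4
    have e5 : ∏ j : Fin k, ((-1 : ℂ) ^ lam.colLen j * (-1) ^ staircase k j) =
        (∏ j : Fin k, (-1) ^ lam.colLen j) * ∏ j : Fin k, (-1) ^ staircase k j :=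
      Finset.prod_mul_distrib
    rw [e, Matrix.det_mul_row, Matrix.det_mul_column, e5]
    unfold alternant
    ring
  rw [h1, h2, h3] at hdet
  rw [hdet]
  have h4 := congrArg (Int.cast : ℤ → ℂ) (sign_boundaryPerm hlam)
  push_cast at h4
  rw [h4]
  -- The sign (-1)^|λ| occurs twice, once from the boundary permutation and once from the minus sign
  -- in `horizontalValues`; that minus sign is there to make them cancel.
  have h5 : (∏ j : Fin k, (-1 : ℂ) ^ lam.colLen j) * (∏ j : Fin k, (-1) ^ lam.colLen j) = 1 := by
    rw [← Finset.prod_mul_distrib]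
    refine Finset.prod_eq_one fun j _ => ?_
    rw [← mul_pow]
    simp
  linear_combination (M₀.det * (Equiv.Perm.sign (boundaryPerm (inBox_bot n k)) : ℤ) *
    ((∏ j : Fin k, (-1) ^ (staircase k j)) * ∏ j, v j) *
      alternant (horizontalValues n k u sig) (exponents (parts k lam.transpose))) * h5

end Complement
-- Evaluation of symmetric polynomials at points.
section General

variable {A : Type*} [CommRing A] {k : ℕ}

theorem alternant_succ (x : Fin k → A) (p : Fin k → ℕ) :
    alternant x (fun i => p i + 1) = (∏ i, x i) * alternant x p := by
  unfold alternant
  rw [← Matrix.det_mul_row]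
  congr 1
  ext i l
  simp [pow_succ, mul_comm]

/-- The exponents of a partition with a single row. -/
def rowExponents (k m : ℕ) (i : Fin k) : ℕ := (if (i : ℕ) = 0 then m else 0) + staircase k i

theorem jacobiTrudi_rowExponents (x : Fin k → A) (hk : 0 < k) (m : ℕ) :
    jacobiTrudi (complete x) (fun i => (rowExponents k m i : ℤ)) = complete x m := by
  obtain ⟨K, rfl⟩ : ∃ K, k = K + 1 := ⟨k - 1, by omega⟩
  unfold jacobiTrudi
  rw [Matrix.det_of_isUpperTriangular]
  · rw [Fin.prod_univ_succ]
    have e1 : ∀ i : Fin K, (Matrix.of fun i j : Fin (K + 1) => complete x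
        ((rowExponents (K + 1) m i : ℤ) - (((K + 1 : ℕ) : ℤ) - 1) + (j : ℤ))) i.succ i.succ = 1 := by
      intro i
      rw [Matrix.of_apply, ← complete_zero x]
      congr 1
      simp [rowExponents, staircase]
    rw [Finset.prod_congr rfl fun i _ => e1 i, Finset.prod_const_one, mul_one, Matrix.of_apply]
    congr 1
    simp [rowExponents, staircase]
  · intro i j hij
    rw [Matrix.of_apply]
    apply complete_of_neg
    have hij : j < i := hij
    simp only [rowExponents, staircase]
    rw [Fin.lt_def] at hij
    rw [if_neg (by omega)]
    omega

/-- Evaluation of symmetric polynomials. -/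
noncomputable def evalSym (x : Fin k → A) : MvPolynomial.symmetricSubalgebra (Fin k) A →+* A :=
  (MvPolynomial.eval x).comp (MvPolynomial.symmetricSubalgebra (Fin k) A).val.toRingHom

theorem evalSym_hSym (x : Fin k → A) (m : ℤ) : evalSym x (hSym A k m) = complete x m := by
  have : evalSym x (hSym A k m) = MvPolynomial.eval x (complete MvPolynomial.X m) := by
    rw [← coe_hSym]
    rfl
  rw [this, map_complete]
  simp

theorem evalSym_schur (x : Fin k → A) (α : Fin k → ℕ) :
    evalSym x (schur A α) = jacobiTrudi (complete x) (fun i => (exponents α i : ℤ)) := by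
  rw [schur_eq_jacobiTrudi, map_jacobiTrudi]
  simp only [evalSym_hSym]

theorem alternant_exponents (x : Fin k → A) (α : Fin k → ℕ) :
    alternant x (exponents α) = alternant x (staircase k) * evalSym x (schur A α) := by
  rw [evalSym_schur]
  exact alternant_eq x _

theorem evalSym_betheIdeal {n : ℕ} {x : Fin k → A} (h0 : complete x n = 1)
    (h1 : ∀ j : ℕ, 1 ≤ j → j ≤ k - 1 → complete x ((n : ℤ) + (j : ℤ)) = 0)
    {f : MvPolynomial.symmetricSubalgebra (Fin k) A} (hf : f ∈ betheIdeal n k (1 : A)) :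
    evalSym x f = 0 := by
  have : betheIdeal n k (1 : A) ≤ RingHom.ker (evalSym x) := by
    unfold betheIdeal
    rw [Ideal.span_le]
    rintro g (hg | ⟨j, hj1, hj2, rfl⟩)
    · rw [Set.mem_singleton_iff] at hg
      rw [hg, SetLike.mem_coe, RingHom.mem_ker, map_sub, evalSym_hSym, h0]
      simp
    · rw [SetLike.mem_coe, RingHom.mem_ker, evalSym_hSym, h1 j hj1 hj2]
  exact this hf

end General

/-! ### The modular S-matrix at the Bethe points. -/

section SMatrix

/-- The numbers `exp (-2πi (r - |σ+ρ| / n) / (k + n))`. -/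
noncomputable def phase (n k : ℕ) (sig : YoungDiagram) (r : ℕ) : ℂ :=
  Complex.exp (-(2 * (Real.pi : ℂ) * Complex.I) / ((k : ℂ) + (n : ℂ)) *
    ((r : ℂ) - (∑ i : Fin n, (boundaryStep n sig i : ℂ)) / (n : ℂ)))

/-- The primitive root of unity `exp (-2πi / (k + n))`. -/
noncomputable def phaseRoot (n k : ℕ) : ℂ :=
  Complex.exp (-(2 * (Real.pi : ℂ) * Complex.I) / ((k : ℂ) + (n : ℂ)))

variable {n k : ℕ} {sig lam : YoungDiagram}

theorem phase_ne_zero (r : ℕ) : phase n k sig r ≠ 0 := Complex.exp_ne_zero _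

theorem phase_eq (r : ℕ) : phase n k sig r = phaseRoot n k ^ r * phase n k sig 0 := by
  unfold phase phaseRoot
  rw [← Complex.exp_nat_mul, ← Complex.exp_add]
  congr 1
  push_cast
  ring

theorem isPrimitiveRoot_phaseRoot (hn : 0 < n) : IsPrimitiveRoot (phaseRoot n k) (n + k) := by
  have h := (Complex.isPrimitiveRoot_exp (n + k) (by omega)).inv
  convert! h using 1
  rw [phaseRoot, ← Complex.exp_neg]
  congr 1
  push_cast
  ring

theorem phase_pow (hn : 0 < n) (r : ℕ) :
    phase n k sig r ^ (n + k) = phase n k sig 0 ^ (n + k) := by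
  rw [phase_eq r, mul_pow, ← pow_mul, mul_comm r, pow_mul,
    (isPrimitiveRoot_phaseRoot hn).pow_eq_one, one_pow, one_mul]

theorem phase_inj (hn : 0 < n) {r s : ℕ} (hr : r < n + k) (hs : s < n + k)
    (h : phase n k sig r = phase n k sig s) : r = s := by
  rw [phase_eq r, phase_eq s] at h
  exact (isPrimitiveRoot_phaseRoot hn).pow_inj hr hs (mul_right_cancel₀ (phase_ne_zero 0) h)

theorem sum_phase (hn : 0 < n) (r s : Fin (n + k)) :
    ∑ c : Fin (n + k), phase n k sig r ^ (c : ℕ) * ((phase n k sig s)⁻¹) ^ (c : ℕ) =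
      if r = s then ((n + k : ℕ) : ℂ) else 0 := by
  simp only [← mul_pow]
  rw [Fin.sum_univ_eq_sum_range (fun c => (phase n k sig r * (phase n k sig s)⁻¹) ^ c)]
  split_ifs with h
  · rw [h, mul_inv_cancel₀ (phase_ne_zero _)]
    simp
  · rw [geom_sum_eq]
    · rw [mul_pow, inv_pow, phase_pow hn r, phase_pow hn s,
        mul_inv_cancel₀ (pow_ne_zero _ (phase_ne_zero _))]
      simp
    · intro h1
      refine h (Fin.ext (phase_inj (sig := sig) hn r.2 s.2 ?_))
      rwa [mul_inv_eq_one₀ (phase_ne_zero _)] at h1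

/-- The `n` variables at which the characters of `su(n)` are evaluated. -/
noncomputable def charPoint (n k : ℕ) (sig : YoungDiagram) : Fin n → ℂ :=
  verticalValues n (phase n k sig) sig

/-- The solution of the Bethe ansatz equations labelled by `sig`. -/
noncomputable def bethePoint (n k : ℕ) (sig : YoungDiagram) : Fin k → ℂ :=
  horizontalValues n k (phase n k sig) sig

theorem charPoint_injective (hn : 0 < n) (h : InBox n k sig) :
    Function.Injective (charPoint n k sig) := by
  intro i j hij
  have := phase_inj hn (boundaryStep_lt h (show (i : ℕ) < n + k by omega))
    (boundaryStep_lt h (show (j : ℕ) < n + k by omega)) hij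
  exact Fin.ext (boundaryStep_injOn h this)

theorem bethePoint_injective (hn : 0 < n) (h : InBox n k sig) :
    Function.Injective (bethePoint n k sig) := by
  intro i j hij
  have := phase_inj hn (boundaryStep_lt h (show n + (i : ℕ) < n + k by omega))
    (boundaryStep_lt h (show n + (j : ℕ) < n + k by omega)) (neg_injective hij)
  have := boundaryStep_injOn h this
  exact Fin.ext (by omega)

theorem prod_charPoint (hn : 0 < n) : ∏ i, charPoint n k sig i = 1 := by
  unfold charPoint verticalValues phase
  rw [← Complex.exp_sum, ← Finset.mul_sum, Finset.sum_sub_distrib]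
  have : (n : ℂ) ≠ 0 := by exact_mod_cast hn.ne'
  simp only [sum_const, card_univ, Fintype.card_fin, nsmul_eq_mul]
  rw [mul_div_cancel₀ _ this]
  simp

/-- The unknown constant of `exists_alternant_eq` is eliminated by comparison with the empty
diagram. -/
theorem alternant_charPoint (hn : 0 < n) (hsig : InBox n k sig) (hlam : InBox n k lam) :
    alternant (charPoint n k sig) (exponents (parts n lam)) =
      alternant (charPoint n k sig) (staircase n) *
        evalSym (bethePoint n k sig) (schur ℂ (parts k lam.transpose)) := by
  obtain ⟨D, hD⟩ := exists_alternant_eq (phase n k sig) phase_ne_zero (sum_phase hn) hsig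
  have h0 := hD ⊥ (inBox_bot n k)
  have e1 : exponents (parts n ⊥) = staircase n := by
    funext i
    simp [exponents, parts, rowLen_bot]
  have e2 : exponents (parts k (⊥ : YoungDiagram).transpose) = staircase k := by
    funext i
    simp [exponents, parts, colLen_bot]
  rw [e1, e2] at h0
  have h1 := hD lam hlam
  rw [alternant_exponents (horizontalValues n k (phase n k sig) sig), ← mul_assoc, ← h0] at h1
  exact h1

theorem rows_column (n : ℕ) (hn : 0 < n) : ∃ lam : YoungDiagram, (∀ k, 0 < k → InBox n k lam) ∧
    (∀ i : Fin n, lam.rowLen i = 1) ∧ ∀ j, lam.colLen j = if j = 0 then n else 0 := by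
  obtain ⟨lam, h1, h2⟩ := exists_youngDiagram (k := n) (y := fun i => if i < n then 1 else 0)
    ⟨fun i => by split_ifs <;> omega, fun i => by split_ifs <;> omega,
      fun i hi => if_neg (by omega)⟩
  have h3 : ∀ i, lam.rowLen i = if i < n then 1 else 0 := by
    intro i
    have := congrFun h1 i
    simp only [rows] at this
    split_ifs at this ⊢ <;> omega
  have h4 : ∀ i j, i < lam.colLen j ↔ i < n ∧ j = 0 := by
    intro i j
    rw [← cell_iff, h3]
    split_ifs <;> omega
  refine ⟨lam, fun k hk => ⟨h2, by rw [h3, if_pos hn]; omega⟩, fun i => by rw [h3, if_pos i.2], ?_⟩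
  intro j
  have h5 := h4 (lam.colLen j) j
  have h6 := h4 n j
  have h7 := h4 (n - 1) j
  have h8 := h4 0 j
  split_ifs <;> omega

/-- For the column of height `n` the character is the product of the variables, which is 1, while
the transposed row gives h_n. This column does not belong to `P`, which is why the duality is stated
for all diagrams in the box. -/
theorem complete_bethePoint (hn : 0 < n) (hk : 0 < k) (hsig : InBox n k sig) :
    complete (bethePoint n k sig) n = 1 := by
  obtain ⟨lam, h1, h2, h3⟩ := rows_column n hn
  have h4 := alternant_charPoint hn hsig (h1 k hk)
  have e1 : exponents (parts n lam) = fun i => staircase n i + 1 := by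
    funext i
    rw [exponents, parts, h2, add_comm]
  have e2 : (fun i => (exponents (parts k lam.transpose) i : ℤ)) =
      fun i => (rowExponents k n i : ℤ) := by
    funext i
    simp [exponents, parts, h3, rowExponents]
  rw [e1, alternant_succ, prod_charPoint hn, one_mul, evalSym_schur, e2,
    jacobiTrudi_rowExponents _ hk] at h4
  exact (mul_left_cancel₀ (alternant_staircase_ne_zero _ (charPoint_injective hn hsig))
    ((mul_one _).trans h4)).symm

/-- All Bethe coordinates have the same (n+k)-th power c. In the alternant of the row (n + j) the
top exponent is (n+k) + (j-1), and j - 1 is the staircase exponent of row k - j, so these two rows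
are proportional with factor c. -/
theorem complete_bethePoint_eq_zero (hn : 0 < n) (hsig : InBox n k sig) (j : ℕ) (hj : 1 ≤ j)
    (hj' : j ≤ k - 1) : complete (bethePoint n k sig) ((n : ℤ) + (j : ℤ)) = 0 := by
  have hk : 0 < k := by omega
  have h1 := jacobiTrudi_rowExponents (bethePoint n k sig) hk (n + j)
  rw [Nat.cast_add] at h1
  rw [← h1]
  apply (mul_eq_zero.1 ((alternant_eq (bethePoint n k sig) (rowExponents k (n + j))).symm.trans ?_)
    ).resolve_left (alternant_staircase_ne_zero _ (bethePoint_injective hn hsig))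
  set c := (-phase n k sig 0) ^ (n + k)
  have hpow : ∀ l, bethePoint n k sig l ^ (n + k) = c := by
    intro l
    simp only [bethePoint, horizontalValues, c]
    rw [neg_pow, phase_pow hn, ← neg_pow]
  set i₀ : Fin k := ⟨0, hk⟩
  set i₁ : Fin k := ⟨k - j, by omega⟩
  have hne : i₀ ≠ i₁ := by
    simp only [i₀, i₁, ne_eq, Fin.mk.injEq]
    omega
  set M : Matrix (Fin k) (Fin k) ℂ :=
    Matrix.of fun i l => bethePoint n k sig l ^ rowExponents k (n + j) i
  have hM : M i₀ = c • M i₁ := by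
    funext l
    simp only [M, Matrix.of_apply, Pi.smul_apply, smul_eq_mul, rowExponents, i₀, i₁, staircase]
    rw [← hpow l, ← pow_add]
    congr 1
    simp only [if_true]
    rw [if_neg (by omega)]
    omega
  show M.det = 0
  have h2 : M = M.updateRow i₀ (c • M i₁) := by
    rw [← hM, Matrix.updateRow_eq_self]
  rw [h2, Matrix.det_updateRow_smul, Matrix.det_zero_of_row_eq hne, mul_zero]
  rw [Matrix.updateRow_self, Matrix.updateRow_ne hne.symm]

theorem evalSym_bethePoint_of_mem (hn : 0 < n) (hk : 0 < k) (hsig : InBox n k sig)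
    {f : MvPolynomial.symmetricSubalgebra (Fin k) ℂ} (hf : f ∈ betheIdeal n k (1 : ℂ)) :
    evalSym (bethePoint n k sig) f = 0 :=
  evalSym_betheIdeal (complete_bethePoint hn hk hsig)
    (complete_bethePoint_eq_zero hn hsig) hf

/-- The normalization of the modular S-matrix. -/
noncomputable def normalization (n k : ℕ) : ℂ :=
  Complex.exp (Complex.I * (Real.pi : ℂ) * ((n : ℂ) * ((n : ℂ) - 1)) / 4)
      / ((Real.sqrt ((n : ℝ) * ((k : ℝ) + (n : ℝ)) ^ (n - 1)) : ℝ) : ℂ)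

theorem normalization_ne_zero (hn : 0 < n) : normalization n k ≠ 0 := by
  refine div_ne_zero (Complex.exp_ne_zero _) ?_
  have : (0 : ℝ) < n := by exact_mod_cast hn
  have : 0 < Real.sqrt ((n : ℝ) * ((k : ℝ) + (n : ℝ)) ^ (n - 1)) := by positivity
  exact_mod_cast this.ne'

theorem shifted_eq (lam : YoungDiagram) (i : Fin n) : shifted n lam i = boundaryStep n lam i := by
  rw [shifted, boundaryStep, if_pos i.2]
  omega

/-- The correction term of `weightInner` is the subtraction of the mean built into `phase`; after
this the sum over permutations is the Leibniz expansion of an alternant. -/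
theorem modularS_apply (lam sig : Weight n k) : modularS n k lam sig =
    normalization n k * alternant (charPoint n k sig.1) (exponents (parts n lam.1)) := by
  rw [modularS, Matrix.of_apply, normalization, alternant, Matrix.det_apply']
  congr 1
  refine Finset.sum_congr rfl fun w _ => ?_
  congr 1
  have e : ∀ i : Fin n, exponents (parts n lam.1) i = boundaryStep n lam.1 i := by
    intro i
    rw [boundaryStep, if_pos i.2]
    rfl
  simp only [Matrix.of_apply, charPoint, verticalValues, phase, e]
  have e2 : ∀ (z : ℂ) (m : ℕ), Complex.exp z ^ m = Complex.exp (m * z) := fun z m =>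
    (Complex.exp_nat_mul z m).symm
  simp only [e2]
  rw [← Complex.exp_sum]
  congr 1
  simp only [weightInner, shifted_eq]
  push_cast
  rw [mul_sub, Finset.mul_sum, mul_comm (∑ i : Fin n, (boundaryStep n sig.1 i : ℂ)), mul_div_assoc,
    Finset.sum_mul, Finset.mul_sum, ← Finset.sum_sub_distrib]
  refine Finset.sum_congr rfl fun i _ => ?_
  ring

theorem modularS_empty (sig : Weight n k) : modularS n k (Weight.empty n k) sig =
    normalization n k * alternant (charPoint n k sig.1) (staircase n) := by
  rw [modularS_apply]
  congr 2
  funext i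
  simp [exponents, parts, Weight.empty, rowLen_bot]

theorem modularS_empty_ne_zero (hn : 0 < n) (sig : Weight n k) :
    modularS n k (Weight.empty n k) sig ≠ 0 := by
  rw [modularS_empty]
  exact mul_ne_zero (normalization_ne_zero hn)
    (alternant_staircase_ne_zero _ (charPoint_injective hn sig.inBox))

theorem modularS_eq (hn : 0 < n) (lam sig : Weight n k) : modularS n k lam sig =
    modularS n k (Weight.empty n k) sig *
      evalSym (bethePoint n k sig.1) (schur ℂ (parts k lam.1.transpose)) := by
  rw [modularS_empty, modularS_apply, alternant_charPoint hn sig.inBox lam.inBox, mul_assoc]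

theorem weightInner_comm {n : ℕ} (a b : Fin n → ℤ) : weightInner a b = weightInner b a := by
  unfold weightInner
  rw [mul_comm (∑ i, (a i : ℝ))]
  simp only [mul_comm]

theorem weightInner_comp {n : ℕ} (a b : Fin n → ℤ) (w : Equiv.Perm (Fin n)) :
    weightInner (fun i => a (w i)) (fun i => b (w i)) = weightInner a b := by
  unfold weightInner
  rw [Equiv.sum_comp w (fun i => (a i : ℝ) * (b i : ℝ)), Equiv.sum_comp w (fun i => (a i : ℝ)),
    Equiv.sum_comp w (fun i => (b i : ℝ))]

theorem modularS_symm (lam sig : Weight n k) : modularS n k lam sig = modularS n k sig lam := by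
  simp only [modularS, Matrix.of_apply]
  congr 1
  refine Finset.sum_equiv (Equiv.inv _) (by simp) fun w _ => ?_
  rw [Equiv.inv_apply, Equiv.Perm.sign_inv, ← weightInner_comp (shifted n lam.1) _ w,
    weightInner_comm]
  simp

end SMatrix
-- The complete symmetric functions separate the Bethe points.
section Separation

/-- The h_m determine the polynomial ∏ (1 - x_i t), whose roots are the inverses of the coordinates.
-/
theorem exists_eq_of_complete_eq {k : ℕ} {x x' : Fin k → ℂ} (hx : ∀ i, x i ≠ 0)
    (h : ∀ m : ℕ, complete x m = complete x' m) (i : Fin k) : ∃ j, x i = x' j := by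
  have h1 : elementarySeries univ x = elementarySeries univ x' := by
    have e1 := mk_complete_mul_elementarySeries x
    have e2 := mk_complete_mul_elementarySeries x'
    simp only [← h] at e2
    calc elementarySeries univ x = elementarySeries univ x *
          (PowerSeries.mk (fun n => complete x (n : ℕ)) * elementarySeries univ x') := by
            rw [e2, mul_one]
      _ = PowerSeries.mk (fun n => complete x (n : ℕ)) * elementarySeries univ x *
            elementarySeries univ x' := by ring
      _ = _ := by rw [e1, one_mul]
  have h2 : ∀ z : Fin k → ℂ, elementarySeries univ z =
      ((∏ j, (1 - Polynomial.C (z j) * Polynomial.X) : Polynomial ℂ) : PowerSeries ℂ) := by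
    intro z
    rw [elementarySeries, ← Polynomial.coeToPowerSeries.ringHom_apply, map_prod]
    simp
  rw [h2, h2, Polynomial.coe_inj] at h1
  have h3 := congrArg (Polynomial.eval (x i)⁻¹) h1
  rw [Polynomial.eval_prod, Polynomial.eval_prod, Finset.prod_eq_zero (mem_univ i)] at h3
  · obtain ⟨j, -, hj⟩ := Finset.prod_eq_zero_iff.1 h3.symm
    refine ⟨j, ?_⟩
    simp only [Polynomial.eval_sub, Polynomial.eval_one, Polynomial.eval_mul, Polynomial.eval_C,
      Polynomial.eval_X, sub_eq_zero] at hj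
    exact ((eq_mul_inv_iff_mul_eq₀ (hx i)).1 hj ▸ (one_mul (x i)).symm)
  · simp [hx i]

variable {n k : ℕ}

theorem phase_eq_phase_iff (hn : 0 < n) {sig tau : YoungDiagram} {r s : ℕ} :
    phase n k sig r = phase n k tau s ↔ ∃ t : ℤ, (n : ℤ) * ((r : ℤ) - s + (n + k) * t) =
      ∑ i : Fin n, (boundaryStep n sig i : ℤ) - ∑ i : Fin n, (boundaryStep n tau i : ℤ) := by
  have hpi : (2 * (Real.pi : ℂ) * Complex.I) ≠ 0 := Complex.two_pi_I_ne_zero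
  have hN : (k : ℂ) + (n : ℂ) ≠ 0 := by
    have : 0 < k + n := by omega
    exact_mod_cast this.ne'
  have hn' : (n : ℂ) ≠ 0 := by exact_mod_cast hn.ne'
  rw [phase, phase, Complex.exp_eq_exp_iff_exists_int]
  refine exists_congr fun t => ?_
  rw [← @Int.cast_inj ℂ]
  push_cast
  set a := ∑ i : Fin n, (boundaryStep n sig i : ℂ)
  set b := ∑ i : Fin n, (boundaryStep n tau i : ℂ)
  constructor
  · intro h
    field_simp at h
    linear_combination -h
  · intro h
    field_simp
    linear_combination -h

/-- With `d` the difference of the means, equality of phases means r ≡ s + d modulo n + k. So the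
horizontal positions of `tau`, shifted by `d`, are among those of `sig`, and the complements can be
compared as integers. -/
theorem eq_of_bethePoint_aux (hn : 0 < n) (hk : 0 < k) {sig tau : Weight n k} {d : ℤ}
    (hd : 0 ≤ d) (hnd : (n : ℤ) * d =
      ∑ i : Fin n, (boundaryStep n sig.1 i : ℤ) - ∑ i : Fin n, (boundaryStep n tau.1 i : ℤ))
    (h : ∀ j : Fin k, ∃ j', bethePoint n k tau.1 j = bethePoint n k sig.1 j') : sig = tau := by
  have hN : (0 : ℤ) < n + k := by omega
  have hcong : ∀ r s : ℕ, phase n k sig.1 r = phase n k tau.1 s ↔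
      ∃ t : ℤ, (r : ℤ) = d + s + (n + k) * t := by
    intro r s
    rw [phase_eq_phase_iff hn, ← hnd]
    constructor
    · rintro ⟨t, ht⟩
      have := mul_left_cancel₀ (show (n : ℤ) ≠ 0 by omega) ht
      exact ⟨-t, by linear_combination this⟩
    · rintro ⟨t, ht⟩
      exact ⟨-t, by rw [ht]; ring⟩
  -- The position congruent to a vertical step of `sig` minus `d` is a step of `tau`. Were it
  -- horizontal, its shift would be a horizontal step of `sig` at the place of a vertical one.
  have key : ∀ i : Fin n, ∃ (q : Fin n) (t : ℤ),
      (boundaryStep n sig.1 i : ℤ) = d + boundaryStep n tau.1 q + (n + k) * t := by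
    intro i
    set a : ℤ := ((boundaryStep n sig.1 i : ℕ) : ℤ)
    have h1 := Int.emod_nonneg (a - d) hN.ne'
    have h2 := Int.emod_lt_of_pos (a - d) hN
    obtain ⟨r, hr⟩ := Int.eq_ofNat_of_zero_le h1
    have hdiv := Int.emod_add_mul_ediv (a - d) (n + k)
    obtain ⟨q, hq⟩ := (boundaryPerm tau.inBox).surjective (⟨r, by omega⟩ : Fin (n + k))
    have hq' : boundaryStep n tau.1 q = r := congrArg Fin.val hq
    by_cases hqn : (q : ℕ) < n
    · refine ⟨⟨q, hqn⟩, (a - d) / (n + k), ?_⟩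
      simp only [hq']
      rw [hr] at hdiv
      linear_combination -hdiv
    · exfalso
      obtain ⟨j', hj'⟩ := h ⟨q - n, by omega⟩
      have h3 := neg_injective hj'
      simp only at h3
      rw [show n + ((q : ℕ) - n) = q by omega, hq'] at h3
      obtain ⟨t, ht⟩ := (hcong _ _).1 h3.symm
      have h4 : phase n k sig.1 (boundaryStep n sig.1 i) = phase n k tau.1 r := by
        rw [hcong]
        refine ⟨(a - d) / (n + k), ?_⟩
        rw [hr] at hdiv
        linear_combination -hdiv
      have h5 := phase_inj hn (boundaryStep_lt sig.inBox (show (i : ℕ) < n + k by omega))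
        (boundaryStep_lt sig.inBox (show n + (j' : ℕ) < n + k by omega)) (h4.trans h3)
      have := boundaryStep_injOn sig.inBox h5
      omega
  choose q t ht using key
  have hlt : ∀ i : Fin n, (boundaryStep n sig.1 i : ℤ) < n + k := fun i => by
    have := boundaryStep_lt sig.inBox (show (i : ℕ) < n + k by omega)
    omega
  -- The sign of `d` enters here: all terms on the right are nonnegative and the left side is below
  -- n + k. Summing over i, where `hnd` fixes the total, then gives ∑ t = 0, so every t vanishes.
  have htneg : ∀ i, t i ≤ 0 := by
    intro i
    by_contra hpos
    have h1 := ht i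
    have h2 := hlt i
    nlinarith [show (0 : ℤ) ≤ boundaryStep n tau.1 (q i) by omega]
  have hqinj : Function.Injective q := by
    intro i i' hii
    have h1 := ht i
    have h2 := ht i'
    rw [hii] at h1
    have h3 : phase n k sig.1 (boundaryStep n sig.1 i) =
        phase n k sig.1 (boundaryStep n sig.1 i') :=
      ((hcong _ _).2 ⟨_, h1⟩).trans ((hcong _ _).2 ⟨_, h2⟩).symm
    have h4 := phase_inj hn (boundaryStep_lt sig.inBox (show (i : ℕ) < n + k by omega))
      (boundaryStep_lt sig.inBox (show (i' : ℕ) < n + k by omega)) h3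
    exact Fin.ext (boundaryStep_injOn sig.inBox h4)
  have hqbij := Finite.injective_iff_bijective.1 hqinj
  have hsum : ∑ i, t i = 0 := by
    have h1 : ∑ i : Fin n, (boundaryStep n sig.1 i : ℤ) =
        n * d + ∑ i : Fin n, (boundaryStep n tau.1 i : ℤ) + (n + k) * ∑ i, t i := by
      rw [Finset.sum_congr rfl fun i _ => ht i, Finset.sum_add_distrib, Finset.sum_add_distrib,
        ← Finset.mul_sum, hqbij.sum_comp (fun i : Fin n => (boundaryStep n tau.1 i : ℤ))]
      simp
    have h2 : ((n : ℤ) + k) * ∑ i, t i = 0 := by linarith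
    exact (mul_eq_zero.1 h2).resolve_left hN.ne'
  have ht0 : ∀ i, t i = 0 := fun i =>
    (Finset.sum_eq_zero_iff_of_nonpos fun i _ => htneg i).1 hsum i (mem_univ i)
  have hrow : ∀ (mu : Weight n k) (i : ℕ), n - 1 ≤ i → mu.1.rowLen i = 0 := fun mu i hi =>
    rowLen_eq_zero (mu.2.1.trans hi)
  -- A diagram in `P` has an empty n-th row, so its last vertical step is at position 0.
  have hd0 : d = 0 := by
    have h1 := ht ⟨n - 1, by omega⟩
    rw [ht0] at h1
    have h2 : boundaryStep n sig.1 (n - 1) = 0 := by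
      rw [boundaryStep, if_pos (by omega), hrow sig _ le_rfl]
      omega
    simp only [h2] at h1
    omega
  have hstep : ∀ i : Fin n, boundaryStep n sig.1 i = boundaryStep n tau.1 (q i) := by
    intro i
    have h1 := ht i
    rw [ht0, hd0] at h1
    omega
  have hdecr : ∀ (mu : Weight n k) {i j : Fin n}, i < j →
      boundaryStep n mu.1 j < boundaryStep n mu.1 i := by
    intro mu i j hij
    have h1 := boundaryStep_lt_iff mu.inBox (show (i : ℕ) < j from hij)
    have h2 := boundaryStep_injOn mu.inBox (a₁ := i) (a₂ := j)
    have h3 : (i : ℕ) < j := hij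
    omega
  have hmono : StrictMono q := by
    intro i j hij
    have h1 := hdecr sig hij
    rw [hstep, hstep] at h1
    rcases lt_trichotomy (q i) (q j) with h2 | h2 | h2
    · exact h2
    · rw [h2] at h1; omega
    · have := hdecr tau h2; omega
  have hqid : q = id := (StrictMono.range_inj hmono strictMono_id).1
    (by simp [hqbij.surjective.range_eq])
  apply Subtype.ext
  apply rows_injective
  funext i
  by_cases hi : i < n
  · have h1 := hstep ⟨i, hi⟩
    rw [hqid] at h1
    simp only [id, boundaryStep, if_pos hi] at h1
    simp only [rows]
    omega
  · simp only [rows]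
    rw [hrow sig i (by omega), hrow tau i (by omega)]

/-- Agreement of all h_m gives inclusions of coordinate sets in both directions. One coincidence of
phases already shows that the difference of the means is an integer, and by symmetry it may be taken
nonnegative. -/
theorem exists_complete_bethePoint_ne (hn : 0 < n) (hk : 0 < k) {sig tau : Weight n k}
    (hne : sig ≠ tau) :
    ∃ m : ℕ, complete (bethePoint n k sig.1) m ≠ complete (bethePoint n k tau.1) m := by
  by_contra! h
  apply hne
  have hx : ∀ (mu : Weight n k) (i : Fin k), bethePoint n k mu.1 i ≠ 0 := fun mu i =>
    neg_ne_zero.2 (phase_ne_zero _)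
  have h1 := exists_eq_of_complete_eq (hx sig) h
  have h2 := exists_eq_of_complete_eq (hx tau) fun m => (h m).symm
  obtain ⟨j, hj⟩ := h1 ⟨0, hk⟩
  obtain ⟨t, ht⟩ := (phase_eq_phase_iff hn).1 (neg_injective hj)
  rcases le_total 0 ((boundaryStep n sig.1 (n + (⟨0, hk⟩ : Fin k)) : ℤ) -
      boundaryStep n tau.1 (n + j) + (n + k) * t) with hd | hd
  · exact eq_of_bethePoint_aux hn hk hd ht h2
  · refine (eq_of_bethePoint_aux hn hk (neg_nonneg.2 hd) ?_ h1).symm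
    rw [mul_neg, ht, neg_sub]

end Separation

/-! ### Invertibility of S and the fusion coefficients. -/

section Span

variable {n k : ℕ}

/-- The function `σ ↦ s_α(x_σ)` on the solutions of the Bethe ansatz equations. -/
noncomputable def schurValue (n k : ℕ) (α : Fin k → ℕ) : Weight n k → ℂ :=
  fun sig => evalSym (bethePoint n k sig.1) (schur ℂ α)

theorem value_schurValue (hn : 0 < n) {α : Fin k → ℕ} {t : SchurTerm k}
    (ht : SchurTerm.IsResult n α t) : t.value (schurValue n k) = schurValue n k α := by
  refine SchurTerm.value_eq_of_isResult ?_ ?_ ?_ ht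
  · intro α hk hα
    funext sig
    have h := evalSym_bethePoint_of_mem hn hk sig.inBox
      (schur_sub_mem_betheIdeal ℂ n hk 1 α hα)
    rw [map_one, one_mul, map_sub, sub_eq_zero] at h
    exact h
  · intro α i h h1
    funext sig
    simp only [schurValue, Pi.neg_apply]
    rw [schur_straighten ℂ α i h h1, map_neg]
  · intro α i h h1
    funext sig
    simp only [schurValue, schur_eq_zero ℂ α i h h1, map_zero, Pi.zero_apply]

theorem exists_weight_of_isReduced (hn : 0 < n) {α : Fin k → ℕ} (h1 : Antitone α)
    (h2 : ∀ i, α i < n) : ∃ kap : Weight n k, parts k kap.1.transpose = α := by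
  obtain ⟨lam, h3, h4⟩ := exists_youngDiagram (k := k)
    (y := fun i => if h : i < k then (α ⟨i, h⟩ : ℤ) else 0) ⟨fun i => by
      split_ifs with h h'
      · have := h1 (show (⟨i, h'⟩ : Fin k) ≤ ⟨i + 1, h⟩ from Nat.le_succ i)
        omega
      · omega
      · omega
      · omega, fun i => by split_ifs <;> omega, fun i hi => dif_neg (by omega)⟩
  have h5 : ∀ i : Fin k, lam.rowLen i = α i := by
    intro i
    have := congrFun h3 i
    simp only [rows, Fin.is_lt, dif_pos, Fin.eta] at this
    omega
  refine ⟨⟨lam.transpose, ?_, ?_⟩, ?_⟩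
  · rw [YoungDiagram.colLen_transpose]
    by_cases hk : 0 < k
    · have h6 := h5 ⟨0, hk⟩
      have h7 := h2 ⟨0, hk⟩
      simp only at h6
      omega
    · rw [rowLen_eq_zero (by omega)]
      omega
  · rw [YoungDiagram.rowLen_transpose]
    exact h4
  · funext i
    rw [YoungDiagram.transpose_transpose]
    exact h5 i

theorem parts_transpose_injective {kap nu : Weight n k}
    (h : parts k kap.1.transpose = parts k nu.1.transpose) : kap = nu := by
  apply Subtype.ext
  rw [← YoungDiagram.transpose_eq_iff]
  apply rows_injective
  funext i
  have hz : ∀ mu : Weight n k, k ≤ i → mu.1.transpose.rowLen i = 0 := fun mu hi =>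
    rowLen_eq_zero (by rw [YoungDiagram.colLen_transpose]; exact mu.2.2.trans hi)
  by_cases hi : i < k
  · have := congrFun h ⟨i, hi⟩
    simp only [parts] at this
    simp only [rows, this]
  · simp only [rows]
    rw [hz kap (not_lt.1 hi), hz nu (not_lt.1 hi)]

/-- The span of the functions `σ ↦ s_{κᵗ}(x_σ)`. -/
noncomputable def schurSpan (n k : ℕ) : Submodule ℂ (Weight n k → ℂ) :=
  Submodule.span ℂ (Set.range fun kap : Weight n k => schurValue n k (parts k kap.1.transpose))

/-- A reduction preserves the function on the Bethe points and ends in zero or a reduced term, which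
is labelled by a weight. -/
theorem schurValue_mem_schurSpan (hn : 0 < n) (hk : 0 < k) (α : Fin k → ℕ) :
    schurValue n k α ∈ schurSpan n k := by
  obtain ⟨t, ht⟩ := SchurTerm.exists_isResult hn hk α
  rw [← value_schurValue hn ht]
  cases t with
  | zero => exact Submodule.zero_mem _
  | signed ε β =>
    obtain ⟨kap, rfl⟩ := exists_weight_of_isReduced hn ht.2.1 ht.2.2
    have : SchurTerm.value (schurValue n k) (SchurTerm.signed ε (parts k kap.1.transpose)) =
        ((ε : ℤ) : ℂ) • schurValue n k (parts k kap.1.transpose) := by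
      funext sig
      simp [SchurTerm.value]
    rw [this]
    exact Submodule.smul_mem _ _ (Submodule.subset_span ⟨kap, rfl⟩)

theorem complete_mul_schurValue (m : ℕ) (α : Fin k → ℕ) :
    (fun sig : Weight n k => complete (bethePoint n k sig.1) m) * schurValue n k α =
      ∑ β ∈ Finset.piAntidiag Finset.univ m, schurValue n k (α + β) := by
  funext sig
  simp only [Pi.mul_apply, Finset.sum_apply, schurValue, evalSym_schur]
  rw [complete_mul_jacobiTrudi]
  refine Finset.sum_congr rfl fun β _ => ?_
  congr 1
  funext i
  simp only [exponents, Pi.add_apply]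
  push_cast
  ring

/-- A product with h_m is a sum of Schur functions of possibly unordered sequences, and all of these
lie in the span by reduction. -/
theorem complete_mul_mem_schurSpan (hn : 0 < n) (hk : 0 < k) (m : ℕ) {v : Weight n k → ℂ}
    (hv : v ∈ schurSpan n k) :
    (fun sig : Weight n k => complete (bethePoint n k sig.1) m) * v ∈ schurSpan n k := by
  unfold schurSpan at hv
  induction hv using Submodule.span_induction with
  | mem v h =>
    obtain ⟨kap, rfl⟩ := h
    rw [complete_mul_schurValue]
    exact Submodule.sum_mem _ fun β _ => schurValue_mem_schurSpan hn hk _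
  | zero => rw [mul_zero]; exact Submodule.zero_mem _
  | add v w _ _ h1 h2 => rw [mul_add]; exact Submodule.add_mem _ h1 h2
  | smul c v _ h => rw [mul_smul_comm]; exact Submodule.smul_mem _ _ h

theorem one_mem_schurSpan (hn : 0 < n) (hk : 0 < k) : (1 : Weight n k → ℂ) ∈ schurSpan n k := by
  have : (1 : Weight n k → ℂ) = schurValue n k 0 := by
    funext sig
    rw [schurValue, evalSym_schur, Pi.one_apply, ← jacobiTrudi_staircase (bethePoint n k sig.1)]
    congr 1
    funext i
    simp [exponents]
  rw [this]
  exact schurValue_mem_schurSpan hn hk _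

/-- Lagrange interpolation: the span contains 1 and is stable under multiplication by the h_m, which
separate the Bethe points. -/
theorem single_mem_schurSpan (hn : 0 < n) (hk : 0 < k) (sig : Weight n k) :
    (Pi.single sig 1 : Weight n k → ℂ) ∈ schurSpan n k := by
  have hex : ∀ tau : Weight n k, tau ≠ sig → ∃ m : ℕ,
      complete (bethePoint n k sig.1) m ≠ complete (bethePoint n k tau.1) m :=
    fun tau h => exists_complete_bethePoint_ne hn hk h.symm
  choose! m hm using hex
  set P : Weight n k → Weight n k → ℂ := fun tau kap =>
    complete (bethePoint n k kap.1) (m tau) - complete (bethePoint n k tau.1) (m tau)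
  have hmem : ∀ s : Finset (Weight n k), ∏ tau ∈ s, P tau ∈ schurSpan n k := by
    intro s
    induction s using Finset.induction_on with
    | empty => rw [prod_empty]; exact one_mem_schurSpan hn hk
    | insert tau s hs ih =>
      rw [prod_insert hs]
      have : P tau * ∏ tau ∈ s, P tau =
          (fun kap : Weight n k => complete (bethePoint n k kap.1) (m tau)) * ∏ tau ∈ s, P tau -
          complete (bethePoint n k tau.1) (m tau) • ∏ tau ∈ s, P tau := by
        funext kap
        simp only [P, Pi.mul_apply, Pi.sub_apply, Pi.smul_apply, smul_eq_mul]
        ring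
      rw [this]
      exact Submodule.sub_mem _ (complete_mul_mem_schurSpan hn hk _ ih)
        (Submodule.smul_mem _ _ ih)
  have hval : (Pi.single sig 1 : Weight n k → ℂ) =
      ((∏ tau ∈ univ.erase sig, P tau) sig)⁻¹ • ∏ tau ∈ univ.erase sig, P tau := by
    funext kap
    rw [Pi.smul_apply, smul_eq_mul]
    by_cases h : kap = sig
    · subst h
      rw [Pi.single_eq_same, inv_mul_cancel₀]
      rw [Finset.prod_apply, Finset.prod_ne_zero_iff]
      intro tau htau
      exact sub_ne_zero.2 (hm tau (ne_of_mem_erase htau))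
    · rw [Pi.single_eq_of_ne h]
      have : (∏ tau ∈ univ.erase sig, P tau) kap = 0 := by
        rw [Finset.prod_apply]
        exact Finset.prod_eq_zero (mem_erase.2 ⟨h, mem_univ kap⟩) (sub_self _)
      rw [this, mul_zero]
  rw [hval]
  exact Submodule.smul_mem _ _ (hmem _)

/-- By `modularS_eq`, S is the matrix of reduced Schur values times the diagonal matrix of the
S_{∅σ}. The first is invertible because its rows span all functions, the second because the
Vandermonde alternants do not vanish. -/
theorem isUnit_det_modularS (hn : 0 < n) (hk : 0 < k) : IsUnit (modularS n k).det := by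
  have hex : ∀ sig : Weight n k, ∃ c : Weight n k → ℂ,
      ∑ kap, c kap • schurValue n k (parts k kap.1.transpose) = Pi.single sig 1 := fun sig =>
    (Submodule.mem_span_range_iff_exists_fun ℂ).1 (single_mem_schurSpan hn hk sig)
  choose c hc using hex
  set E : Matrix (Weight n k) (Weight n k) ℂ :=
    Matrix.of fun kap sig => schurValue n k (parts k kap.1.transpose) sig
  have h1 : Matrix.of c * E = 1 := by
    ext sig tau
    have := congrFun (hc sig) tau
    simp only [Finset.sum_apply, Pi.smul_apply, smul_eq_mul] at this
    rw [Matrix.mul_apply, Matrix.one_apply]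
    simp only [Matrix.of_apply, E, this, Pi.single_apply, eq_comm]
  have h2 : modularS n k = E * Matrix.diagonal (fun sig => modularS n k (Weight.empty n k) sig) := by
    ext lam sig
    rw [Matrix.mul_diagonal, modularS_eq hn, mul_comm]
    rfl
  have h3 : E.det ≠ 0 := by
    have := congrArg Matrix.det h1
    rw [Matrix.det_mul, Matrix.det_one] at this
    exact right_ne_zero_of_mul_eq_one this
  rw [h2, Matrix.det_mul, Matrix.det_diagonal, isUnit_iff_ne_zero]
  exact mul_ne_zero h3 (Finset.prod_ne_zero_iff.2 fun sig _ => modularS_empty_ne_zero hn sig)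

/-- S and therefore its inverse are symmetric, so the sum over the second index of both factors is
an entry of S S⁻¹. -/
theorem sum_modularS_mul_inv (hn : 0 < n) (hk : 0 < k) (kap nu : Weight n k) :
    ∑ sig, modularS n k kap sig * (modularS n k)⁻¹ nu sig = if kap = nu then 1 else 0 := by
  have hsymm : (modularS n k).transpose = modularS n k := by
    ext a b
    exact modularS_symm b a
  have h1 : modularS n k * ((modularS n k)⁻¹).transpose = 1 := by
    rw [Matrix.transpose_nonsing_inv, hsymm, Matrix.mul_nonsing_inv _ (isUnit_det_modularS hn hk)]
  have h2 := congrFun (congrFun h1 kap) nu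
  rw [Matrix.mul_apply, Matrix.one_apply] at h2
  exact h2

theorem sum_value_mul_inv (hn : 0 < n) (hk : 0 < k) {t : SchurTerm k} (ht : t.IsReduced n)
    (nu : Weight n k) :
    ∑ sig, modularS n k (Weight.empty n k) sig * t.value (schurValue n k) sig *
      (modularS n k)⁻¹ nu sig = (t.coeff (parts k nu.1.transpose) : ℂ) := by
  cases t with
  | zero => simp [SchurTerm.value, SchurTerm.coeff]
  | signed ε α =>
    obtain ⟨kap, rfl⟩ := exists_weight_of_isReduced hn ht.1 ht.2
    have h1 : ∀ sig ∈ (univ : Finset (Weight n k)), modularS n k (Weight.empty n k) sig *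
        SchurTerm.value (schurValue n k) (SchurTerm.signed ε (parts k kap.1.transpose)) sig *
        (modularS n k)⁻¹ nu sig =
        ((ε : ℤ) : ℂ) * (modularS n k kap sig * (modularS n k)⁻¹ nu sig) := by
      intro sig _
      rw [modularS_eq hn kap sig]
      simp only [SchurTerm.value, Pi.mul_apply, Pi.intCast_apply, schurValue]
      ring
    rw [Finset.sum_congr rfl h1, ← Finset.mul_sum, sum_modularS_mul_inv hn hk]
    simp only [SchurTerm.coeff]
    by_cases h : kap = nu
    · subst h
      simp
    · rw [if_neg h, if_neg fun h' => h (parts_transpose_injective h')]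
      simp

/-- The Verlinde summand is S_{∅σ} s_{λᵗ} s_{μᵗ} at the Bethe point of σ, times S⁻¹_{νσ}. Expanding
the product and replacing each term by its reduced form turns S_{∅σ} s_{κᵗ} into S_{κσ}, and the
inverse picks out κ = ν. -/
theorem fusionCoeff_eq (hn : 0 < n) (hk : 0 < k) (lam mu : Weight n k)
    (result : YoungDiagram → SchurTerm k)
    (hr : ∀ rho ∈ remaining k (lam.1.card + mu.1.card),
      SchurTerm.IsResult n (parts k rho.transpose) (result rho)) (nu : Weight n k) :
    fusionCoeff n k lam mu nu =
      ((∑ rho ∈ remaining k (lam.1.card + mu.1.card),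
        (lrCoeff lam.1.transpose mu.1.transpose rho.transpose : ℤ) *
          (result rho).coeff (parts k nu.1.transpose) : ℤ) : ℂ) := by
  have h1 : ∀ sig ∈ (univ : Finset (Weight n k)),
      modularS n k lam sig * modularS n k mu sig * (modularS n k)⁻¹ nu sig /
        modularS n k (Weight.empty n k) sig =
      ∑ rho ∈ remaining k (lam.1.card + mu.1.card),
        (lrCoeff lam.1.transpose mu.1.transpose rho.transpose : ℂ) *
          (modularS n k (Weight.empty n k) sig * (result rho).value (schurValue n k) sig *
            (modularS n k)⁻¹ nu sig) := by
    intro sig _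
    have h0 := modularS_empty_ne_zero hn sig
    have h2 := congrArg (evalSym (bethePoint n k sig.1)) (schur_mul_schur_transpose ℂ lam mu)
    rw [map_mul, map_sum] at h2
    rw [modularS_eq hn lam sig, modularS_eq hn mu sig]
    have h3 : ∀ rho ∈ remaining k (lam.1.card + mu.1.card),
        (lrCoeff lam.1.transpose mu.1.transpose rho.transpose : ℂ) *
          (modularS n k (Weight.empty n k) sig * (result rho).value (schurValue n k) sig *
            (modularS n k)⁻¹ nu sig) =
        modularS n k (Weight.empty n k) sig * (modularS n k)⁻¹ nu sig *
          evalSym (bethePoint n k sig.1)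
            (lrCoeff lam.1.transpose mu.1.transpose rho.transpose •
              schur ℂ (parts k rho.transpose)) := by
      intro rho hrho
      rw [value_schurValue hn (hr rho hrho), map_nsmul, nsmul_eq_mul]
      simp only [schurValue]
      ring
    rw [Finset.sum_congr rfl h3, ← Finset.mul_sum, ← h2]
    field_simp
  rw [fusionCoeff, Finset.sum_congr rfl h1, Finset.sum_comm]
  push_cast
  refine Finset.sum_congr rfl fun rho hrho => ?_
  rw [← Finset.mul_sum, sum_value_mul_inv hn hk (hr rho hrho).2]

end Span
-- An example that differs from the Kac-Walton formula.
-- Besides a tableau, finiteness is needed, because `Nat.card` is 0 on infinite types; it comes from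
-- the injection into the finite set of chains.
theorem lrCoeff_ne_zero {lam mu rho : YoungDiagram} {k : ℕ} (hlam : lam.colLen 0 ≤ k)
    (hmu : mu.colLen 0 ≤ k) (hrho : rho.colLen 0 ≤ k) (T : LRTableau lam mu rho) :
    lrCoeff lam mu rho ≠ 0 := by
  have hfin : Finite (LRTableau lam mu rho) := by
    refine Finite.of_injective (β := chains k (rows lam) (rows mu) k)
      (fun T => ⟨(tableauEquiv hmu hrho T).1,
        (mem_chains (isPartition_rows hlam)).2 (tableauEquiv hmu hrho T).2.1.1⟩) fun T T' h => ?_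
    have h1 : (tableauEquiv hmu hrho T).1 = (tableauEquiv hmu hrho T').1 := Subtype.mk.inj h
    exact (tableauEquiv hmu hrho).injective (Subtype.ext h1)
  exact Nat.card_ne_zero.2 ⟨⟨T⟩, hfin⟩

theorem exists_column (n : ℕ) (hn : 0 < n) : ∃ lam : YoungDiagram,
    (∀ i, lam.rowLen i = if i < n then 1 else 0) ∧ (∀ j, lam.colLen j = if j = 0 then n else 0) ∧
      lam.card = n := by
  obtain ⟨lam, -, h2, h3⟩ := rows_column n hn
  have h4 : lam.colLen 0 = n := by simp [h3]
  have h5 : ∀ i, lam.rowLen i = if i < n then 1 else 0 := by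
    intro i
    split_ifs with hi
    · exact h2 ⟨i, hi⟩
    · exact rowLen_eq_zero (by omega)
  refine ⟨lam, h5, h3, ?_⟩
  rw [card_eq_sum_rowLen h4.le, Finset.sum_congr rfl fun i hi => by
    rw [h5, if_pos (mem_range.1 hi)]]
  simp

/-- For columns, the tableau with the entries `0, 1, …` from top to bottom. -/
theorem lrCoeff_column_ne_zero {lam mu rho : YoungDiagram} {a b : ℕ}
    (hlam : ∀ i, lam.rowLen i = if i < a then 1 else 0)
    (hmu : ∀ i, mu.rowLen i = if i < b then 1 else 0)
    (hrho : ∀ i, rho.rowLen i = if i < a + b then 1 else 0) : lrCoeff lam mu rho ≠ 0 := by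
  have hcol : ∀ {κ : YoungDiagram} {c : ℕ}, (∀ i, κ.rowLen i = if i < c then 1 else 0) →
      c ≤ a + b → κ.colLen 0 ≤ a + b := by
    intro κ c hκ hc
    by_contra! hlt
    have h1 := cell_iff.2 hlt
    rw [hκ, if_neg (by omega)] at h1
    omega
  have hmem : ∀ i j, (i, j) ∈ rho.cells \ lam.cells ↔ (a ≤ i ∧ i < a + b) ∧ j = 0 := by
    intro i j
    rw [mem_cells_sdiff, hlam, hrho]
    split_ifs <;> omega
  refine lrCoeff_ne_zero (hcol hlam (by omega)) (hcol hmu (by omega)) (hcol hrho le_rfl)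
    { entry := fun i j => if (i, j) ∈ rho.cells \ lam.cells then i - a else 0
      le := ?_
      zeros := fun i j h => if_neg h
      row_weak := ?_
      col_strict := ?_
      content := ?_
      lattice := ?_ }
  · rintro ⟨i, j⟩ h
    change (i, j) ∈ lam at h
    rw [YoungDiagram.mem_iff_lt_rowLen] at h ⊢
    rw [hlam] at h
    rw [hrho]
    split_ifs at h ⊢ <;> omega
  · intro i j₁ j₂ hj h1 h2
    rw [hmem] at h1 h2
    omega
  · intro i₁ i₂ j hi h1 h2
    rw [if_pos h1, if_pos h2]
    rw [hmem] at h1 h2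
    omega
  · intro m
    rw [hmu]
    split_ifs with hm
    · rw [card_eq_one]
      refine ⟨(a + m, 0), ?_⟩
      ext ⟨i, j⟩
      rw [mem_filter, mem_singleton, Prod.mk.injEq]
      constructor
      · rintro ⟨h1, h2⟩
        simp only at h2
        rw [hmem] at h1
        omega
      · rintro ⟨rfl, rfl⟩
        have h1 : (a + m, 0) ∈ rho.cells \ lam.cells := (hmem _ _).2 (by omega)
        simp only
        exact ⟨h1, by omega⟩
    · rw [card_eq_zero, filter_eq_empty_iff]
      rintro ⟨i, j⟩ h1
      simp only
      rw [hmem] at h1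
      omega
  · intro i j hij m
    -- Every entry m + 1 has the entry m in the cell above it, which is read earlier.
    refine card_le_card_of_injOn (fun c => (c.1 - 1, c.2)) ?_ ?_
    · rintro ⟨i', j'⟩ h
      rw [mem_coe, mem_filter] at h
      obtain ⟨h1, h2, h3⟩ := h
      simp only [if_pos h1] at h2 h3
      rw [hmem] at h1 hij
      have h4 : (i' - 1, j') ∈ rho.cells \ lam.cells := by
        rw [hmem]
        omega
      rw [mem_coe, mem_filter]
      simp only [if_pos h4]
      exact ⟨h4, by omega, by omega⟩
    · rintro ⟨i₁, j₁⟩ h1 ⟨i₂, j₂⟩ h2 h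
      rw [mem_coe, mem_filter] at h1 h2
      have h3 := h1.2.2
      have h4 := h2.2.2
      simp only [if_pos h1.1, if_pos h2.1] at h3 h4
      simp only [Prod.mk.injEq] at h ⊢
      omega

/-- For rows, the tableau all of whose entries are `0`. -/
theorem lrCoeff_row_ne_zero {lam mu rho : YoungDiagram} {a b : ℕ}
    (hlam : ∀ i, lam.rowLen i = if i = 0 then a else 0)
    (hmu : ∀ i, mu.rowLen i = if i = 0 then b else 0)
    (hrho : ∀ i, rho.rowLen i = if i = 0 then a + b else 0) : lrCoeff lam mu rho ≠ 0 := by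
  have hcol : ∀ {κ : YoungDiagram} {c : ℕ}, (∀ i, κ.rowLen i = if i = 0 then c else 0) →
      κ.colLen 0 ≤ 1 := by
    intro κ c hκ
    by_contra! hlt
    have h1 := cell_iff.2 hlt
    rw [hκ, if_neg (by omega)] at h1
    omega
  have hmem : ∀ i j, (i, j) ∈ rho.cells \ lam.cells ↔ i = 0 ∧ a ≤ j ∧ j < a + b := by
    intro i j
    rw [mem_cells_sdiff, hlam, hrho]
    split_ifs <;> omega
  have hcells : rho.cells \ lam.cells = (Ico a (a + b)).image fun j => (0, j) := by
    ext ⟨i, j⟩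
    rw [hmem]
    simp only [mem_image, mem_Ico, Prod.mk.injEq]
    constructor
    · rintro ⟨rfl, h⟩
      exact ⟨j, h, rfl, rfl⟩
    · rintro ⟨j', h, rfl, rfl⟩
      exact ⟨rfl, h⟩
  refine lrCoeff_ne_zero (hcol hlam) (hcol hmu) (hcol hrho)
    { entry := fun i j => 0
      le := ?_
      zeros := fun i j h => rfl
      row_weak := fun i j₁ j₂ _ _ _ => le_rfl
      col_strict := ?_
      content := ?_
      lattice := fun i j _ m => ?_ }
  · rintro ⟨i, j⟩ h
    change (i, j) ∈ lam at h
    rw [YoungDiagram.mem_iff_lt_rowLen] at h ⊢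
    rw [hlam] at h
    rw [hrho]
    split_ifs at h ⊢ <;> omega
  · intro i₁ i₂ j hi h1 h2
    rw [hmem] at h1 h2
    omega
  · intro m
    rw [hmu, hcells]
    by_cases hm : m = 0
    · subst hm
      rw [filter_true_of_mem fun _ _ => rfl, card_image_of_injective _ (Prod.mk_right_injective 0)]
      simp
    · simp [hm, eq_comm]
  · simp

/-- With a single part, a reduction takes the part modulo `n`. -/
theorem coeff_ne_zero_of_isResult_one {n : ℕ} {α β : Fin 1 → ℕ}
    (h : α 0 % n = β 0) {t : SchurTerm 1} (ht : SchurTerm.IsResult n α t) : t.coeff β ≠ 0 := by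
  -- The indicator of the residue class of β modulo `n` is invariant under the rim rule, and with
  -- one part there are no other rules. Its value 1 at α forces the result to be ± s_β.
  have hv := SchurTerm.value_eq_of_isResult
    (f := fun α : Fin 1 → ℕ => if α 0 % n = β 0 then (1 : ℤ) else 0)
    (fun α hk hα => by
      have h1 : rimReduce n α 0 = α 0 - n := by simp [rimReduce]
      have h2 : n ≤ α 0 := hα
      rw [h1, Nat.mod_eq_sub_mod h2])
    (fun α i h => by omega) (fun α i h => by omega) ht
  cases t with
  | zero => simp [SchurTerm.value, h] at hv
  | signed ε γ =>
    have hγ : γ 0 < n := ht.2.2 0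
    simp only [SchurTerm.value, Nat.mod_eq_of_lt hγ, if_pos h] at hv
    have hγβ : γ 0 = β 0 := by
      by_contra hne
      simp [hne] at hv
    have : γ = β := funext fun i => by rw [Subsingleton.elim i 0, hγβ]
    simp [SchurTerm.coeff, this]

theorem exists_coeff_ne_kacWaltonCoeff : ∃ (n k : ℕ) (lam mu nu : Weight n k) (rho : YoungDiagram),
    2 ≤ n ∧ 1 ≤ k ∧ rho ∈ remaining k (lam.1.card + mu.1.card) ∧
    lrCoeff lam.1 mu.1 rho ≠ 0 ∧ lrCoeff lam.1.transpose mu.1.transpose rho.transpose ≠ 0 ∧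
    ∀ t : SchurTerm k, SchurTerm.IsResult n (parts k rho.transpose) t →
      t.coeff (parts k nu.1.transpose) ≠ kacWaltonCoeff n k nu.1 rho := by
  -- Here n = 3, k = 1, λ = μ = (1,1), ν = (1) and ρ = (1,1,1,1). With four rows ρ does not label a
  -- weight in the Kac-Walton sum, whereas ρᵗ = (4) reduces to (1) = νᵗ.
  obtain ⟨lam, hlam1, hlam2, hlam3⟩ := exists_column 2 (by norm_num)
  obtain ⟨nu, hnu1, hnu2, -⟩ := exists_column 1 (by norm_num)
  obtain ⟨rho, hrho1, hrho2, hrho3⟩ := exists_column 4 (by norm_num)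
  let lam' : Weight 3 1 := ⟨lam, by simp [hlam2], by simp [hlam1]⟩
  refine ⟨3, 1, lam', lam', ⟨nu, by simp [hnu2], by simp [hnu1]⟩, rho, by norm_num, le_rfl,
    ?_, lrCoeff_column_ne_zero hlam1 hlam1 hrho1,
    lrCoeff_row_ne_zero (a := 2) (b := 2) ?_ ?_ ?_, fun t ht => ?_⟩
  · simp [mem_remaining, lam', hlam3, hrho3, hrho1]
  · simpa [lam'] using hlam2
  · simpa [lam'] using hlam2
  · simpa using hrho2
  · have h0 : kacWaltonCoeff 3 1 nu rho = 0 := if_neg (by simp [hrho2])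
    change _ ≠ kacWaltonCoeff 3 1 nu rho
    rw [h0]
    exact coeff_ne_zero_of_isResult_one (by simp [parts, hrho2, hnu2]) ht

end Fusion

theorem mainTheorem1 :
    (∀ n k : ℕ, 2 ≤ n → ∀ hk : 1 ≤ k,
      -- reduction modulo the Bethe ansatz ideal
      (∀ (R : Type*) [CommRing R] (z : R) (α : Fin k → ℕ), Antitone α → n ≤ α ⟨0, hk⟩ →
        Fusion.schur R α - algebraMap R _ z * Fusion.schur R (Fusion.rimReduce n α)
          ∈ Fusion.betheIdeal n k z) ∧
      -- straightening rules
      (∀ (R : Type*) [CommRing R] (α : Fin k → ℕ) (i : ℕ) (h : i + 1 < k),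
        (1 ≤ α ⟨i + 1, h⟩ → Fusion.schur R α = -Fusion.schur R (Fusion.straighten α i h)) ∧
        (α ⟨i + 1, h⟩ = α ⟨i, by omega⟩ + 1 → Fusion.schur R α = 0)) ∧
      -- first step: Littlewood-Richardson expansion, terms of length greater than `k` discarded
      (∀ (R : Type*) [CommRing R] (lam mu : Fusion.Weight n k),
        Fusion.schur R (Fusion.parts k lam.1.transpose) *
            Fusion.schur R (Fusion.parts k mu.1.transpose) =
          ∑ rho ∈ Fusion.remaining k (lam.1.card + mu.1.card),
            Fusion.lrCoeff lam.1.transpose mu.1.transpose rho.transpose •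
              Fusion.schur R (Fusion.parts k rho.transpose)) ∧
      -- second step: the reduction terminates, and it can stop only at reduced terms
      (WellFounded fun t' t : Fusion.SchurTerm k => Fusion.SchurTerm.Step n t t') ∧
      (∀ t : Fusion.SchurTerm k,
        (∀ t', ¬ Fusion.SchurTerm.Step n t t') ↔ t.IsReduced n) ∧
      -- third step: collecting terms gives the fusion coefficients, in whatever order one reduces
      (∀ (lam mu : Fusion.Weight n k) (result : YoungDiagram → Fusion.SchurTerm k),
        (∀ rho ∈ Fusion.remaining k (lam.1.card + mu.1.card),
          Fusion.SchurTerm.IsResult n (Fusion.parts k rho.transpose) (result rho)) →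
        ∀ nu : Fusion.Weight n k,
          Fusion.fusionCoeff n k lam mu nu =
            ((∑ rho ∈ Fusion.remaining k (lam.1.card + mu.1.card),
              (Fusion.lrCoeff lam.1.transpose mu.1.transpose rho.transpose : ℤ) *
                (result rho).coeff (Fusion.parts k nu.1.transpose) : ℤ) : ℂ))) ∧
    -- the expressions in Littlewood-Richardson coefficients differ from the Kac-Walton formula
    (∃ (n k : ℕ) (lam mu nu : Fusion.Weight n k) (rho : YoungDiagram),
      2 ≤ n ∧ 1 ≤ k ∧ rho ∈ Fusion.remaining k (lam.1.card + mu.1.card) ∧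
      Fusion.lrCoeff lam.1 mu.1 rho ≠ 0 ∧
      Fusion.lrCoeff lam.1.transpose mu.1.transpose rho.transpose ≠ 0 ∧
      ∀ t : Fusion.SchurTerm k,
        Fusion.SchurTerm.IsResult n (Fusion.parts k rho.transpose) t →
        t.coeff (Fusion.parts k nu.1.transpose) ≠ Fusion.kacWaltonCoeff n k nu.1 rho) := by
  refine ⟨fun n k hn hk => ⟨fun R _ z α _ hα => Fusion.schur_sub_mem_betheIdeal R n hk z α hα,
    fun R _ α i h => ⟨Fusion.schur_straighten R α i h, Fusion.schur_eq_zero R α i h⟩,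
    fun R _ lam mu => Fusion.schur_mul_schur_transpose R lam mu,
    Fusion.SchurTerm.wellFounded_step (by omega),
    Fusion.SchurTerm.forall_not_step_iff hk,
    fun lam mu result hr nu => Fusion.fusionCoeff_eq (by omega) hk lam mu result hr nu⟩,
    Fusion.exists_coeff_ne_kacWaltonCoeff⟩
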